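/- Let $U\subset\mathbb R^2$ be a bounded domain (nonempty connected open set) such that every $x\in\partial U$ satisfies the Poincaré cone condition: there are a cone $V$ with apex $x$ and opening angle $\alpha>0$ and a number $h>0$ such that $V\cap B(x,h)\subset U^c$, where $B(x,h)$ is the open ball. Assume that $\partial U$ is computable in the following sense: there is a computable sequence $(C_n)_{n\in\mathbb N}$ such that, for each $n$, $C_n$ is a finite set of closed squares of the grid $2^{-n}\mathbb Z\times 2^{-n}\mathbb Z$ whose union is connected, contains $\partial U$, and has all of its points at distance at most $2^{-n+2}$ from $\partial U$. Let $\varphi:\partial U\to\mathbb R$ be computable in the following sense: there are real numbers $\varphi_n(\mathbf c)$, for $n\in\mathbb N$ and $\mathbf c\in C_n$, computable uniformly in $n$ and $\mathbf c$, and a computable sequence of real numbers $\epsilon(n)$ that tends to $0$ with a computable modulus of convergence, such that for all $n$: $|\varphi_n(\mathbf c)-\varphi(y)|\le\epsilon(n)$ for all $\mathbf c\in C_n$ and $y\in\partial U\cap\mathbf c$, and $|\varphi_n(\mathbf c)-\varphi_n(\mathbf c')|\le\epsilon(n)$ for all $\mathbf c,\mathbf c'\in C_n$ that share an edge. Then there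 is a unique continuous function $u:\overline U\to\mathbb R$ that is harmonic on $U$ and satisfies $u(x)=\varphi(x)$ for all $x\in\partial U$, and $u$ is computable on $\overline U$: there is an algorithm which, given as an oracle any sequence of dyadic points $(q_j)_{j\in\mathbb N}$, $q_j\in 2^{-j}\mathbb Z\times 2^{-j}\mathbb Z$, with $|x-q_j|\le 2^{-j}$ for all $j$, for a point $x\in\overline U$, and given $k\in\mathbb N$ as input, outputs an integer $r$ with $|u(x)-r2^{-k}|\le 2^{-k}$. -/

import Mathlib

/-! The plane is `ℂ`, with its Euclidean norm and its real inner product. -/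

/-- The closed cone with apex `x`, unit axis `v` and (half) opening angle `α`, for `0 < α < π`. -/
def planarCone (x v : ℂ) (α : ℝ) : Set ℂ :=
  {p | ‖p - x‖ * Real.cos α ≤ inner ℝ (p - x) v}

/-- The Poincaré cone condition for `U` at the point `x`. -/
def PoincareConeAt (U : Set ℂ) (x : ℂ) : Prop :=
  ∃ v : ℂ, ‖v‖ = 1 ∧ ∃ α : ℝ, 0 < α ∧ α < Real.pi ∧ ∃ h : ℝ, 0 < h ∧
    planarCone x v α ∩ Metric.ball x h ⊆ Uᶜ

/-- The closed square of the grid `2⁻ⁿℤ × 2⁻ⁿℤ` with lower left corner `2⁻ⁿ c`. -/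
def gridSquare (n : ℕ) (c : ℤ × ℤ) : Set ℂ :=
  {z | (c.1 : ℝ) / 2 ^ n ≤ z.re ∧ z.re ≤ ((c.1 : ℝ) + 1) / 2 ^ n ∧
       (c.2 : ℝ) / 2 ^ n ≤ z.im ∧ z.im ≤ ((c.2 : ℝ) + 1) / 2 ^ n}

/-- The union of a finite list of squares of the grid `2⁻ⁿℤ × 2⁻ⁿℤ`. -/
def gridUnion (n : ℕ) (L : List (ℤ × ℤ)) : Set ℂ :=
  ⋃ c ∈ L, gridSquare n c

/-- Two grid squares are adjacent when they are distinct and share an edge. -/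
def GridAdjacent (c d : ℤ × ℤ) : Prop :=
  |c.1 - d.1| + |c.2 - d.2| = 1

/-- The sequence `C` of finite sets of grid squares is a computable approximation of the
planar set `K`. -/
structure IsComputableApproximation (K : Set ℂ) (C : ℕ → List (ℤ × ℤ)) : Prop where
  computable : Computable C
  connected : ∀ n, IsConnected (gridUnion n (C n))
  covers : ∀ n, K ⊆ gridUnion n (C n)
  close : ∀ n, ∀ z ∈ gridUnion n (C n), ∃ y ∈ K, dist z y ≤ 4 / 2 ^ n

/-- The real numbers `f i`, for `i ∈ S`, are uniformly computable: a single algorithm produces, from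
`i ∈ S` and `k`, a dyadic number `m / 2ᵏ` within `2⁻ᵏ` of `f i`. -/
def UniformlyComputableOn {ι : Type*} [Primcodable ι] (S : Set ι) (f : ι → ℝ) : Prop :=
  ∃ g : ι → ℕ → ℤ, Computable₂ g ∧ ∀ i ∈ S, ∀ k : ℕ, |f i - (g i k : ℝ) / 2 ^ k| ≤ 1 / 2 ^ k

/-- The sequence `ε` tends to `0` with a computable modulus of convergence. -/
def TendsToZeroComputably (ε : ℕ → ℝ) : Prop :=
  ∃ m : ℕ → ℕ, Computable m ∧ ∀ k n : ℕ, m k ≤ n → |ε n| ≤ 1 / 2 ^ k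

/-- The function `φ` on `K` is computable relative to the approximation `C` of `K`: there are
uniformly computable values `ψ n c`, for `c` in `C n`, and a computable sequence `ε` tending
computably to `0`, such that `ψ n c` is `ε n`-close to the values of `φ` on `K ∩ c` and
`ε n`-close to `ψ n d` whenever the squares `c` and `d` of `C n` are adjacent. -/
def IsComputableCondition (K : Set ℂ) (C : ℕ → List (ℤ × ℤ)) (φ : ℂ → ℝ) : Prop :=
  ∃ (ψ : ℕ → ℤ × ℤ → ℝ) (ε : ℕ → ℝ),
    UniformlyComputableOn {p : ℕ × (ℤ × ℤ) | p.2 ∈ C p.1} (fun p => ψ p.1 p.2) ∧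
    UniformlyComputableOn Set.univ ε ∧
    TendsToZeroComputably ε ∧
    (∀ n, ∀ c ∈ C n, ∀ y ∈ K ∩ gridSquare n c, |ψ n c - φ y| ≤ ε n) ∧
    (∀ n, ∀ c ∈ C n, ∀ d ∈ C n, GridAdjacent c d → |ψ n c - ψ n d| ≤ ε n)

/-- The dyadic point `2⁻ᵏ a` of the plane. -/
noncomputable def dyadicPoint (k : ℕ) (a : ℤ × ℤ) : ℂ :=
  ⟨(a.1 : ℝ) / 2 ^ k, (a.2 : ℝ) / 2 ^ k⟩

/-- `a` is a name of `z`: a sequence of dyadic points whose `k`-th term is within `2⁻ᵏ` of `z`. -/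
def IsPointName (a : ℕ → ℤ × ℤ) (z : ℂ) : Prop :=
  ∀ k, dist z (dyadicPoint k (a k)) ≤ 1 / 2 ^ k

/-- The function `u` is computable on `S` (in the sense of computable analysis): a single algorithm
produces, from any name of any `z ∈ S` given as an oracle and any `k`, a dyadic number `r / 2ᵏ`
within `2⁻ᵏ` of `u z`. The algorithm `F` is run on longer and longer initial segments of the name;
on each of them it may ask for more (`none`) or give an answer, it must answer at some point, and
its answers must be right. -/
def IsComputableOn (u : ℂ → ℝ) (S : Set ℂ) : Prop :=
  ∃ F : List (ℤ × ℤ) → ℕ → Option ℤ, Computable₂ F ∧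
    ∀ z ∈ S, ∀ a : ℕ → ℤ × ℤ, IsPointName a z → ∀ k : ℕ,
      (∃ n r, F ((List.range n).map a) k = some r) ∧
      (∀ n r, F ((List.range n).map a) k = some r → |u z - (r : ℝ) / 2 ^ k| ≤ 1 / 2 ^ k)

/-- `u` is a solution of the Dirichlet problem on the open set `U` with boundary values `φ`
(only the values of `u` on the closure of `U` and of `φ` on the boundary of `U` matter). -/
structure IsDirichletSolution (U : Set ℂ) (φ u : ℂ → ℝ) : Prop where
  continuousOn : ContinuousOn u (closure U)
  harmonic : InnerProductSpace.HarmonicOnNhd u U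
  boundary : ∀ x ∈ frontier U, u x = φ x

/-! Write `K` for the frontier of `U`. The theorem rests on a decay estimate at points of `K`, on
solvability of the Dirichlet problem, and on finite certificates that can be found by search.

Decay. Let `a ∈ K` and suppose that `z - a` has continuous square roots at every positive distance
from the complement of `V` near `a`. A subharmonic `f ≤ M` that is nonpositive off `V` is lifted
through `z = a + s ^ 2` to one of the two sheets. The lift and its reflection `s ↦ -s` add up to at
most `M`, so the lift has circle mean at most `M / 2`, and Harnack's inequality yields `f ≤ 3 / 4 *
M` on a disc 16 times smaller. Iterating gives `subharm_le_pow`, with constants independent of `f`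
and of the fine geometry. The square roots come from the grid unions, which are connected and shrink
to `K`: a root of `z - b` exists trivially for `b ∈ K` outside the disc, and it is carried along the
union to `a` (`IsComputableApproximation.nonThinAt`).

Existence and uniqueness. For subharmonic data, sweeping along a sequence of discs increases to the
solution, and the decay estimate gives continuity at the boundary. Continuous data are uniform
limits of differences of subharmonic functions (`exists_convex_approx`, `exists_dirichlet`).
Uniqueness is the comparison principle `subharm_le_harmonic`.

Computability. The approximation of `K` does not tell on which side of `K` a grid point lies, so the
Dirichlet problem is solved on both sides of `K` inside a large disc (`exists_isTwoSidedSolution`).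
A certificate is a finite table of integers which agrees with the boundary data at grid points near
`K` and has small discrete Laplacian at the others. The rounded solution is a certificate once the
parameters are fine enough (`IsTwoSidedSolution.exists_isCertificateAt`). Conversely every
certificate is close to the solution on the closure of `U`, by the decay estimate near `K` and the
discrete maximum principle elsewhere (`IsTwoSidedSolution.abs_sub_le_of_isCertificateAt`). Being a
certificate is decidable, so an unbounded search computes the solution. -/

open Filter Topology Metric Set InnerProductSpace

/-! ### Subharmonic functions and the comparison principle -/

/-- `v` is subharmonic at `z`, in the viscosity sense: a function harmonic near `z` can touch `v`
from above at `z`, up to a constant, only if `v` differs from it by a constant near `z`. -/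
def SubharmAt (v : ℂ → ℝ) (z : ℂ) : Prop :=
  ∀ h : ℂ → ℝ, HarmonicAt h z → (∀ᶠ w in 𝓝 z, v w - h w ≤ v z - h z) →
    ∀ᶠ w in 𝓝 z, v w - h w = v z - h z

theorem InnerProductSpace.HarmonicAt.exists_analytic {h : ℂ → ℝ} {z : ℂ} (hh : HarmonicAt h z) :
    ∃ F : ℂ → ℂ, AnalyticAt ℂ F z ∧ ∀ᶠ w in 𝓝 z, h w = (F w).re := by
  obtain ⟨r, hr, hr'⟩ := Metric.isOpen_iff.1 (isOpen_setOfPred_harmonicAt (f := h)) z hh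
  obtain ⟨F, hF, hF'⟩ := HarmonicOnNhd.exists_analyticOnNhd_ball_re_eq (fun _ hy => hr' hy)
  exact ⟨F, hF z (mem_ball_self hr),
    eventually_of_mem (ball_mem_nhds z hr) fun w hw => (hF' hw).symm⟩

/-- With `h` the real part of an analytic `F`, this is the maximum modulus principle for `exp ∘ F`,
whose modulus is `exp ∘ h`. -/
theorem InnerProductSpace.HarmonicAt.eventually_eq_of_le {h : ℂ → ℝ} {z : ℂ} (hh : HarmonicAt h z)
    (hmax : ∀ᶠ w in 𝓝 z, h w ≤ h z) : ∀ᶠ w in 𝓝 z, h w = h z := by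
  obtain ⟨F, hF, hF'⟩ := hh.exists_analytic
  have h1 : ∀ᶠ w in 𝓝 z, DifferentiableAt ℂ (fun w => Complex.exp (F w)) w := by
    filter_upwards [hF.eventually_analyticAt] with w hw using hw.differentiableAt.cexp
  have h2 : IsLocalMax (norm ∘ fun w => Complex.exp (F w)) z := by
    filter_upwards [hmax, hF'] with w hw hw'
    simp only [Function.comp, Complex.norm_exp]
    rw [← hw', ← hF'.self_of_nhds]
    exact Real.exp_le_exp.2 hw
  filter_upwards [Complex.eventually_eq_of_isLocalMax_norm h1 h2, hF'] with w hw hw'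
  have := congrArg norm hw
  rw [Complex.norm_exp, Complex.norm_exp, Real.exp_eq_exp] at this
  rw [hw', this, hF'.self_of_nhds]

theorem InnerProductSpace.HarmonicAt.subharmAt {v : ℂ → ℝ} {z : ℂ} (hv : HarmonicAt v z) : SubharmAt v z := by
  intro h hh hm
  exact (hv.sub hh).eventually_eq_of_le hm

theorem SubharmAt.congr {v w : ℂ → ℝ} {z : ℂ} (hv : SubharmAt v z) (h : ∀ᶠ y in 𝓝 z, v y = w y) :
    SubharmAt w z := by
  intro g hg hm
  have h0 := h.self_of_nhds
  have := hv g hg (by filter_upwards [hm, h] with y h1 h2; rw [h2, h0]; exact h1)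
  filter_upwards [this, h] with y h1 h2
  rw [← h2, ← h0]; exact h1

theorem SubharmAt.sub_harmonic {v g : ℂ → ℝ} {z : ℂ} (hv : SubharmAt v z) (hg : HarmonicAt g z) :
    SubharmAt (fun w => v w - g w) z := by
  intro h hh hm
  have := hv (g + h) (hg.add hh) (by
    filter_upwards [hm] with y hy
    simp only [Pi.add_apply]; linarith)
  filter_upwards [this] with y hy
  simp only [Pi.add_apply] at hy; linarith

theorem harmonicAt_constant (c : ℝ) (z : ℂ) : HarmonicAt (fun _ : ℂ => c) z :=
  harmonicOnNhd_const (s := univ) c z (mem_univ z)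

theorem SubharmAt.sub_const {v : ℂ → ℝ} {z : ℂ} (hv : SubharmAt v z) (c : ℝ) :
    SubharmAt (fun w => v w - c) z :=
  hv.sub_harmonic (harmonicAt_constant c z)

/-- If `v ≤ w` near `z`, with equality at `z`, then subharmonicity passes from `v` to `w`. -/
theorem SubharmAt.of_le {v w : ℂ → ℝ} {z : ℂ} (hv : SubharmAt v z) (h : ∀ᶠ y in 𝓝 z, v y ≤ w y)
    (h0 : v z = w z) : SubharmAt w z := by
  intro g hg hm
  have := hv g hg (by filter_upwards [hm, h] with y h1 h2; linarith)
  filter_upwards [this, hm, h] with y h1 h2 h3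
  linarith

theorem SubharmAt.max {v w : ℂ → ℝ} {z : ℂ} (hv : SubharmAt v z) (hw : SubharmAt w z) :
    SubharmAt (fun y => max (v y) (w y)) z := by
  rcases le_total (v z) (w z) with h | h
  · exact hw.of_le (Eventually.of_forall fun y => le_max_right _ _) (max_eq_right h).symm
  · exact hv.of_le (Eventually.of_forall fun y => le_max_left _ _) (max_eq_left h).symm

theorem harmonicAt_re_mul (p q z : ℂ) : HarmonicAt (fun w : ℂ => (p * w + q).re) z :=
  AnalyticAt.harmonicAt_re (f := fun w => p * w + q) (by fun_prop)

/-- Convex functions are subharmonic: the supporting affine function is harmonic, lies below `s` and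
touches it at `z`. -/
theorem subharmAt_of_supporting {s : ℂ → ℝ} {z p : ℂ}
    (hp : ∀ w, s z + (p * (w - z)).re ≤ s w) : SubharmAt s z := by
  have h := (harmonicAt_re_mul p (s z - p * z) z).subharmAt
  refine h.of_le (Eventually.of_forall fun y => ?_) ?_
  · have := hp y
    rw [mul_sub, Complex.sub_re] at this
    simp only [Complex.add_re, Complex.sub_re, Complex.ofReal_re] ; linarith
  · simp

/-- A local analytic inverse of `t ↦ a + t ^ 2` near `s ≠ 0`. -/
theorem exists_analytic_sqrt {s : ℂ} (hs : s ≠ 0) (a : ℂ) :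
    ∃ τ : ℂ → ℂ, AnalyticAt ℂ τ (a + s ^ 2) ∧ τ (a + s ^ 2) = s ∧
      (∀ᶠ z in 𝓝 (a + s ^ 2), a + τ z ^ 2 = z) ∧ ∀ᶠ t in 𝓝 s, τ (a + t ^ 2) = t := by
  have han : AnalyticAt ℂ (fun t : ℂ => a + t ^ 2) s := by fun_prop
  have hd0 : deriv (fun t : ℂ => a + t ^ 2) s ≠ 0 := by simpa using hs
  have hd := han.hasStrictDerivAt
  have hl := HasStrictDerivAt.eventually_left_inverse hd hd0
  have hr := HasStrictDerivAt.eventually_right_inverse hd hd0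
  exact ⟨hd.localInverse _ _ _ hd0, han.analyticAt_localInverse hd0, hl.self_of_nhds, hr, hl⟩

/-- Conformal invariance: a harmonic test function at `s` is transported by the local inverse of `t
↦ a + t ^ 2` to one at `a + s ^ 2`. -/
theorem SubharmAt.comp_sq {f : ℂ → ℝ} {a s : ℂ} (hs : s ≠ 0) (hf : SubharmAt f (a + s ^ 2)) :
    SubharmAt (fun t => f (a + t ^ 2)) s := by
  intro h hh hm
  obtain ⟨τ, hτ, hτs, hr, hl⟩ := exists_analytic_sqrt hs a
  have hc : Tendsto τ (𝓝 (a + s ^ 2)) (𝓝 s) := by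
    have := hτ.continuousAt.tendsto; rwa [hτs] at this
  obtain ⟨F, hF, hF'⟩ := hh.exists_analytic
  have hh' : HarmonicAt (fun z => h (τ z)) (a + s ^ 2) := by
    have h1 : AnalyticAt ℂ (fun z => F (τ z)) (a + s ^ 2) := by
      refine AnalyticAt.fun_comp ?_ hτ
      rwa [hτs]
    refine (harmonicAt_congr_nhds ?_).2 h1.harmonicAt_re
    exact hc.eventually hF'
  have key := hf _ hh' (by
    filter_upwards [hc.eventually hm, hr] with z hz hz'
    rw [hz'] at hz
    rwa [hτs])
  have hcs : Tendsto (fun t : ℂ => a + t ^ 2) (𝓝 s) (𝓝 (a + s ^ 2)) :=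
    Continuous.tendsto (by fun_prop) s
  filter_upwards [hcs.eventually key, hl] with t ht ht'
  rwa [ht', hτs] at ht

/-- The comparison principle for subharmonic and harmonic functions. -/
theorem subharm_le_harmonic {D : Set ℂ} (hD : IsOpen D) (hb : Bornology.IsBounded D)
    {v H : ℂ → ℝ} (hv : ContinuousOn v (closure D)) (hH : ContinuousOn H (closure D))
    (hvs : ∀ z ∈ D, SubharmAt v z) (hHh : ∀ z ∈ D, HarmonicAt H z)
    (hle : ∀ z ∈ frontier D, v z ≤ H z) : ∀ z ∈ closure D, v z ≤ H z := by
  by_contra! hcon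
  obtain ⟨z₀, hz₀, hlt⟩ := hcon
  have hK : IsCompact (closure D) := hb.isCompact_closure
  have hg : ContinuousOn (fun z => v z - H z) (closure D) := hv.sub hH
  obtain ⟨p, hp, hpm⟩ := hK.exists_isMaxOn ⟨z₀, hz₀⟩ hg
  have hpos : 0 < v p - H p := by
    have : v z₀ - H z₀ ≤ v p - H p := hpm hz₀
    linarith
  set S := closure D ∩ {z | v z - H z = v p - H p} with hS
  have hSc : IsCompact S := by
    have : IsClosed (closure D ∩ (fun z => v z - H z) ⁻¹' {v p - H p}) :=
      hg.preimage_isClosed_of_isClosed isClosed_closure isClosed_singleton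
    exact hK.of_isClosed_subset this inter_subset_left
  -- Choosing the rightmost point of the maximum set avoids any connectedness assumption: `v - H` is
  -- constant near that point, so a small step to the right stays in the maximum set, which is
  -- absurd.
  obtain ⟨q, hq, hqm⟩ := hSc.exists_isMaxOn ⟨p, hp, rfl⟩ Complex.continuous_re.continuousOn
  have hqv : v q - H q = v p - H p := hq.2
  have hqD : q ∈ D := by
    by_contra hn
    have : q ∈ frontier D := by rw [hD.frontier_eq]; exact ⟨hq.1, hn⟩
    linarith [hle q this]
  have h1 := hvs q hqD H (hHh q hqD) (by
    filter_upwards [hD.mem_nhds hqD] with w hw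
    rw [hqv]; exact hpm (subset_closure hw))
  obtain ⟨ε, hε, hball⟩ := Metric.mem_nhds_iff.1 (h1.and (hD.mem_nhds hqD))
  have hmem : q + (ε / 2 : ℝ) ∈ ball q ε := by
    simp only [mem_ball, dist_eq_norm, add_sub_cancel_left, Complex.norm_real, Real.norm_eq_abs]
    rw [abs_of_pos (by linarith)]; linarith
  have h2 := hball hmem
  have h3 : (q + (ε / 2 : ℝ)).re ≤ q.re := hqm ⟨subset_closure h2.2, by
    have := h2.1
    simp only [mem_ofPred_eq]; linarith⟩
  simp at h3
  linarith

/-! ### Poisson integrals and Poisson modification -/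

/-- The Poisson integral of `f` over the circle of centre `c` and radius `R`. -/
noncomputable def poissonIntegral (c : ℂ) (R : ℝ) (f : ℂ → ℝ) (w : ℂ) : ℝ :=
  Real.circleAverage (fun ζ => poissonKernel c w ζ * f ζ) c R

section Poisson
variable {c w : ℂ} {R : ℝ} {f g : ℂ → ℝ}

theorem continuousOn_poissonKernel (hw : w ∈ ball c R) :
    ContinuousOn (poissonKernel c w) (sphere c |R|) := by
  rw [poissonKernel_eq_re_herglotzRieszKernel]
  exact Complex.continuous_re.comp_continuousOn (continuousOn_herglotzRieszKernel_sphere hw)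

theorem circleIntegrable_poissonKernel_mul (hw : w ∈ ball c R) (hf : CircleIntegrable f c R) :
    CircleIntegrable (fun ζ => poissonKernel c w ζ * f ζ) c R :=
  hf.continuousOn_smul (continuousOn_poissonKernel hw)

theorem poissonKernel_nonneg {ζ : ℂ} (hw : w ∈ ball c R) (hζ : ζ ∈ sphere c R) :
    0 ≤ poissonKernel c w ζ := by
  rw [mem_ball, dist_eq_norm] at hw
  rw [mem_sphere, dist_eq_norm] at hζ
  rw [poissonKernel, hζ]
  have := norm_nonneg (w - c)
  apply div_nonneg _ (by positivity)
  nlinarith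

theorem poissonIntegral_mono (hw : w ∈ ball c R) (hf : CircleIntegrable f c R)
    (hg : CircleIntegrable g c R) (h : ∀ ζ ∈ sphere c R, f ζ ≤ g ζ) :
    poissonIntegral c R f w ≤ poissonIntegral c R g w := by
  have hR : |R| = R := abs_of_pos (pos_of_mem_ball hw)
  refine Real.circleAverage_mono (circleIntegrable_poissonKernel_mul hw hf)
    (circleIntegrable_poissonKernel_mul hw hg) fun ζ hζ => ?_
  rw [hR] at hζ
  exact mul_le_mul_of_nonneg_left (h ζ hζ) (poissonKernel_nonneg hw hζ)

theorem poissonIntegral_of_harmonic (hf : HarmonicContOnCl f (ball c R)) (hw : w ∈ ball c R) :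
    poissonIntegral c R f w = f w :=
  hf.circleAverage_poissonKernel_smul hw

theorem poissonIntegral_const (hw : w ∈ ball c R) (a : ℝ) :
    poissonIntegral c R (fun _ => a) w = a :=
  poissonIntegral_of_harmonic harmonicContOnCl_const hw

theorem poissonIntegral_sub (hw : w ∈ ball c R) (hf : CircleIntegrable f c R)
    (hg : CircleIntegrable g c R) :
    poissonIntegral c R (fun z => f z - g z) w = poissonIntegral c R f w - poissonIntegral c R g w := by
  rw [poissonIntegral, poissonIntegral, poissonIntegral, ← Real.circleAverage_fun_sub
    (circleIntegrable_poissonKernel_mul hw hf) (circleIntegrable_poissonKernel_mul hw hg)]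
  simp only [mul_sub]

theorem poissonIntegral_congr (hR : 0 ≤ R) (h : EqOn f g (sphere c R)) :
    poissonIntegral c R f w = poissonIntegral c R g w := by
  apply Real.circleAverage_congr_sphere
  rw [abs_of_nonneg hR]
  intro z hz
  simp only [h hz]

theorem poissonIntegral_translate :
    poissonIntegral c R f w = poissonIntegral 0 R (fun z => f (z + c)) (w - c) := by
  rw [poissonIntegral, poissonIntegral, ← Real.circleAverage_map_add_const]
  simp [poissonKernel]

theorem harmonicAt_poissonIntegral (hf : CircleIntegrable f c R) (hw : w ∈ ball c R) :
    HarmonicAt (poissonIntegral c R f) w := by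
  have hf0 : CircleIntegrable (fun z => f (z + c)) 0 R := by
    simpa [CircleIntegrable, circleMap, add_comm] using hf
  have hf1 : CircleIntegrable (fun z => (f (z + c) : ℂ)) 0 R := by
    simp only [CircleIntegrable, intervalIntegrable_iff] at hf0 ⊢
    exact Complex.ofRealCLM.integrable_comp hf0
  have h1 := analyticOnNhd_circleAverage_herglotzRieszKernel_smul hf1
  have hw0 : ∀ y ∈ ball c R, y - c ∈ ball 0 R := fun y hy => by simpa using mem_ball_iff_norm.1 hy
  have h2 : AnalyticAt ℂ (fun y => Real.circleAverage (fun ζ => herglotzRieszKernel 0 (y - c) ζ •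
      (f (ζ + c) : ℂ)) 0 R) w :=
    AnalyticAt.fun_comp (g := fun y => Real.circleAverage (fun ζ => herglotzRieszKernel 0 y ζ •
      (f (ζ + c) : ℂ)) 0 R) (f := fun y => y - c) (h1 _ (hw0 w hw)) (by fun_prop)
  refine (harmonicAt_congr_nhds ?_).2 h2.harmonicAt_re
  filter_upwards [isOpen_ball.mem_nhds hw] with y hy
  rw [poissonIntegral_translate, re_circleAverage_herglotzRieszKernel_smul hf0 (hw0 y hy),
    poissonIntegral, poissonKernel_eq_re_herglotzRieszKernel]
  rfl

/-- Replacing `f` inside a disc by its Poisson integral. -/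
noncomputable def poissonMod (c : ℂ) (R : ℝ) (f : ℂ → ℝ) : ℂ → ℝ :=
  open Classical in fun w => if w ∈ ball c R then poissonIntegral c R f w else f w

theorem poissonMod_of_mem (hw : w ∈ ball c R) : poissonMod c R f w = poissonIntegral c R f w :=
  if_pos hw

theorem poissonMod_of_notMem (hw : w ∉ ball c R) : poissonMod c R f w = f w :=
  if_neg hw

/-- Barrier argument: on the circle `|f - f ζ₀|` is at most `ε / 2` plus a multiple of `‖ζ - ζ₀‖ ^
2`, which agrees there with an affine function vanishing at `ζ₀`. The Poisson integral preserves
this bound inside the disc, where it is harmonic and explicit. -/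
theorem tendsto_poissonIntegral (hR : 0 < R) (hf : ContinuousOn f (sphere c R)) {ζ₀ : ℂ}
    (hζ₀ : ζ₀ ∈ sphere c R) :
    Tendsto (poissonIntegral c R f) (𝓝[ball c R] ζ₀) (𝓝 (f ζ₀)) := by
  have hfi := hf.circleIntegrable hR.le
  obtain ⟨M, hM⟩ := (isCompact_sphere c R).exists_bound_of_continuousOn hf
  have hM0 : 0 ≤ M := (norm_nonneg _).trans (hM ζ₀ hζ₀)
  rw [Metric.tendsto_nhds]
  intro ε hε
  obtain ⟨δ, hδ, hδf⟩ := Metric.continuousWithinAt_iff.1 (hf ζ₀ hζ₀) (ε / 2) (by linarith)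
  set C : ℝ := 2 * M / δ ^ 2 with hC
  -- on the circle, `‖ζ - ζ₀‖ ^ 2` is the restriction of the affine function `L`
  set L : ℂ → ℝ := fun w =>
    ((-2 * (starRingEnd ℂ) (ζ₀ - c)) * w + (2 * R ^ 2 + 2 * (starRingEnd ℂ) (ζ₀ - c) * c)).re with hL
  have hLh : ∀ z, HarmonicAt L z := fun z => harmonicAt_re_mul _ _ z
  have hLc : Continuous L := by
    simp only [hL]; fun_prop
  have hnorm : ‖ζ₀ - c‖ = R := by rw [← dist_eq_norm]; exact hζ₀
  have hLs : ∀ ζ ∈ sphere c R, L ζ = ‖ζ - ζ₀‖ ^ 2 := by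
    intro ζ hζ
    have h1 : ‖ζ - c‖ = R := by rw [← dist_eq_norm]; exact hζ
    have e1 : R ^ 2 = (ζ.re - c.re) ^ 2 + (ζ.im - c.im) ^ 2 := by
      rw [← h1, ← Complex.normSq_eq_norm_sq, Complex.normSq_apply]; simp; ring
    have e2 : R ^ 2 = (ζ₀.re - c.re) ^ 2 + (ζ₀.im - c.im) ^ 2 := by
      rw [← hnorm, ← Complex.normSq_eq_norm_sq, Complex.normSq_apply]; simp; ring
    have e3 : L ζ = 2 * R ^ 2 - 2 * ((ζ₀.re - c.re) * (ζ.re - c.re)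
        + (ζ₀.im - c.im) * (ζ.im - c.im)) := by
      simp [hL, ← Complex.ofReal_pow]; ring
    rw [e3, ← Complex.normSq_eq_norm_sq, Complex.normSq_apply]
    simp only [Complex.sub_re, Complex.sub_im]
    linear_combination e1 + e2
  have hL0 : L ζ₀ = 0 := by rw [hLs ζ₀ hζ₀]; simp
  have hbound : ∀ ζ ∈ sphere c R, |f ζ - f ζ₀| ≤ ε / 2 + C * L ζ := by
    intro ζ hζ
    rw [hLs ζ hζ]
    by_cases hd : dist ζ ζ₀ < δ
    · have := hδf hζ hd
      rw [Real.dist_eq] at this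
      have h2 : 0 ≤ C * ‖ζ - ζ₀‖ ^ 2 := by positivity
      linarith
    · have h1 : δ ≤ ‖ζ - ζ₀‖ := by rw [← dist_eq_norm]; linarith
      have h2 : 2 * M ≤ C * ‖ζ - ζ₀‖ ^ 2 := by
        rw [hC, div_mul_eq_mul_div, le_div_iff₀ (by positivity)]
        gcongr
      have h3 : |f ζ - f ζ₀| ≤ 2 * M := by
        have a := hM ζ hζ
        have b := hM ζ₀ hζ₀
        rw [Real.norm_eq_abs] at a b
        linarith [abs_sub (f ζ) (f ζ₀)]
      linarith
  set G : ℂ → ℝ := (fun _ => ε / 2) + C • L with hG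
  have hGharm : HarmonicContOnCl G (ball c R) :=
    harmonicContOnCl_const.add ((HarmonicOnNhd.harmonicContOnCl fun z _ => hLh z).const_smul C)
  have hGi : CircleIntegrable G c R := (by
    simp only [hG]; fun_prop : Continuous G).continuousOn.circleIntegrable hR.le
  have hev : ∀ᶠ w in 𝓝 ζ₀, C * L w < ε / 2 := by
    have : Tendsto (fun w => C * L w) (𝓝 ζ₀) (𝓝 (C * L ζ₀)) :=
      (hLc.const_mul C).tendsto ζ₀
    rw [hL0, mul_zero] at this
    exact this.eventually (gt_mem_nhds (by linarith))
  filter_upwards [self_mem_nhdsWithin, mem_nhdsWithin_of_mem_nhds hev] with w hw hwL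
  have hc : CircleIntegrable (fun _ : ℂ => f ζ₀) c R := continuousOn_const.circleIntegrable hR.le
  have hsub := hfi.sub hc
  have hneg : CircleIntegrable (fun z => f ζ₀ - f z) c R := hc.sub hfi
  have hGw : G w = ε / 2 + C * L w := rfl
  have u1 := poissonIntegral_mono hw hsub hGi fun ζ hζ => (abs_le.1 (hbound ζ hζ)).2
  have u2 := poissonIntegral_mono hw hneg hGi fun ζ hζ => by
    have := (abs_le.1 (hbound ζ hζ)).1
    simp only [hG, Pi.add_apply, Pi.smul_apply, smul_eq_mul]; linarith
  rw [poissonIntegral_of_harmonic hGharm hw] at u1 u2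
  have e1 := poissonIntegral_sub hw hfi hc
  have e2 := poissonIntegral_sub hw hc hfi
  rw [poissonIntegral_const hw] at e1 e2
  rw [e2] at u2
  have u1' : poissonIntegral c R f w - f ζ₀ ≤ G w := by rw [← e1]; exact u1
  rw [Real.dist_eq, abs_lt]
  constructor <;> linarith

theorem continuousOn_poissonMod (hR : 0 < R) {s : Set ℂ} (hs : closedBall c R ⊆ s)
    (hf : ContinuousOn f s) : ContinuousOn (poissonMod c R f) s := by
  have hfs : ContinuousOn f (sphere c R) := hf.mono (sphere_subset_closedBall.trans hs)
  intro z hz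
  by_cases hzb : z ∈ ball c R
  · refine ContinuousAt.continuousWithinAt ?_
    have := (harmonicAt_poissonIntegral (hfs.circleIntegrable hR.le) hzb).1.continuousAt
    refine this.congr ?_
    filter_upwards [isOpen_ball.mem_nhds hzb] with y hy using (poissonMod_of_mem hy).symm
  · rw [ContinuousWithinAt, poissonMod_of_notMem hzb]
    have h1 : Tendsto (poissonMod c R f) (𝓝[s ∩ (ball c R)ᶜ] z) (𝓝 (f z)) :=
      ((hf z hz).mono inter_subset_left).congr' (by
        filter_upwards [self_mem_nhdsWithin] with y hy using (poissonMod_of_notMem hy.2).symm)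
    have h2 : Tendsto (poissonMod c R f) (𝓝[s ∩ ball c R] z) (𝓝 (f z)) := by
      by_cases hzs : z ∈ sphere c R
      · refine ((tendsto_poissonIntegral hR hfs hzs).mono_left
          (nhdsWithin_mono z inter_subset_right)).congr' ?_
        filter_upwards [self_mem_nhdsWithin] with y hy using (poissonMod_of_mem hy.2).symm
      · have : 𝓝[s ∩ ball c R] z = ⊥ := by
          rw [← notMem_closure_iff_nhdsWithin_eq_bot]
          intro hcl
          have h3 := closure_ball_subset_closedBall (closure_mono inter_subset_right hcl)
          rw [← sphere_union_ball] at h3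
          exact h3.elim hzs hzb
        rw [this]; exact tendsto_bot
    have := h1.sup h2
    rwa [← nhdsWithin_union, union_comm, inter_union_compl] at this

theorem harmonicAt_poissonMod (hR : 0 < R) (hf : ContinuousOn f (sphere c R)) (hw : w ∈ ball c R) :
    HarmonicAt (poissonMod c R f) w := by
  refine (harmonicAt_congr_nhds ?_).2 (harmonicAt_poissonIntegral (hf.circleIntegrable hR.le) hw)
  filter_upwards [isOpen_ball.mem_nhds hw] with y hy using poissonMod_of_mem hy

theorem le_poissonMod (hR : 0 < R) (hf : ContinuousOn f (closedBall c R))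
    (hs : ∀ z ∈ ball c R, SubharmAt f z) (w : ℂ) : f w ≤ poissonMod c R f w := by
  by_cases hw : w ∈ ball c R
  · have hcl : closure (ball c R) = closedBall c R := closure_ball c hR.ne'
    refine subharm_le_harmonic isOpen_ball isBounded_ball (by rwa [hcl])
      (by rw [hcl]; exact continuousOn_poissonMod hR subset_rfl hf) hs
      (fun z hz => harmonicAt_poissonMod hR (hf.mono sphere_subset_closedBall) hz)
      (fun z hz => ?_) w (subset_closure hw)
    rw [frontier_ball c hR.ne'] at hz
    rw [poissonMod_of_notMem]
    intro h
    exact (mem_ball.1 h).ne hz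
  · rw [poissonMod_of_notMem hw]

theorem subharmAt_poissonMod (hR : 0 < R) (hf : ContinuousOn f (closedBall c R))
    (hs : ∀ z ∈ ball c R, SubharmAt f z) (hw : SubharmAt f w) :
    SubharmAt (poissonMod c R f) w := by
  by_cases h : w ∈ ball c R
  · exact (harmonicAt_poissonMod hR (hf.mono sphere_subset_closedBall) h).subharmAt
  · exact hw.of_le (Eventually.of_forall (le_poissonMod hR hf hs)) (poissonMod_of_notMem h).symm

theorem poissonMod_le {M : ℝ} (hR : 0 < R) (hf : ContinuousOn f (sphere c R))
    (hM : ∀ z ∈ closedBall c R, f z ≤ M) (hw : w ∈ closedBall c R) : poissonMod c R f w ≤ M := by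
  by_cases h : w ∈ ball c R
  · rw [poissonMod_of_mem h, ← poissonIntegral_const h M]
    exact poissonIntegral_mono h (hf.circleIntegrable hR.le)
      (continuousOn_const.circleIntegrable hR.le) fun z hz => hM z (sphere_subset_closedBall hz)
  · rw [poissonMod_of_notMem h]; exact hM w hw

end Poisson

/-! ### Decay of subharmonic functions at points where the complement is not thin -/

theorem poissonIntegral_le_of_circleAverage_le {c w : ℂ} {R M : ℝ} {f : ℂ → ℝ} (hR : 0 < R)
    (hM : 0 ≤ M) (hf : CircleIntegrable f c R) (hfM : ∀ z ∈ sphere c R, f z ≤ M)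
    (havg : Real.circleAverage f c R ≤ M / 2) (hw : ‖w - c‖ ≤ R / 4) :
    poissonIntegral c R f w ≤ 3 / 4 * M := by
  have hwb : w ∈ ball c R := by rw [mem_ball, dist_eq_norm]; linarith
  have hc : CircleIntegrable (fun _ : ℂ => M) c R := continuousOn_const.circleIntegrable hR.le
  have hi : CircleIntegrable (fun z => M - f z) c R := hc.sub hf
  have h1 := poissonIntegral_sub hwb hc hf
  rw [poissonIntegral_const hwb] at h1
  -- Harnack: for `‖w - c‖ ≤ R / 4` the Poisson kernel is at least `(1 - 1/4) / (1 + 1/4) = 3/5`.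
  -- Since `M - f` has mean at least `M / 2`, its Poisson integral is at least `3/10 * M`, which
  -- leaves `7/10 * M` for `f`.
  have h2 : Real.circleAverage (fun z => (3 / 5 : ℝ) • (M - f z)) c R ≤
      poissonIntegral c R (fun z => M - f z) w := by
    refine Real.circleAverage_mono hi.const_fun_smul (circleIntegrable_poissonKernel_mul hwb hi)
      fun z hz => ?_
    rw [abs_of_pos hR] at hz
    refine mul_le_mul_of_nonneg_right ?_ (sub_nonneg.2 (hfM z hz))
    rw [poissonKernel_eq_re_herglotzRieszKernel]
    refine le_trans ?_ (le_re_herglotzRieszKernel hz hwb)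
    have := norm_nonneg (w - c)
    rw [le_div_iff₀ (by positivity)]
    linarith
  rw [Real.circleAverage_fun_smul, Real.circleAverage_fun_sub hc hf, Real.circleAverage_const,
    smul_eq_mul] at h2
  linarith

theorem circleAverage_comp_neg (f : ℂ → ℝ) (R : ℝ) :
    Real.circleAverage (fun z => f (-z)) 0 R = Real.circleAverage f 0 R := by
  rw [← Real.circleAverage_neg_radius (f := f)]
  simp [Real.circleAverage, circleMap]

/-- The complement of `V` is not thin at `a`, at the scale `r`: away from the complement of `V`, the
function `z - a` has a continuous square root in the disc of centre `a` and radius `r`. -/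
def NonThinAt (V : Set ℂ) (a : ℂ) (r : ℝ) : Prop :=
  ∀ δ > 0, ∃ σ : ℂ → ℂ, ContinuousOn σ {z | z ∈ ball a r ∧ ∀ w, w ∉ V → δ ≤ dist z w} ∧
    ∀ z ∈ ball a r, (∀ w, w ∉ V → δ ≤ dist z w) → σ z ^ 2 = z - a

theorem NonThinAt.mono {V : Set ℂ} {a : ℂ} {r r' : ℝ} (h : NonThinAt V a r) (hr : r' ≤ r) :
    NonThinAt V a r' := by
  intro δ hδ
  obtain ⟨σ, h1, h2⟩ := h δ hδ
  exact ⟨σ, h1.mono fun z hz => ⟨ball_subset_ball hr hz.1, hz.2⟩,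
    fun z hz => h2 z (ball_subset_ball hr hz)⟩

section Lift
variable {V : Set ℂ} {a : ℂ} {f : ℂ → ℝ} {ε : ℝ} {σ : ℂ → ℂ}

/-- The positive part of `f - ε`, lifted along `s ↦ a + s ^ 2` to the sheet selected by the branch
`σ` of the square root. -/
noncomputable def sheetLift (f : ℂ → ℝ) (a : ℂ) (ε : ℝ) (σ : ℂ → ℂ) (s : ℂ) : ℝ :=
  open Classical in if ε ≤ f (a + s ^ 2) ∧ σ (a + s ^ 2) = s then f (a + s ^ 2) - ε else 0

theorem sheetLift_nonneg (s : ℂ) : 0 ≤ sheetLift f a ε σ s := by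
  unfold sheetLift
  split_ifs with h
  · linarith [h.1]
  · rfl

/-- Only one of `s` and `-s` can be the value of `σ` at `a + s ^ 2`, unless `s = 0`, and there the
lift vanishes because `f a < ε`. -/
theorem sheetLift_add_neg_le {M : ℝ} (hε : 0 < ε) (hM : 0 ≤ M) (ha : f a ≤ 0) {s : ℂ}
    (hf : f (a + s ^ 2) ≤ M) : sheetLift f a ε σ s + sheetLift f a ε σ (-s) ≤ M := by
  unfold sheetLift
  rw [neg_sq]
  split_ifs with h h' h'
  · have hs : s = 0 := by
      have := h.2.symm.trans h'.2
      linear_combination (1 / 2) * this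
    subst hs
    have := h.1
    simp at this
    linarith
  all_goals linarith

/-- The value `σ (a + t ^ 2)` is `t` or `-t`, and by continuity the sign is locally constant away
from `0`. So locally the lift is either zero or the full truncation `max (f - ε) 0`; this makes it
continuous and subharmonic. -/
theorem sheetLift_eventually {s : ℂ} (hε : 0 < ε) (ha : f a ≤ 0)
    (hf : ContinuousAt f (a + s ^ 2))
    (hσ : ε ≤ f (a + s ^ 2) → ContinuousAt σ (a + s ^ 2) ∧
      ∀ᶠ z in 𝓝 (a + s ^ 2), σ z ^ 2 = z - a) :
    (∀ᶠ t in 𝓝 s, sheetLift f a ε σ t = 0) ∨ (s ≠ 0 ∧ ε ≤ f (a + s ^ 2) ∧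
      ∀ᶠ t in 𝓝 s, sheetLift f a ε σ t = max (f (a + t ^ 2) - ε) 0) := by
  have hc : Tendsto (fun t : ℂ => a + t ^ 2) (𝓝 s) (𝓝 (a + s ^ 2)) :=
    Continuous.tendsto (by fun_prop) s
  by_cases hlt : f (a + s ^ 2) < ε
  · left
    filter_upwards [hc.eventually (hf.eventually (gt_mem_nhds hlt))] with t ht
    exact if_neg fun h => absurd h.1 (not_le.2 ht)
  · rw [not_lt] at hlt
    obtain ⟨hσc, hσ2⟩ := hσ hlt
    have hs : s ≠ 0 := by
      rintro rfl
      simp at hlt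
      linarith
    have hsq : σ (a + s ^ 2) ^ 2 = s ^ 2 := by rw [hσ2.self_of_nhds]; ring
    have hct : Tendsto (fun t : ℂ => σ (a + t ^ 2)) (𝓝 s) (𝓝 (σ (a + s ^ 2))) := hσc.tendsto.comp hc
    rcases sq_eq_sq_iff_eq_or_eq_neg.1 hsq with h | h
    · right
      refine ⟨hs, hlt, ?_⟩
      rw [h] at hct
      have h2 : ∀ᶠ t in 𝓝 s, σ (a + t ^ 2) + t ≠ 0 := by
        refine (hct.add tendsto_id).eventually_ne ?_
        intro h3
        apply hs
        linear_combination (1 / 2) * h3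
      filter_upwards [h2, hc.eventually hσ2] with t ht ht2
      have h4 : σ (a + t ^ 2) = t := by
        have : (σ (a + t ^ 2) + t) * (σ (a + t ^ 2) - t) = 0 := by linear_combination ht2
        exact sub_eq_zero.1 ((mul_eq_zero.1 this).resolve_left ht)
      unfold sheetLift
      by_cases h5 : ε ≤ f (a + t ^ 2)
      · rw [if_pos ⟨h5, h4⟩, max_eq_left (by linarith)]
      · rw [if_neg (fun h => h5 h.1), max_eq_right (by linarith)]
    · left
      rw [h] at hct
      have h2 : ∀ᶠ t in 𝓝 s, σ (a + t ^ 2) - t ≠ 0 := by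
        refine (hct.sub tendsto_id).eventually_ne ?_
        intro h3
        apply hs
        linear_combination (-1 / 2) * h3
      filter_upwards [h2] with t ht
      exact if_neg fun h => ht (sub_eq_zero.2 h.2)

end Lift

theorem subharm_le_three_quarters {V : Set ℂ} {a : ℂ} {r M : ℝ} {f : ℂ → ℝ} (hV : IsOpen V)
    (ha : a ∉ V) (hn : NonThinAt V a r) (hf : ContinuousOn f (ball a r))
    (hs : ∀ z ∈ V ∩ ball a r, SubharmAt f z) (h0 : ∀ z ∈ ball a r, z ∉ V → f z ≤ 0)
    (hfM : ∀ z ∈ ball a r, f z ≤ M) (hM : 0 ≤ M) : ∀ z ∈ ball a (r / 16), f z ≤ 3 / 4 * M := by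
  intro z hz
  refine le_of_forall_pos_le_add fun ε hε => ?_
  rw [mem_ball, dist_eq_norm] at hz
  have hr : 0 < r := by linarith [norm_nonneg (z - a)]
  by_cases hfz : f z < ε
  · linarith
  rw [not_lt] at hfz
  have hfa : f a ≤ 0 := h0 a (mem_ball_self hr) ha
  -- Any `q` strictly between `16 * ‖z - a‖` and `r` would do. The disc `‖s‖ ≤ √q` maps into the
  -- closed disc of radius `q`, and a square root of `z - a` has modulus at most `√q / 4`; this is
  -- the origin of the factor 16.
  set q := (16 * ‖z - a‖ + r) / 2 with hq
  set r' := (q + r) / 2 with hr'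
  have hq0 : 0 < q := by positivity
  have hqr : q < r := by linarith
  set ρ := Real.sqrt q with hρ
  have hρ0 : 0 < ρ := Real.sqrt_pos.2 hq0
  have hρ2 : ρ ^ 2 = q := Real.sq_sqrt hq0.le
  set S := closedBall a r' ∩ f ⁻¹' Ici ε with hS
  have hcb : closedBall a r' ⊆ ball a r := closedBall_subset_ball (by linarith)
  have hSc : IsCompact S := (isCompact_closedBall a r').of_isClosed_subset
    ((hf.mono hcb).preimage_isClosed_of_isClosed isClosed_closedBall isClosed_Ici)
    inter_subset_left
  have hSV : S ⊆ V := by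
    intro x hx
    by_contra hxV
    have h1 := h0 x (hcb hx.1) hxV
    have h2 : ε ≤ f x := hx.2
    linarith
  -- The compact set where `f ≥ ε` stays at distance `δ` from the complement of `V`, so a branch of
  -- the root valid at distance `δ / 2` is continuous on a neighbourhood of it. Where `f < ε` the
  -- lift is zero and no branch is needed.
  obtain ⟨δ, hδ, hδV⟩ := hSc.exists_thickening_subset_open hV hSV
  obtain ⟨σ, hσc, hσ2⟩ := hn (δ / 2) (by linarith)
  have hnhds : ∀ x ∈ S, {z | z ∈ ball a r ∧ ∀ w, w ∉ V → δ / 2 ≤ dist z w} ∈ 𝓝 x := by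
    intro x hx
    filter_upwards [isOpen_ball.mem_nhds (hcb hx.1), ball_mem_nhds x (half_pos hδ)] with y hy hy'
    refine ⟨hy, fun w hw => ?_⟩
    by_contra! hlt
    apply hw
    apply hδV
    rw [mem_thickening_iff]
    refine ⟨x, hx, ?_⟩
    rw [mem_ball] at hy'
    linarith [dist_triangle_left w x y]
  have hσS : ∀ x ∈ S, ContinuousAt σ x ∧ ∀ᶠ z in 𝓝 x, σ z ^ 2 = z - a := by
    intro x hx
    refine ⟨hσc.continuousAt (hnhds x hx), ?_⟩
    filter_upwards [hnhds x hx] with y hy using hσ2 y hy.1 hy.2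
  have hmem : ∀ s : ℂ, ‖s‖ ≤ ρ → a + s ^ 2 ∈ closedBall a r' := by
    intro s hs
    rw [mem_closedBall, dist_eq_norm, add_sub_cancel_left, norm_pow]
    have : ‖s‖ ^ 2 ≤ ρ ^ 2 := by gcongr
    linarith
  set v := sheetLift f a ε σ with hv
  have hloc : ∀ s : ℂ, ‖s‖ ≤ ρ → _ := fun s hs =>
    sheetLift_eventually (f := f) (a := a) (ε := ε) (σ := σ) (s := s) hε hfa
      (hf.continuousAt (isOpen_ball.mem_nhds (hcb (hmem s hs))))
      (fun h => hσS _ ⟨hmem s hs, h⟩)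
  have hvc : ContinuousOn v (closedBall 0 ρ) := by
    intro s hs'
    rw [mem_closedBall_zero_iff] at hs'
    refine ContinuousAt.continuousWithinAt ?_
    rcases hloc s hs' with h | ⟨-, -, h⟩
    · exact (continuousAt_congr h).2 continuousAt_const
    · refine (continuousAt_congr h).2 ?_
      have h1 := hf.continuousAt (isOpen_ball.mem_nhds (hcb (hmem s hs')))
      have h2 : ContinuousAt (fun t : ℂ => f (a + t ^ 2)) s :=
        ContinuousAt.comp (f := fun t : ℂ => a + t ^ 2) h1 (by fun_prop)
      exact (h2.sub continuousAt_const).max continuousAt_const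
  have hvs : ∀ s ∈ ball (0 : ℂ) ρ, SubharmAt v s := by
    intro s hs'
    rw [mem_ball_zero_iff] at hs'
    rcases hloc s hs'.le with h | ⟨h1, h2, h⟩
    · exact (harmonicAt_constant 0 s).subharmAt.congr (h.mono fun t ht => ht.symm)
    · have hx : a + s ^ 2 ∈ S := ⟨hmem s hs'.le, h2⟩
      have h3 := (hs _ ⟨hSV hx, hcb hx.1⟩).comp_sq h1
      exact ((h3.sub_const ε).max (harmonicAt_constant 0 s).subharmAt).congr
        (h.mono fun t ht => ht.symm)
  have hvi : CircleIntegrable v 0 ρ :=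
    (hvc.mono sphere_subset_closedBall).circleIntegrable hρ0.le
  have hvi' : CircleIntegrable (fun s => v (-s)) 0 ρ := by
    refine ContinuousOn.circleIntegrable hρ0.le ?_
    refine (hvc.mono sphere_subset_closedBall).comp continuous_neg.continuousOn ?_
    intro s hs'
    simpa using hs'
  have hsum : ∀ s ∈ sphere (0 : ℂ) |ρ|, v s + v (-s) ≤ M := by
    intro s hs'
    rw [abs_of_pos hρ0, mem_sphere_zero_iff_norm] at hs'
    exact sheetLift_add_neg_le hε hM hfa (hfM _ (hcb (hmem s hs'.le)))
  have havg : Real.circleAverage v 0 ρ ≤ M / 2 := by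
    have h1 := Real.circleAverage_mono_on_of_le_circle (hvi.add hvi') hsum
    rw [Real.circleAverage_add hvi hvi', circleAverage_comp_neg] at h1
    linarith
  have hvM : ∀ s ∈ sphere (0 : ℂ) ρ, v s ≤ M := by
    intro s hs'
    have h1 := hsum s (by rwa [abs_of_pos hρ0])
    have h2 : 0 ≤ v (-s) := sheetLift_nonneg _
    linarith
  have hzS : z ∈ S := by
    refine ⟨?_, hfz⟩
    rw [mem_closedBall, dist_eq_norm]
    have := norm_nonneg (z - a)
    linarith
  have hsz : σ z ^ 2 = z - a := (hσS z hzS).2.self_of_nhds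
  have hnorm : ‖σ z‖ ≤ ρ / 4 := by
    have h1 : ‖σ z‖ ^ 2 = ‖z - a‖ := by rw [← norm_pow, hsz]
    have h2 : ‖σ z‖ ^ 2 ≤ (ρ / 4) ^ 2 := by rw [h1, div_pow, hρ2]; linarith
    exact le_of_sq_le_sq h2 (by positivity)
  have hle := le_poissonMod hρ0 hvc hvs (σ z)
  rw [poissonMod_of_mem (by rw [mem_ball_zero_iff]; linarith)] at hle
  have hfin := poissonIntegral_le_of_circleAverage_le hρ0 hM hvi hvM havg
    (w := σ z) (by simpa using hnorm)
  have hvz : v (σ z) = f z - ε := by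
    have : a + σ z ^ 2 = z := by rw [hsz]; ring
    simp only [hv, sheetLift, this]
    rw [if_pos ⟨hfz, trivial⟩]
  linarith

/-- A Beurling-type estimate: near a point of the complement of `V` at which that complement is not
thin, a bounded subharmonic function on `V` with nonpositive boundary values is small. -/
theorem subharm_le_pow {V : Set ℂ} {a : ℂ} {r M : ℝ} {f : ℂ → ℝ} (hV : IsOpen V)
    (ha : a ∉ V) (hn : NonThinAt V a r) (hf : ContinuousOn f (ball a r))
    (hs : ∀ z ∈ V ∩ ball a r, SubharmAt f z) (h0 : ∀ z ∈ ball a r, z ∉ V → f z ≤ 0)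
    (hfM : ∀ z ∈ ball a r, f z ≤ M) (hM : 0 ≤ M) (j : ℕ) :
    ∀ z ∈ ball a (r / 16 ^ j), f z ≤ (3 / 4) ^ j * M := by
  rcases le_or_gt r 0 with hr | hr
  · intro z hz
    rw [ball_eq_empty.2 (div_nonpos_of_nonpos_of_nonneg hr (by positivity))] at hz
    exact hz.elim
  induction j with
  | zero => simpa using hfM
  | succ j ih =>
    have hle : r / 16 ^ j ≤ r := div_le_self hr.le (one_le_pow₀ (by norm_num))
    have hb := ball_subset_ball (x := a) hle
    have := subharm_le_three_quarters hV ha (hn.mono hle) (hf.mono hb)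
      (fun z hz => hs z ⟨hz.1, hb hz.2⟩) (fun z hz => h0 z (hb hz)) ih (by positivity)
    rw [pow_succ, ← div_div]
    intro z hz
    have := this z hz
    rw [pow_succ]
    linarith

/-! ### The Dirichlet problem by sweeping out -/

theorem poissonKernel_le {c w ζ : ℂ} {R : ℝ} (hw : w ∈ ball c R) (hζ : ζ ∈ sphere c R) :
    poissonKernel c w ζ ≤ (R + ‖w - c‖) / (R - ‖w - c‖) := by
  rw [poissonKernel_eq_re_herglotzRieszKernel]
  exact re_herglotzRieszKernel_le hζ hw

theorem tendsto_poissonIntegral_of_bounded {c w : ℂ} {R C : ℝ} {f : ℕ → ℂ → ℝ} {u : ℂ → ℝ}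
    (hw : w ∈ ball c R) (hf : ∀ n, Measurable (f n)) (hC : ∀ n, ∀ z ∈ sphere c R, |f n z| ≤ C)
    (hlim : ∀ z, Tendsto (fun n => f n z) atTop (𝓝 (u z))) :
    CircleIntegrable u c R ∧
      Tendsto (fun n => poissonIntegral c R (f n) w) atTop (𝓝 (poissonIntegral c R u w)) := by
  have hR : 0 < R := pos_of_mem_ball hw
  have hu : Measurable u := measurable_of_tendsto_metrizable hf (tendsto_pi_nhds.2 hlim)
  have hm : Measurable (circleMap c R) := (continuous_circleMap c R).measurable
  have hk : Measurable (poissonKernel c w) := by unfold poissonKernel; fun_prop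
  have hsph : ∀ θ, circleMap c R θ ∈ sphere c R := circleMap_mem_sphere c hR.le
  have hwR : ‖w - c‖ < R := by rw [← dist_eq_norm]; exact hw
  constructor
  · refine (intervalIntegrable_const (c := C)).mono_fun (hu.comp hm).aestronglyMeasurable ?_
    refine Eventually.of_forall fun θ => ?_
    refine le_trans (le_of_tendsto' (hlim _).abs fun n => hC n _ (hsph θ)) ?_
    exact le_abs_self C
  · refine Tendsto.const_smul ?_ _
    refine intervalIntegral.tendsto_integral_filter_of_dominated_convergence
      (fun _ => (R + ‖w - c‖) / (R - ‖w - c‖) * C) ?_ ?_ intervalIntegrable_const ?_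
    · exact Eventually.of_forall fun n => ((hk.mul (hf n)).comp hm).aestronglyMeasurable
    · refine Eventually.of_forall fun n => Eventually.of_forall fun θ _ => ?_
      rw [norm_mul, Real.norm_eq_abs, Real.norm_eq_abs,
        abs_of_nonneg (poissonKernel_nonneg hw (hsph θ))]
      refine mul_le_mul (poissonKernel_le hw (hsph θ)) (hC n _ (hsph θ)) (abs_nonneg _) ?_
      exact div_nonneg (by positivity) (by linarith)
    · exact Eventually.of_forall fun θ _ => (hlim _).const_mul _

/-- The sweeping-out process: successive Poisson modifications of `s` along a sequence of discs. -/
noncomputable def balayage (s : ℂ → ℝ) (B : ℕ → ℂ × ℝ) : ℕ → ℂ → ℝ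
  | 0 => s
  -- The first component of `j.unpair` takes each value infinitely often, so every disc is swept
  -- infinitely often.
  | j + 1 => poissonMod (B j.unpair.1).1 (B j.unpair.1).2 (balayage s B j)

section Balayage
variable {s : ℂ → ℝ} {B : ℕ → ℂ × ℝ} {V : Set ℂ}

theorem continuous_balayage (hs : Continuous s) (hB : ∀ i, 0 < (B i).2) (j : ℕ) :
    Continuous (balayage s B j) := by
  induction j with
  | zero => exact hs
  | succ j ih =>
    rw [← continuousOn_univ] at ih ⊢
    exact continuousOn_poissonMod (hB _) (subset_univ _) ih

theorem subharmAt_balayage (hs : Continuous s) (hsub : ∀ z, SubharmAt s z) (hB : ∀ i, 0 < (B i).2)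
    (j : ℕ) (z : ℂ) : SubharmAt (balayage s B j) z := by
  induction j generalizing z with
  | zero => exact hsub z
  | succ j ih =>
    exact subharmAt_poissonMod (hB _) (continuous_balayage hs hB j).continuousOn (fun z _ => ih z)
      (ih z)

theorem balayage_mono (hs : Continuous s) (hsub : ∀ z, SubharmAt s z) (hB : ∀ i, 0 < (B i).2)
    (z : ℂ) : Monotone fun j => balayage s B j z :=
  monotone_nat_of_le_succ fun j => le_poissonMod (hB _) (continuous_balayage hs hB j).continuousOn
    (fun z _ => subharmAt_balayage hs hsub hB j z) z

theorem balayage_of_notMem (hBV : ∀ i, closedBall (B i).1 (B i).2 ⊆ V) {z : ℂ} (hz : z ∉ V)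
    (j : ℕ) : balayage s B j z = s z := by
  induction j with
  | zero => rfl
  | succ j ih =>
    rw [balayage, poissonMod_of_notMem (fun h => hz (hBV _ (ball_subset_closedBall h))), ih]

theorem balayage_le {M : ℝ} (hs : Continuous s) (hB : ∀ i, 0 < (B i).2)
    (hBV : ∀ i, closedBall (B i).1 (B i).2 ⊆ V) (hM : ∀ z ∈ V, s z ≤ M) {z : ℂ}
    (hz : z ∈ V) (j : ℕ) : balayage s B j z ≤ M := by
  induction j generalizing z with
  | zero => exact hM z hz
  | succ j ih =>
    by_cases h : z ∈ closedBall (B j.unpair.1).1 (B j.unpair.1).2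
    · exact poissonMod_le (hB _) (continuous_balayage hs hB j).continuousOn
        (fun z hz => ih (hBV _ hz)) h
    · rw [balayage, poissonMod_of_notMem (fun h' => h (ball_subset_closedBall h'))]
      exact ih hz

end Balayage

theorem exists_disc_cover {V : Set ℂ} (hV : IsOpen V) (hne : V.Nonempty) :
    ∃ B : ℕ → ℂ × ℝ, (∀ i, 0 < (B i).2) ∧ (∀ i, closedBall (B i).1 (B i).2 ⊆ V) ∧
      ∀ z ∈ V, ∃ i, z ∈ ball (B i).1 (B i).2 := by
  have h1 : ∀ z : V, ∃ r : ℝ, 0 < r ∧ closedBall (z : ℂ) r ⊆ V := fun z =>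
    nhds_basis_closedBall.mem_iff.1 (hV.mem_nhds z.2)
  choose r hr hrV using h1
  obtain ⟨t, htc, ht⟩ := TopologicalSpace.isOpen_iUnion_countable (fun z : V => ball (z : ℂ) (r z))
    fun z => isOpen_ball
  have hcov : V ⊆ ⋃ z ∈ t, ball (z : ℂ) (r z) := by
    rw [ht]
    intro z hz
    exact mem_iUnion.2 ⟨⟨z, hz⟩, mem_ball_self (hr _)⟩
  have htn : t.Nonempty := by
    obtain ⟨z, hz⟩ := hne
    obtain ⟨i, hi, -⟩ := mem_iUnion₂.1 (hcov hz)
    exact ⟨i, hi⟩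
  obtain ⟨e, he⟩ := htc.exists_eq_range htn
  refine ⟨fun i => (e i, r (e i)), fun i => hr _, fun i => hrV _, fun z hz => ?_⟩
  obtain ⟨i, hi, hzi⟩ := mem_iUnion₂.1 (hcov hz)
  rw [he] at hi
  obtain ⟨n, rfl⟩ := hi
  exact ⟨n, hzi⟩

/-- Solvability of the Dirichlet problem for boundary values given by a subharmonic function. -/
theorem exists_dirichlet_of_subharm {V : Set ℂ} (hV : IsOpen V) (hVb : Bornology.IsBounded V)
    (hn : ∀ a ∈ frontier V, ∃ r > 0, NonThinAt V a r) {s : ℂ → ℝ} (hs : Continuous s)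
    (hsub : ∀ z, SubharmAt s z) :
    ∃ u : ℂ → ℝ, Continuous u ∧ (∀ z ∈ V, HarmonicAt u z) ∧ ∀ z, z ∉ V → u z = s z := by
  rcases V.eq_empty_or_nonempty with rfl | hne
  · exact ⟨s, hs, by simp, by simp⟩
  obtain ⟨B, hB, hBV, hcov⟩ := exists_disc_cover hV hne
  obtain ⟨ρ, hρ⟩ := hVb.subset_closedBall 0
  obtain ⟨C, hC⟩ := (isCompact_closedBall (0 : ℂ) (ρ + 1)).exists_bound_of_continuousOn
    hs.continuousOn
  have hVρ : V ⊆ closedBall 0 (ρ + 1) := hρ.trans (closedBall_subset_closedBall (by linarith))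
  set f := balayage s B with hf
  have hfc : ∀ j, Continuous (f j) := continuous_balayage hs hB
  have hfm : ∀ z, Monotone fun j => f j z := balayage_mono hs hsub hB
  have hfV : ∀ z, z ∉ V → ∀ j, f j z = s z := fun z hz => balayage_of_notMem hBV hz
  have hfC : ∀ z ∈ closedBall (0 : ℂ) (ρ + 1), ∀ j, f j z ≤ C := by
    intro z hz j
    by_cases hzV : z ∈ V
    · exact balayage_le hs hB hBV (fun y hy => (abs_le.1 (hC y (hVρ hy))).2) hzV j
    · rw [hfV z hzV]; exact (abs_le.1 (hC z hz)).2
  have hsf : ∀ z j, s z ≤ f j z := fun z j => hfm z (Nat.zero_le j)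
  have hfabs : ∀ z ∈ V, ∀ j, |f j z| ≤ C := fun z hz j =>
    abs_le.2 ⟨(abs_le.1 (hC z (hVρ hz))).1.trans (hsf z j), hfC z (hVρ hz) j⟩
  have hbdd : ∀ z, BddAbove (range fun j => f j z) := by
    intro z
    by_cases hzV : z ∈ V
    · exact ⟨C, by rintro _ ⟨j, rfl⟩; exact hfC z (hVρ hzV) j⟩
    · exact ⟨s z, by rintro _ ⟨j, rfl⟩; exact (hfV z hzV j).le⟩
  set u : ℂ → ℝ := fun z => ⨆ j, f j z with hu
  have hlim : ∀ z, Tendsto (fun j => f j z) atTop (𝓝 (u z)) := fun z =>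
    tendsto_atTop_ciSup (hfm z) (hbdd z)
  have hus : ∀ z, z ∉ V → u z = s z := by
    intro z hz
    simp only [hu, hfV z hz, ciSup_const]
  have hharm : ∀ z ∈ V, HarmonicAt u z := by
    intro z hz
    obtain ⟨i, hi⟩ := hcov z hz
    have hsub : ∀ w ∈ sphere (B i).1 (B i).2, w ∈ V := fun w hw =>
      hBV i (sphere_subset_closedBall hw)
    -- Going from step `Nat.pair i n` to the next one sweeps the disc `B i`. Passing to the limit
    -- along these steps shows that `u` equals its own Poisson integral on that disc.
    have htop : Tendsto (fun n => Nat.pair i n) atTop atTop :=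
      tendsto_atTop_mono (fun n => Nat.right_le_pair i n) tendsto_id
    have hP := fun w (hw : w ∈ ball (B i).1 (B i).2) =>
      tendsto_poissonIntegral_of_bounded (f := fun n => f (Nat.pair i n)) (u := u) (C := C) hw
        (fun n => (hfc _).measurable) (fun n y hy => hfabs y (hsub y hy) _)
        (fun y => (hlim y).comp htop)
    have heq : ∀ w ∈ ball (B i).1 (B i).2, u w = poissonIntegral (B i).1 (B i).2 u w := by
      intro w hw
      refine tendsto_nhds_unique ((hlim w).comp ((tendsto_add_atTop_nat 1).comp htop)) ?_
      refine (hP w hw).2.congr fun n => ?_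
      simp only [Function.comp_apply, hf, balayage, Nat.unpair_pair]
      rw [poissonMod_of_mem hw]
    refine (harmonicAt_congr_nhds ?_).2 (harmonicAt_poissonIntegral (hP z hi).1 hi)
    filter_upwards [isOpen_ball.mem_nhds hi] with w hw using heq w hw
  refine ⟨u, ?_, hharm, hus⟩
  rw [continuous_iff_continuousAt]
  intro a
  by_cases haV : a ∈ V
  · exact (hharm a haV).1.continuousAt
  by_cases hac : a ∈ closure V
  · obtain ⟨r, hr, hnr⟩ := hn a (by rw [hV.frontier_eq]; exact ⟨hac, haV⟩)
    rw [Metric.continuousAt_iff]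
    intro ε hε
    obtain ⟨δ, hδ, hδs⟩ := Metric.continuousAt_iff.1 hs.continuousAt (ε / 3) (by positivity)
    set d := min (min δ r) 1 with hd
    have hd0 : 0 < d := by positivity
    have hC0 : 0 ≤ C := by
      have : a ∈ closedBall (0 : ℂ) (ρ + 1) := closure_minimal hVρ isClosed_closedBall hac
      exact (norm_nonneg _).trans (hC a this)
    have haρ : a ∈ closedBall (0 : ℂ) ρ := closure_minimal hρ isClosed_closedBall hac
    have hballs : ball a d ⊆ closedBall (0 : ℂ) (ρ + 1) := by
      intro z hz
      rw [mem_ball] at hz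
      rw [mem_closedBall] at haρ ⊢
      have h1 : d ≤ 1 := min_le_right _ _
      linarith [dist_triangle z a 0]
    have hsa : ∀ z ∈ ball a d, |s z - s a| < ε / 3 := fun z hz => by
      have := hδs ((mem_ball.1 hz).trans_le ((min_le_left _ _).trans (min_le_left _ _)))
      rwa [Real.dist_eq] at this
    obtain ⟨k, hk⟩ := exists_pow_lt_of_lt_one (show 0 < ε / (3 * (2 * C + 1)) by positivity)
      (show (3 / 4 : ℝ) < 1 by norm_num)
    have hk' : (3 / 4 : ℝ) ^ k * (2 * C) < ε / 3 := by
      rw [lt_div_iff₀ (by positivity)] at hk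
      have : (0 : ℝ) < (3 / 4) ^ k := by positivity
      nlinarith
    -- The decay estimate for `f j - (s a + ε / 3)` is uniform in `j`, hence survives the supremum.
    -- The matching lower bound is simply `s ≤ u`.
    have hup : ∀ j, ∀ z ∈ ball a (d / 16 ^ k), f j z ≤ s a + 2 * ε / 3 := by
      intro j z hz
      have hg := subharm_le_pow (f := fun z => f j z - (s a + ε / 3)) (M := 2 * C) hV haV
        (hnr.mono ((min_le_left _ _).trans (min_le_right _ _) : d ≤ r))
        ((hfc j).sub continuous_const).continuousOn
        (fun z _ => (subharmAt_balayage hs hsub hB j z).sub_const _)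
        (fun z hz hzV => by
          rw [hfV z hzV]
          have := (abs_lt.1 (hsa z hz)).2
          linarith)
        (fun z hz => by
          have h1 := hfC z (hballs hz) j
          have h2 := (abs_le.1 (hC a (hballs (mem_ball_self hd0)))).1
          linarith) (by positivity) k z hz
      linarith
    refine ⟨d / 16 ^ k, by positivity, fun z hz => ?_⟩
    have h1 : u z ≤ s a + 2 * ε / 3 := ciSup_le fun j => hup j z hz
    have h2 : s z ≤ u z := ge_of_tendsto' (hlim z) (hsf z)
    have hzd : z ∈ ball a d :=
      ball_subset_ball (div_le_self hd0.le (one_le_pow₀ (by norm_num))) (mem_ball.2 hz)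
    have h3 := (abs_lt.1 (hsa z hzd)).1
    rw [hus a haV, Real.dist_eq, abs_lt]
    constructor <;> linarith
  · refine (continuousAt_congr ?_).2 hs.continuousAt
    filter_upwards [isClosed_closure.isOpen_compl.mem_nhds hac] with z hz
    exact hus z fun h => hz (subset_closure h)

theorem norm_sub_sq_eq (z w : ℂ) :
    ‖z - w‖ ^ 2 = ‖z‖ ^ 2 - 2 * (z * (starRingEnd ℂ) w).re + ‖w‖ ^ 2 := by
  simp only [← Complex.normSq_eq_norm_sq]
  rw [Complex.normSq_sub]; ring

/-- A continuous function on a compact set, up to a quadratic function, is the supremum of affine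
functions up to a small error. -/
theorem exists_convex_approx {K : Set ℂ} (hK : IsCompact K) (hne : K.Nonempty) {φ : ℂ → ℝ}
    (hφ : ContinuousOn φ K) : ∃ S : ℕ → ℂ → ℝ,
      (∀ n, Continuous (S n)) ∧ (∀ n z, SubharmAt (S n) z) ∧
      ∀ ε > 0, ∃ N, ∀ n ≥ N, ∀ z ∈ K, |S n z - n * ‖z‖ ^ 2 - φ z| ≤ ε := by
  -- Affine in `z`, and `g n z y - n * ‖z‖ ^ 2 = φ y - n * ‖z - y‖ ^ 2`. The maximum over `y` is
  -- therefore convex in `z`, and it differs by a quadratic from the sup-convolution of `φ`.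
  set g : ℕ → ℂ → ℂ → ℝ := fun n z y =>
    φ y - n * ‖y‖ ^ 2 + 2 * n * (z * (starRingEnd ℂ) y).re with hg
  have hgc : ∀ n z, ContinuousOn (g n z) K := by
    intro n z
    simp only [hg]
    refine ContinuousOn.add (hφ.sub ?_) ?_ <;> exact Continuous.continuousOn (by fun_prop)
  have hmax : ∀ n z, ∃ y ∈ K, ∀ y' ∈ K, g n z y' ≤ g n z y := fun n z =>
    hK.exists_isMaxOn hne (hgc n z)
  choose y hyK hy using hmax
  have hsupp : ∀ n z w, g n z (y n z) + (2 * n * (starRingEnd ℂ) (y n z) * (w - z)).re ≤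
      g n w (y n w) := by
    intro n z w
    refine le_trans (le_of_eq ?_) (hy n w (y n z) (hyK n z))
    simp only [hg, Complex.mul_re, Complex.mul_im, Complex.sub_re, Complex.sub_im,
      Complex.conj_re, Complex.conj_im, Complex.natCast_re, Complex.natCast_im, Complex.re_ofNat,
      Complex.im_ofNat]
    ring
  obtain ⟨ρ, hρ⟩ := hK.isBounded.subset_closedBall 0
  have hρ0 : 0 ≤ ρ := by
    obtain ⟨x, hx⟩ := hne
    exact (norm_nonneg x).trans (mem_closedBall_zero_iff.1 (hρ hx))
  refine ⟨fun n z => g n z (y n z), fun n => ?_, fun n z => subharmAt_of_supporting (hsupp n z), ?_⟩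
  · refine (LipschitzWith.of_le_add_mul (Real.toNNReal (2 * n * ρ)) fun z w => ?_).continuous
    rw [Real.coe_toNNReal _ (by positivity)]
    have h1 := hsupp n z w
    have h2 : -(2 * n * (starRingEnd ℂ) (y n z) * (w - z)).re ≤ 2 * n * ρ * dist z w := by
      rw [← Complex.neg_re]
      refine (Complex.re_le_norm _).trans ?_
      rw [norm_neg, norm_mul, norm_mul, dist_comm, dist_eq_norm]
      have := mem_closedBall_zero_iff.1 (hρ (hyK n z))
      simp only [Complex.norm_mul, Complex.norm_ofNat, Complex.norm_natCast, RCLike.norm_conj]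
      gcongr
    linarith
  · intro ε hε
    obtain ⟨M, hM⟩ := hK.exists_bound_of_continuousOn hφ
    have huc := hK.uniformContinuousOn_of_continuous hφ
    obtain ⟨δ, hδ, hδφ⟩ := Metric.uniformContinuousOn_iff.1 huc ε hε
    -- From `N` on, the penalty `n * ‖z - y‖ ^ 2` is at least `2 * M`, which bounds the oscillation
    -- of `φ`, as soon as `‖z - y‖ ≥ δ`.
    obtain ⟨N, hN⟩ := exists_nat_ge (2 * M / δ ^ 2)
    refine ⟨N, fun n hn z hz => ?_⟩
    have hval : ∀ w, g n z w - n * ‖z‖ ^ 2 = φ w - n * ‖z - w‖ ^ 2 := by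
      intro w
      rw [norm_sub_sq_eq]; simp only [hg]; ring
    rw [hval, abs_le]
    constructor
    · have h1 := hy n z z hz
      have h2 := hval z
      have h3 := hval (y n z)
      simp at h2
      linarith
    · by_cases hd : dist (y n z) z < δ
      · have h1 := hδφ _ (hyK n z) z hz hd
        rw [Real.dist_eq] at h1
        have h2 := (abs_lt.1 h1).2
        have h3 : 0 ≤ (n : ℝ) * ‖z - y n z‖ ^ 2 := by positivity
        linarith
      · have h1 : δ ≤ ‖z - y n z‖ := by rw [← dist_eq_norm, dist_comm]; linarith
        have h2 : 2 * M ≤ n * ‖z - y n z‖ ^ 2 := by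
          calc 2 * M = 2 * M / δ ^ 2 * δ ^ 2 := by field_simp
            _ ≤ n * ‖z - y n z‖ ^ 2 := by
              have : (N : ℝ) ≤ n := by exact_mod_cast hn
              gcongr
              linarith
        have h3 := (abs_le.1 (hM _ (hyK n z))).2
        have h4 := (abs_le.1 (hM z hz)).1
        linarith

theorem subharmAt_mul_norm_sq (n : ℕ) (z : ℂ) : SubharmAt (fun w : ℂ => n * ‖w‖ ^ 2) z := by
  refine subharmAt_of_supporting (p := 2 * n * (starRingEnd ℂ) z) fun w => ?_
  have h1 : (2 * n * (starRingEnd ℂ) z * (w - z)).re =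
      n * (2 * (w * (starRingEnd ℂ) z).re - 2 * ‖z‖ ^ 2) := by
    rw [← Complex.normSq_eq_norm_sq, Complex.normSq_apply]
    simp only [Complex.mul_re, Complex.mul_im, Complex.sub_re, Complex.sub_im,
      Complex.conj_re, Complex.conj_im, Complex.natCast_re, Complex.natCast_im, Complex.re_ofNat,
      Complex.im_ofNat]
    ring
  rw [h1]
  have h2 := norm_sub_sq_eq w z
  have h3 : 0 ≤ (n : ℝ) * ‖w - z‖ ^ 2 := by positivity
  rw [h2] at h3
  nlinarith

/-- The Poisson formula on a small disc passes to the limit by dominated convergence. -/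
theorem harmonicAt_of_tendstoUniformlyOn {V : Set ℂ} (hV : IsOpen V) {f : ℕ → ℂ → ℝ} {u : ℂ → ℝ}
    (hfc : ∀ n, Continuous (f n)) (hf : ∀ n, ∀ z ∈ V, HarmonicAt (f n) z)
    (hu : ContinuousOn u V) (hfu : TendstoUniformlyOn f u atTop V) {z : ℂ} (hz : z ∈ V) :
    HarmonicAt u z := by
  obtain ⟨r, hr, hrV⟩ := nhds_basis_closedBall.mem_iff.1 (hV.mem_nhds hz)
  obtain ⟨C, hC⟩ := (isCompact_closedBall z r).exists_bound_of_continuousOn (hu.mono hrV)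
  obtain ⟨N, hN⟩ := eventually_atTop.1 (Metric.tendstoUniformlyOn_iff.1 hfu 1 one_pos)
  set S := sphere z r with hS
  have hSV : S ⊆ V := sphere_subset_closedBall.trans hrV
  -- Cutting off to the circle leaves Poisson integrals unchanged and makes the functions converge
  -- at every point of the plane, from which the measurability of the limit follows.
  have hP := fun w (hw : w ∈ ball z r) =>
    tendsto_poissonIntegral_of_bounded (f := fun n => S.indicator (f (n + N))) (u := S.indicator u)
      (C := C + 1) hw (fun n => (hfc _).measurable.indicator isClosed_sphere.measurableSet)
      (fun n y hy => by
        rw [indicator_of_mem hy]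
        have h1 := hN (n + N) (Nat.le_add_left _ _) y (hSV hy)
        have h2 := hC y (sphere_subset_closedBall hy)
        rw [Real.dist_eq, abs_sub_comm] at h1
        rw [Real.norm_eq_abs] at h2
        have := abs_sub_abs_le_abs_sub (f (n + N) y) (u y)
        linarith)
      (fun y => by
        by_cases hy : y ∈ S
        · simp only [indicator_of_mem hy]
          exact (hfu.tendsto_at (hSV hy)).comp (tendsto_add_atTop_nat N)
        · simp only [indicator_of_notMem hy]
          exact tendsto_const_nhds)
  have heq : ∀ w ∈ ball z r, u w = poissonIntegral z r (S.indicator u) w := by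
    intro w hw
    refine tendsto_nhds_unique ((hfu.tendsto_at (hrV (ball_subset_closedBall hw))).comp
      (tendsto_add_atTop_nat N)) ?_
    refine (hP w hw).2.congr fun n => ?_
    rw [poissonIntegral_congr (g := f (n + N)) hr.le
      (fun y hy => indicator_of_mem (show y ∈ S from hy) _)]
    refine poissonIntegral_of_harmonic ⟨fun y hy => hf _ y (hrV (ball_subset_closedBall hy)), ?_⟩ hw
    exact (hfc _).continuousOn
  refine (harmonicAt_congr_nhds ?_).2
    (harmonicAt_poissonIntegral (hP z (mem_ball_self hr)).1 (mem_ball_self hr))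
  filter_upwards [ball_mem_nhds z hr] with w hw using heq w hw

/-- Solvability of the Dirichlet problem on a bounded open set with nowhere thin complement. -/
theorem exists_dirichlet {V : Set ℂ} (hV : IsOpen V) (hVb : Bornology.IsBounded V)
    (hn : ∀ a ∈ frontier V, ∃ r > 0, NonThinAt V a r) {φ : ℂ → ℝ}
    (hφ : ContinuousOn φ (frontier V)) :
    ∃ u : ℂ → ℝ, ContinuousOn u (closure V) ∧ (∀ z ∈ V, HarmonicAt u z) ∧
      ∀ z ∈ frontier V, u z = φ z := by
  rcases (frontier V).eq_empty_or_nonempty with he | hne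
  · obtain ⟨u, hu, huh, -⟩ := exists_dirichlet_of_subharm hV hVb hn continuous_const
      (fun z => (harmonicAt_constant 0 z).subharmAt)
    exact ⟨u, hu.continuousOn, huh, by simp [he]⟩
  have hK : IsCompact (frontier V) :=
    hVb.isCompact_closure.of_isClosed_subset isClosed_frontier frontier_subset_closure
  obtain ⟨S, hSc, hSs, hSφ⟩ := exists_convex_approx hK hne hφ
  have h1 := fun n => exists_dirichlet_of_subharm hV hVb hn (hSc n) (hSs n)
  have h2 := fun n : ℕ => exists_dirichlet_of_subharm hV hVb hn
    (s := fun w : ℂ => n * ‖w‖ ^ 2) (by fun_prop) (subharmAt_mul_norm_sq n)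
  choose p hpc hph hpV using h1
  choose q hqc hqh hqV using h2
  -- Both `S n` and `n * ‖z‖ ^ 2` are subharmonic, so both are solvable data. The differences of the
  -- solutions tend to `φ` uniformly on the frontier, hence by comparison they are uniformly Cauchy
  -- on the closure.
  set f : ℕ → ℂ → ℝ := fun n => p n - q n with hf
  have hfc : ∀ n, Continuous (f n) := fun n => (hpc n).sub (hqc n)
  have hfh : ∀ n, ∀ z ∈ V, HarmonicAt (f n) z := fun n z hz => (hph n z hz).sub (hqh n z hz)
  have hfr : ∀ z ∈ frontier V, z ∉ V := fun z hz => by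
    rw [hV.frontier_eq] at hz; exact hz.2
  have hfφ : ∀ ε > 0, ∃ N, ∀ n ≥ N, ∀ z ∈ frontier V, |f n z - φ z| ≤ ε := by
    intro ε hε
    obtain ⟨N, hN⟩ := hSφ ε hε
    refine ⟨N, fun n hn z hz => ?_⟩
    have := hN n hn z hz
    simp only [hf, Pi.sub_apply, hpV n z (hfr z hz), hqV n z (hfr z hz)]
    exact this
  have hcau : ∀ ε > 0, ∃ N, ∀ m ≥ N, ∀ n ≥ N, ∀ z ∈ closure V, f m z - f n z ≤ ε := by
    intro ε hε
    obtain ⟨N, hN⟩ := hfφ (ε / 2) (by positivity)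
    refine ⟨N, fun m hm n hn z hz => ?_⟩
    have := subharm_le_harmonic hV hVb (v := f m) (H := f n + fun _ => ε) (hfc m).continuousOn
      ((hfc n).add continuous_const).continuousOn (fun z hz => (hfh m z hz).subharmAt)
      (fun z hz => (hfh n z hz).add (harmonicAt_constant ε z))
      (fun z hz => by
        have a := (abs_le.1 (hN m hm z hz)).2
        have b := (abs_le.1 (hN n hn z hz)).1
        simp only [Pi.add_apply]; linarith) z hz
    simp only [Pi.add_apply] at this
    linarith
  have hunif : UniformCauchySeqOn f atTop (closure V) := by
    rw [Metric.uniformCauchySeqOn_iff]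
    intro ε hε
    obtain ⟨N, hN⟩ := hcau (ε / 2) (by positivity)
    refine ⟨N, fun m hm n hn z hz => ?_⟩
    have a := hN m hm n hn z hz
    have b := hN n hn m hm z hz
    rw [Real.dist_eq, abs_lt]
    constructor <;> linarith
  have hlim : ∀ z ∈ closure V, Tendsto (fun n => f n z) atTop (𝓝 (limUnder atTop fun n => f n z)) :=
    fun z hz => (hunif.cauchySeq hz).tendsto_limUnder
  have hfu := hunif.tendstoUniformlyOn_of_tendsto hlim
  have huc : ContinuousOn (fun z => limUnder atTop fun n => f n z) (closure V) :=
    hfu.continuousOn (Frequently.of_forall fun n => (hfc n).continuousOn)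
  refine ⟨_, huc, fun z hz => harmonicAt_of_tendstoUniformlyOn hV hfc hfh
    (huc.mono subset_closure) (hfu.mono subset_closure) hz, fun z hz => ?_⟩
  refine tendsto_nhds_unique (hlim z (frontier_subset_closure hz)) ?_
  rw [Metric.tendsto_atTop]
  intro ε hε
  obtain ⟨N, hN⟩ := hfφ (ε / 2) (by positivity)
  refine ⟨N, fun n hn => ?_⟩
  rw [Real.dist_eq]
  linarith [hN n hn z hz]

/-! ### Computable integer arithmetic, finite checks and unbounded search -/

theorem encode_int_ofNat (n : ℕ) : Encodable.encode (Int.ofNat n) = 2 * n := rfl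

theorem encode_int_negSucc (n : ℕ) : Encodable.encode (Int.negSucc n) = 2 * n + 1 := rfl

/-- The parity of the code of an integer is its sign. Once positive and negative parts are primitive
recursive, integer arithmetic reduces to that of natural numbers. -/
theorem Primrec.int_toNat : Primrec Int.toNat := by
  have h : Primrec fun x : ℤ => if Encodable.encode x % 2 = 0 then Encodable.encode x / 2 else 0 :=
    Primrec.ite (Primrec.eq.comp (Primrec.nat_mod.comp .encode (.const 2)) (.const 0))
      (Primrec.nat_div.comp .encode (.const 2)) (.const 0)
  refine h.of_eq fun x => ?_
  cases x with
  | ofNat n => rw [encode_int_ofNat]; simp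
  | negSucc n => rw [encode_int_negSucc, if_neg (by omega)]; rfl

theorem Primrec.int_toNat_neg : Primrec fun x : ℤ => (-x).toNat := by
  have h : Primrec fun x : ℤ => if Encodable.encode x % 2 = 0 then 0
      else Encodable.encode x / 2 + 1 :=
    Primrec.ite (Primrec.eq.comp (Primrec.nat_mod.comp .encode (.const 2)) (.const 0))
      (.const 0) (Primrec.succ.comp (Primrec.nat_div.comp .encode (.const 2)))
  refine h.of_eq fun x => ?_
  cases x with
  | ofNat n => rw [encode_int_ofNat]; simp
  | negSucc n => rw [encode_int_negSucc, if_neg (by omega), Int.neg_negSucc]; simp; omega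

theorem Primrec.int_sub_nat : Primrec₂ fun a b : ℕ => (a : ℤ) - b := by
  refine Primrec₂.encode_iff.1 ?_
  have h : Primrec₂ fun a b : ℕ => if b ≤ a then 2 * (a - b) else 2 * (b - a - 1) + 1 :=
    Primrec.ite (Primrec.nat_le.comp .snd .fst)
      (Primrec.nat_mul.comp (.const 2) (Primrec.nat_sub.comp .fst .snd))
      (Primrec.succ.comp (Primrec.nat_mul.comp (.const 2)
        (Primrec.nat_sub.comp (Primrec.nat_sub.comp .snd .fst) (.const 1))))
  refine h.of_eq fun a b => ?_
  split_ifs with hab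
  · rw [show (a : ℤ) - b = Int.ofNat (a - b) by simp; omega, encode_int_ofNat]
  · rw [show (a : ℤ) - b = Int.negSucc (b - a - 1) by omega, encode_int_negSucc]

theorem Primrec.int_ofNat : Primrec fun n : ℕ => (n : ℤ) :=
  (Primrec.int_sub_nat.comp .id (.const 0)).of_eq fun n => by simp

theorem Primrec.int_add : Primrec₂ fun x y : ℤ => x + y := by
  have h : Primrec₂ fun x y : ℤ => ((x.toNat + y.toNat : ℕ) : ℤ) - ((-x).toNat + (-y).toNat : ℕ) :=
    Primrec.int_sub_nat.comp
      (Primrec.nat_add.comp (Primrec.int_toNat.comp .fst) (Primrec.int_toNat.comp .snd))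
      (Primrec.nat_add.comp (Primrec.int_toNat_neg.comp .fst) (Primrec.int_toNat_neg.comp .snd))
  exact h.of_eq fun x y => by omega

theorem Primrec.int_neg : Primrec fun x : ℤ => -x :=
  (Primrec.int_sub_nat.comp Primrec.int_toNat_neg Primrec.int_toNat).of_eq fun x => by omega

theorem Primrec.int_sub : Primrec₂ fun x y : ℤ => x - y :=
  (Primrec.int_add.comp .fst (Primrec.int_neg.comp .snd)).of_eq fun p => (sub_eq_add_neg p.1 p.2).symm

theorem Primrec.int_mul : Primrec₂ fun x y : ℤ => x * y := by
  have hp : Primrec fun p : ℤ × ℤ => p.1.toNat := Primrec.int_toNat.comp .fst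
  have hq : Primrec fun p : ℤ × ℤ => p.2.toNat := Primrec.int_toNat.comp .snd
  have hp' : Primrec fun p : ℤ × ℤ => (-p.1).toNat := Primrec.int_toNat_neg.comp .fst
  have hq' : Primrec fun p : ℤ × ℤ => (-p.2).toNat := Primrec.int_toNat_neg.comp .snd
  have h := Primrec.int_sub_nat.comp
    (Primrec.nat_add.comp (Primrec.nat_mul.comp hp hq) (Primrec.nat_mul.comp hp' hq'))
    (Primrec.nat_add.comp (Primrec.nat_mul.comp hp hq') (Primrec.nat_mul.comp hp' hq))
  refine h.of_eq fun p => ?_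
  have h1 : p.1 = p.1.toNat - (-p.1).toNat := by omega
  have h2 : p.2 = p.2.toNat - (-p.2).toNat := by omega
  conv_rhs => rw [h1, h2]
  push_cast
  ring

theorem Primrec.int_le : Primrec₂ fun x y : ℤ => decide (x ≤ y) := by
  have h : Primrec₂ fun x y : ℤ => decide (x.toNat + (-y).toNat ≤ y.toNat + (-x).toNat) :=
    (primrecRel_iff_primrec_decide.1 Primrec.nat_le).comp
      (Primrec.nat_add.comp (Primrec.int_toNat.comp .fst) (Primrec.int_toNat_neg.comp .snd))
      (Primrec.nat_add.comp (Primrec.int_toNat.comp .snd) (Primrec.int_toNat_neg.comp .fst))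
  exact h.of_eq fun x y => by
    congr 1
    simp only [eq_iff_iff]
    omega

theorem Primrec.two_pow : Primrec fun n : ℕ => 2 ^ n := by
  refine Primrec.of_eq (Primrec.nat_rec₁ 1 (f := fun _ x => 2 * x)
    (Primrec.nat_mul.comp (.const 2) .snd)) fun n => ?_
  induction n with
  | zero => rfl
  | succ n ih => rw [pow_succ', ← ih]

theorem Primrec.int_two_pow : Primrec fun n : ℕ => (2 : ℤ) ^ n :=
  (Primrec.int_ofNat.comp Primrec.two_pow).of_eq fun n => by push_cast; rfl

section Lists
variable {α β : Type*} [Primcodable α] [Primcodable β]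

theorem Computable.list_all {L : α → List β} {p : α → β → Bool} (hL : Computable L)
    (hp : Computable₂ p) : Computable fun a => (L a).all (p a) := by
  have h : Computable fun a => Nat.rec (motive := fun _ => Bool) true
      (fun i acc => acc && ((L a)[i]?.map (p a)).getD true) (L a).length := by
    refine Computable.nat_rec (Computable.list_length.comp hL) (Computable.const true)
      (h := fun a (q : ℕ × Bool) => q.2 && ((L a)[q.1]?.map (p a)).getD true) ?_
    refine (Primrec.and.to_comp.comp (Computable.snd.comp .snd) ?_)
    refine Computable.option_getD (Computable.option_map ?_ ?_) (Computable.const true)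
    · exact Computable.list_getElem?.comp (hL.comp .fst) (Computable.fst.comp .snd)
    · exact hp.comp (Computable.fst.comp .fst) .snd
  refine h.of_eq fun a => ?_
  have key : ∀ n ≤ (L a).length, Nat.rec (motive := fun _ => Bool) true
      (fun i acc => acc && ((L a)[i]?.map (p a)).getD true) n = ((L a).take n).all (p a) := by
    intro n
    induction n with
    | zero => simp
    | succ n ih =>
      intro hn
      have hn' : n < (L a).length := hn
      simp only [ih hn'.le, List.take_add_one, List.all_append]
      simp [List.getElem?_eq_getElem hn']
  rw [key _ le_rfl, List.take_length]

theorem Computable.bool_and {f g : α → Bool} (hf : Computable f) (hg : Computable g) :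
    Computable fun a => f a && g a :=
  Primrec.and.to_comp.comp hf hg

theorem Computable.bool_or {f g : α → Bool} (hf : Computable f) (hg : Computable g) :
    Computable fun a => f a || g a :=
  Primrec.or.to_comp.comp hf hg

theorem Computable.bool_not {f : α → Bool} (hf : Computable f) : Computable fun a => !f a :=
  Primrec.not.to_comp.comp hf

theorem Computable.list_any {L : α → List β} {p : α → β → Bool} (hL : Computable L)
    (hp : Computable₂ p) : Computable fun a => (L a).any (p a) := by
  have h := (Computable.list_all hL (p := fun a b => !p a b) (Computable.bool_not hp)).bool_not
  exact h.of_eq fun a => by simp [List.any_eq_not_all_not]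

/-- An unbounded search that always succeeds is computable. -/
theorem Computable.exists_search [Inhabited β] {p : α → β → Bool} (hp : Computable₂ p)
    (h : ∀ a, ∃ b, p a b = true) : ∃ f : α → β, Computable f ∧ ∀ a, p a (f a) = true := by
  classical
  set q : α → ℕ → Bool := fun a n => ((Encodable.decode (α := β) n).map (p a)).getD false with hq
  have h' : ∀ a, ∃ n : ℕ, q a n = true := fun a => by
    obtain ⟨b, hb⟩ := h a
    exact ⟨Encodable.encode b, by simpa [hq] using hb⟩
  have hqc : Computable₂ q := by
    refine Computable.option_getD (Computable.option_map (Computable.decode.comp .snd) ?_)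
      (Computable.const false)
    exact hp.comp (Computable.fst.comp .fst) .snd
  have hr := Partrec.rfind hqc.partrec₂
  have hc : Computable fun a => Nat.find (h' a) := by
    refine hr.of_eq_tot fun a => ?_
    refine Nat.mem_rfind.2 ⟨?_, fun {m} hm => ?_⟩
    · simpa using Nat.find_spec (h' a)
    · simpa using Nat.find_min (h' a) hm
  refine ⟨fun a => (Encodable.decode (α := β) (Nat.find (h' a))).getD default,
    Computable.option_getD (Computable.decode.comp hc) (Computable.const default), fun a => ?_⟩
  have h1 := Nat.find_spec (h' a)
  simp only [hq] at h1
  cases hd : Encodable.decode (α := β) (Nat.find (h' a)) with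
  | none => rw [hd] at h1; simp at h1
  | some b => simp only [hd] at h1 ⊢; simpa using h1

end Lists

/-! ### Square roots of `z - a` away from a connected set -/

/-- The principal square root. -/
noncomputable def principalSqrt (w : ℂ) : ℂ := Complex.exp (Complex.log w / 2)

theorem principalSqrt_sq {w : ℂ} (hw : w ≠ 0) : principalSqrt w ^ 2 = w := by
  rw [principalSqrt, ← Complex.exp_nat_mul, Nat.cast_ofNat, mul_div_cancel₀ _ two_ne_zero,
    Complex.exp_log hw]

theorem continuousAt_principalSqrt_one_add {t : ℂ} (ht : ‖t‖ < 1) :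
    ContinuousAt (fun t => principalSqrt (1 + t)) t := by
  have h := Complex.mem_slitPlane_of_norm_lt_one ht
  have h1 : ContinuousAt (fun t : ℂ => 1 + t) t := by fun_prop
  exact ((h1.clog h).div_const 2).cexp

theorem one_add_ne_zero_of_norm_lt {t : ℂ} (ht : ‖t‖ < 1) : 1 + t ≠ 0 :=
  Complex.slitPlane_ne_zero (Complex.mem_slitPlane_of_norm_lt_one ht)

/-- `z - a` has a continuous square root on `W`. -/
def HasSqrtOn (W : Set ℂ) (a : ℂ) : Prop :=
  ∃ σ : ℂ → ℂ, ContinuousOn σ W ∧ ∀ z ∈ W, σ z ^ 2 = z - a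

/-- `z - b = (a - b) * (1 + (z - a) / (a - b))`, and the last factor stays within distance less than
`1` of `1`. -/
theorem hasSqrtOn_of_far {W : Set ℂ} {a b : ℂ} (h : ∀ z ∈ W, dist z a < dist b a) :
    HasSqrtOn W b := by
  rcases eq_or_ne b a with rfl | hne
  · refine ⟨fun _ => 0, continuousOn_const, fun z hz => ?_⟩
    have := h z hz
    rw [dist_self] at this
    exact absurd this (not_lt.2 dist_nonneg)
  have hab : a - b ≠ 0 := sub_ne_zero.2 hne.symm
  have hlt : ∀ z ∈ W, ‖(z - a) / (a - b)‖ < 1 := by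
    intro z hz
    rw [norm_div, div_lt_one (norm_pos_iff.2 hab), ← dist_eq_norm, ← dist_eq_norm, dist_comm a b]
    exact h z hz
  refine ⟨fun z => principalSqrt (a - b) * principalSqrt (1 + (z - a) / (a - b)), ?_, ?_⟩
  · refine continuousOn_const.mul fun z hz => ContinuousAt.continuousWithinAt ?_
    exact ContinuousAt.comp (f := fun z => (z - a) / (a - b))
      (continuousAt_principalSqrt_one_add (hlt z hz)) (by fun_prop)
  · intro z hz
    rw [mul_pow, principalSqrt_sq hab, principalSqrt_sq (one_add_ne_zero_of_norm_lt (hlt z hz))]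
    field_simp
    ring

/-- `z - p' = (z - p) * (1 + (p - p') / (z - p))`, with the last factor again in the slit plane. -/
theorem HasSqrtOn.of_near {W : Set ℂ} {p p' : ℂ} (h : HasSqrtOn W p)
    (hd : ∀ z ∈ W, dist p p' < dist z p) : HasSqrtOn W p' := by
  obtain ⟨σ, hσ, hσ2⟩ := h
  have hne : ∀ z ∈ W, z - p ≠ 0 := fun z hz =>
    sub_ne_zero.2 (dist_pos.1 (dist_nonneg.trans_lt (hd z hz)))
  have hlt : ∀ z ∈ W, ‖(p - p') / (z - p)‖ < 1 := by
    intro z hz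
    rw [norm_div, div_lt_one (norm_pos_iff.2 (hne z hz)), ← dist_eq_norm, ← dist_eq_norm]
    exact hd z hz
  refine ⟨fun z => σ z * principalSqrt (1 + (p - p') / (z - p)), ?_, ?_⟩
  · refine hσ.mul fun z hz => ContinuousAt.continuousWithinAt ?_
    refine ContinuousAt.comp (f := fun z => (p - p') / (z - p))
      (continuousAt_principalSqrt_one_add (hlt z hz)) ?_
    exact continuousAt_const.div (by fun_prop) (hne z hz)
  · intro z hz
    have := hne z hz
    rw [mul_pow, hσ2 z hz, principalSqrt_sq (one_add_ne_zero_of_norm_lt (hlt z hz))]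
    field_simp
    ring

/-- The property of having a square root spreads along a connected set far from `W`. -/
theorem HasSqrtOn.of_isPreconnected {W G : Set ℂ} {δ : ℝ} (hδ : 0 < δ) (hG : IsPreconnected G)
    (hfar : ∀ z ∈ W, ∀ p ∈ G, 2 * δ ≤ dist z p) {a b : ℂ} (ha : a ∈ G) (hb : b ∈ G)
    (h : HasSqrtOn W b) : HasSqrtOn W a := by
  have hnear : ∀ p ∈ G, ∀ p' ∈ G, dist p p' < 2 * δ → HasSqrtOn W p → HasSqrtOn W p' :=
    fun p hp p' _ hd hp' => hp'.of_near fun z hz => hd.trans_le (hfar z hz p hp)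
  by_contra hna
  set P := {p | p ∈ G ∧ HasSqrtOn W p} with hP
  set N := {p | p ∈ G ∧ ¬ HasSqrtOn W p} with hN
  have hopen : ∀ S : Set ℂ, IsOpen (⋃ p ∈ S, ball p δ) := fun S => isOpen_biUnion fun _ _ => isOpen_ball
  obtain ⟨x, hxG, hx1, hx2⟩ := hG _ _ (hopen P) (hopen N)
    (fun p hp => by
      by_cases hs : HasSqrtOn W p
      · exact Or.inl (mem_biUnion (show p ∈ P from ⟨hp, hs⟩) (mem_ball_self hδ))
      · exact Or.inr (mem_biUnion (show p ∈ N from ⟨hp, hs⟩) (mem_ball_self hδ)))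
    ⟨b, hb, mem_biUnion (show b ∈ P from ⟨hb, h⟩) (mem_ball_self hδ)⟩
    ⟨a, ha, mem_biUnion (show a ∈ N from ⟨ha, hna⟩) (mem_ball_self hδ)⟩
  obtain ⟨p, hp, hxp⟩ := mem_iUnion₂.1 hx1
  obtain ⟨p', hp', hxp'⟩ := mem_iUnion₂.1 hx2
  rw [mem_ball] at hxp hxp'
  refine hp'.2 (hnear p hp.1 p' hp'.1 ?_ hp.2)
  linarith [dist_triangle_left p p' x]

theorem exists_div_two_pow_lt (c : ℝ) {δ : ℝ} (hδ : 0 < δ) : ∃ n : ℕ, c / 2 ^ n < δ := by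
  have h : Tendsto (fun n : ℕ => c / 2 ^ n) atTop (𝓝 0) :=
    tendsto_const_nhds.div_atTop (tendsto_pow_atTop_atTop_of_one_lt one_lt_two)
  exact (h.eventually (gt_mem_nhds hδ)).exists

/-- The set at distance at least `δ` from the complement of `V` is at distance at least `δ / 2` from
a fine enough grid union. This union is connected and contains both `a` and `b`. Since `b` is
outside the disc, `z - b` has a root there, and the root is carried along the union to `a`. -/
theorem IsComputableApproximation.nonThinAt {K V : Set ℂ} {C : ℕ → List (ℤ × ℤ)}
    (hC : IsComputableApproximation K C) (hKV : ∀ y ∈ K, y ∉ V) {a b : ℂ} (ha : a ∈ K) (hb : b ∈ K)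
    {r : ℝ} (hr : r ≤ dist b a) : NonThinAt V a r := by
  intro δ hδ
  obtain ⟨n, hn⟩ := exists_div_two_pow_lt 4 (half_pos hδ)
  have hfar : ∀ z ∈ {z | z ∈ ball a r ∧ ∀ w, w ∉ V → δ ≤ dist z w}, ∀ p ∈ gridUnion n (C n),
      2 * (δ / 4) ≤ dist z p := by
    intro z hz p hp
    obtain ⟨y, hy, hpy⟩ := hC.close n p hp
    have := hz.2 y (hKV y hy)
    linarith [dist_triangle z p y]
  obtain ⟨σ, h1, h2⟩ := HasSqrtOn.of_isPreconnected (by positivity) (hC.connected n).isPreconnected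
    hfar (hC.covers n ha) (hC.covers n hb)
    (hasSqrtOn_of_far fun z hz => (mem_ball.1 hz.1).trans_le hr)
  exact ⟨σ, h1, fun z hz hz' => h2 z ⟨hz, hz'⟩⟩

theorem nonThinAt_of_mem_sphere {V : Set ℂ} {R : ℝ} (hV : V ⊆ ball 0 R) {a : ℂ}
    (ha : a ∈ sphere (0 : ℂ) R) (r : ℝ) : NonThinAt V a r := by
  intro δ hδ
  obtain ⟨σ, h1, h2⟩ := hasSqrtOn_of_far
    (W := {z | z ∈ ball a r ∧ ∀ w, w ∉ V → δ ≤ dist z w}) (a := 0) (b := a) (by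
      intro z hz
      have hzV : z ∈ V := by
        by_contra h
        have := hz.2 z h
        rw [dist_self] at this
        linarith
      rw [mem_sphere.1 ha]
      exact mem_ball.1 (hV hzV))
  exact ⟨σ, h1, fun z hz hz' => h2 z ⟨hz, hz'⟩⟩

/-! ### Continuity of the boundary data and the two-sided Dirichlet problem -/

theorem isClosed_gridSquare (n : ℕ) (c : ℤ × ℤ) : IsClosed (gridSquare n c) := by
  have h : gridSquare n c = Complex.re ⁻¹' Icc ((c.1 : ℝ) / 2 ^ n) (((c.1 : ℝ) + 1) / 2 ^ n) ∩
      Complex.im ⁻¹' Icc ((c.2 : ℝ) / 2 ^ n) (((c.2 : ℝ) + 1) / 2 ^ n) := by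
    ext z
    simp [gridSquare, and_assoc]
  rw [h]
  exact (isClosed_Icc.preimage Complex.continuous_re).inter
    (isClosed_Icc.preimage Complex.continuous_im)

theorem TendsToZeroComputably.exists_le {ε : ℕ → ℝ} (hε : TendsToZeroComputably ε) {δ : ℝ}
    (hδ : 0 < δ) : ∃ n, |ε n| < δ := by
  obtain ⟨m, -, hm⟩ := hε
  obtain ⟨k, hk⟩ := exists_div_two_pow_lt 1 hδ
  exact ⟨m k, (hm k _ le_rfl).trans_lt hk⟩

/-- Points of `K` close enough to `y` lie only in squares of level `n` that also contain `y`,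
because there are finitely many squares and they are closed. Two points in a common square have
values within `2 * ε n`. -/
theorem IsComputableCondition.continuousOn {K : Set ℂ} {C : ℕ → List (ℤ × ℤ)} {φ : ℂ → ℝ}
    (hC : IsComputableApproximation K C) (hφ : IsComputableCondition K C φ) : ContinuousOn φ K := by
  obtain ⟨ψ, ε, -, -, hε, hψ, -⟩ := hφ
  intro y hy
  rw [Metric.continuousWithinAt_iff']
  intro δ hδ
  obtain ⟨n, hn⟩ := hε.exists_le (half_pos hδ)
  have hev : ∀ c ∈ {c | c ∈ C n}, ∀ᶠ x in 𝓝 y, x ∈ gridSquare n c → y ∈ gridSquare n c := by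
    intro c _
    by_cases h : y ∈ gridSquare n c
    · exact Eventually.of_forall fun _ _ => h
    · filter_upwards [(isClosed_gridSquare n c).isOpen_compl.mem_nhds h] with x hx hx'
      exact absurd hx' hx
  have hfin : {c | c ∈ C n}.Finite := List.finite_toSet _
  have hall := (eventually_all_finite hfin).2 hev
  filter_upwards [mem_nhdsWithin_of_mem_nhds hall, self_mem_nhdsWithin] with x hx hxK
  obtain ⟨c, hc, hxc⟩ := mem_iUnion₂.1 (hC.covers n hxK)
  have h1 := hψ n c hc x ⟨hxK, hxc⟩
  have h2 := hψ n c hc y ⟨hy, hx c hc hxc⟩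
  have h3 := le_abs_self (ε n)
  rw [Real.dist_eq]
  have : φ x - φ y = (ψ n c - φ y) - (ψ n c - φ x) := by ring
  rw [this]
  have h4 := abs_sub (ψ n c - φ y) (ψ n c - φ x)
  linarith

/-- The frontier of a bounded nonempty open set has points with different real parts. -/
theorem exists_re_lt_re_frontier {U : Set ℂ} (hU : IsOpen U) (hne : U.Nonempty)
    (hb : Bornology.IsBounded U) : ∃ p ∈ frontier U, ∃ q ∈ frontier U, p.re < q.re := by
  obtain ⟨z, hz⟩ := hne
  have hK := hb.isCompact_closure
  have hnc : (closure U).Nonempty := ⟨z, subset_closure hz⟩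
  obtain ⟨q, hq, hqm⟩ := hK.exists_isMaxOn hnc Complex.continuous_re.continuousOn
  obtain ⟨p, hp, hpm⟩ := hK.exists_isMinOn hnc Complex.continuous_re.continuousOn
  have hmove : ∀ w ∈ U, ∃ ε > 0, w + (ε : ℝ) ∈ U ∧ w - (ε : ℝ) ∈ U := by
    intro w hw
    obtain ⟨ε, hε, hball⟩ := Metric.isOpen_iff.1 hU w hw
    refine ⟨ε / 2, by positivity, hball ?_, hball ?_⟩ <;>
    · simp only [mem_ball, dist_eq_norm]
      simp [abs_of_pos hε, hε]
  have hqU : q ∉ U := by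
    intro h
    obtain ⟨ε, hε, h1, -⟩ := hmove q h
    have : (q + (ε : ℝ)).re ≤ q.re := hqm (subset_closure h1)
    simp at this
    linarith
  have hpU : p ∉ U := by
    intro h
    obtain ⟨ε, hε, -, h1⟩ := hmove p h
    have : p.re ≤ (p - (ε : ℝ)).re := hpm (subset_closure h1)
    simp at this
    linarith
  refine ⟨p, by rw [hU.frontier_eq]; exact ⟨hp, hpU⟩, q, by rw [hU.frontier_eq]; exact ⟨hq, hqU⟩, ?_⟩
  obtain ⟨ε, hε, h1, h2⟩ := hmove z hz
  have a : (z + (ε : ℝ)).re ≤ q.re := hqm (subset_closure h1)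
  have b : p.re ≤ (z - (ε : ℝ)).re := hpm (subset_closure h2)
  simp at a b
  linarith

/-- `u` solves the Dirichlet problem with boundary values `φ` on both sides of `K`, inside a disc of
radius `2 ^ (b + 2)`; it is bounded by `2 ^ M`, and `K` is nowhere thin at the scale `1 / 2 ^ A`. -/
structure IsTwoSidedSolution (K : Set ℂ) (φ u : ℂ → ℝ) (b M A : ℕ) : Prop where
  isCompact : IsCompact K
  subset : K ⊆ closedBall 0 (2 ^ b - 1)
  continuousOn : ContinuousOn u (closedBall 0 (2 ^ (b + 2)))
  harmonic : ∀ z ∈ ball 0 (2 ^ (b + 2)) \ K, HarmonicAt u z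
  boundary : ∀ z ∈ K, u z = φ z
  bound : ∀ z ∈ closedBall (0 : ℂ) (2 ^ (b + 2)), |u z| ≤ 2 ^ M
  nonThin : ∀ a ∈ K, NonThinAt (ball 0 (2 ^ (b + 2)) \ K) a (1 / 2 ^ A)

theorem exists_le_two_pow (x : ℝ) : ∃ n : ℕ, x ≤ 2 ^ n := by
  obtain ⟨n, hn⟩ := pow_unbounded_of_one_lt x one_lt_two
  exact ⟨n, hn.le⟩

theorem exists_isTwoSidedSolution {U : Set ℂ} (hU : IsOpen U) (hne : U.Nonempty)
    (hb : Bornology.IsBounded U) {C : ℕ → List (ℤ × ℤ)}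
    (hC : IsComputableApproximation (frontier U) C) {φ : ℂ → ℝ}
    (hφ : ContinuousOn φ (frontier U)) :
    ∃ (u : ℂ → ℝ) (b M A : ℕ), IsTwoSidedSolution (frontier U) φ u b M A ∧
      closure U ⊆ closedBall 0 (2 ^ b - 1) := by
  set K := frontier U with hK
  have hKc : IsCompact K :=
    hb.isCompact_closure.of_isClosed_subset isClosed_frontier frontier_subset_closure
  obtain ⟨ρ, hρ⟩ := hb.closure.subset_closedBall 0
  obtain ⟨b, hb'⟩ := exists_le_two_pow (ρ + 1)
  have hcl : closure U ⊆ closedBall 0 (2 ^ b - 1) :=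
    hρ.trans (closedBall_subset_closedBall (by linarith))
  have hKb : K ⊆ closedBall 0 (2 ^ b - 1) := frontier_subset_closure.trans hcl
  set R : ℝ := 2 ^ (b + 2) with hR
  have hR0 : 0 < R := by positivity
  have hbR : closedBall (0 : ℂ) (2 ^ b - 1) ⊆ ball 0 R := by
    refine closedBall_subset_ball ?_
    rw [hR, pow_add]
    have : (0 : ℝ) < 2 ^ b := by positivity
    linarith
  set V := ball (0 : ℂ) R \ K with hV
  have hVo : IsOpen V := isOpen_ball.sdiff hKc.isClosed
  have hVb : Bornology.IsBounded V := isBounded_ball.subset sdiff_subset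
  -- Every point of `K` is at distance at least `dist p q / 2` from `p` or from `q`, which gives one
  -- scale of non-thinness valid on all of `K`.
  obtain ⟨p, hp, q, hq, hpq⟩ := exists_re_lt_re_frontier hU hne hb
  have hpq0 : 0 < dist p q := dist_pos.2 fun h => by rw [h] at hpq; exact lt_irrefl _ hpq
  obtain ⟨A, hA⟩ := exists_div_two_pow_lt 1 (half_pos hpq0)
  have hnt : ∀ a ∈ K, NonThinAt V a (1 / 2 ^ A) := by
    intro a ha
    by_cases hpa : dist p q / 2 ≤ dist p a
    · exact hC.nonThinAt (fun y hy hy' => hy'.2 hy) ha hp (hA.le.trans hpa)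
    · refine hC.nonThinAt (fun y hy hy' => hy'.2 hy) ha hq (hA.le.trans ?_)
      linarith [dist_triangle_right p q a]
  have hUV : U ⊆ V := fun z hz => ⟨hbR (hcl (subset_closure hz)), fun h => by
    rw [hK, hU.frontier_eq] at h; exact h.2 hz⟩
  have hKV : K ⊆ closure V := frontier_subset_closure.trans (closure_mono hUV)
  have hballV : ball (0 : ℂ) R ⊆ closure V := by
    intro z hz
    by_cases h : z ∈ K
    · exact hKV h
    · exact subset_closure ⟨hz, h⟩
  have hcbV : closedBall (0 : ℂ) R ⊆ closure V := by
    rw [← closure_ball _ hR0.ne']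
    exact closure_minimal hballV isClosed_closure
  have hKf : K ⊆ frontier V := fun z hz => by
    rw [hVo.frontier_eq]; exact ⟨hKV hz, fun h => h.2 hz⟩
  have hfr : ∀ a ∈ frontier V, ∃ r > 0, NonThinAt V a r := by
    intro a ha
    by_cases haK : a ∈ K
    · exact ⟨_, by positivity, hnt a haK⟩
    · refine ⟨1, one_pos, nonThinAt_of_mem_sphere sdiff_subset ?_ 1⟩
      rw [hVo.frontier_eq] at ha
      have h1 : a ∈ closedBall (0 : ℂ) R :=
        closure_ball_subset_closedBall (closure_mono sdiff_subset ha.1)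
      rw [← sphere_union_ball] at h1
      exact h1.resolve_right fun h => ha.2 ⟨h, haK⟩
  -- The values on the outer circle are immaterial; a Tietze extension of `φ` supplies some.
  obtain ⟨g, hg⟩ := ContinuousMap.exists_restrict_eq hKc.isClosed
    (⟨K.domRestrict φ, hφ.domRestrict⟩ : C(K, ℝ))
  obtain ⟨u, hu, huh, huf⟩ := exists_dirichlet hVo hVb hfr (φ := g) g.continuous.continuousOn
  have hu' := hu.mono hcbV
  obtain ⟨M₀, hM₀⟩ := (isCompact_closedBall (0 : ℂ) R).exists_bound_of_continuousOn hu'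
  obtain ⟨M, hM⟩ := exists_le_two_pow M₀
  refine ⟨u, b, M, A, ⟨hKc, hKb, hu', huh, fun z hz => ?_, fun z hz => (hM₀ z hz).trans hM, hnt⟩, hcl⟩
  rw [huf z (hKf hz)]
  exact congrFun (congrArg DFunLike.coe hg) ⟨z, hz⟩

/-! ### Quantitative estimates for harmonic functions -/

theorem abs_sum_poissonIntegral_le {ι : Type*} (s : Finset ι) (a : ι → ℝ) (w : ι → ℂ) {c : ℂ}
    {R M ε : ℝ} {u : ℂ → ℝ} (hR : 0 < R) (hw : ∀ i ∈ s, w i ∈ ball c R)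
    (hu : ContinuousOn u (sphere c R)) (hM : ∀ z ∈ sphere c R, |u z| ≤ M)
    (hε : ∀ z ∈ sphere c R, |∑ i ∈ s, a i * poissonKernel c (w i) z| ≤ ε) (hε0 : 0 ≤ ε) :
    |∑ i ∈ s, a i * poissonIntegral c R u (w i)| ≤ ε * M := by
  have hui := hu.circleIntegrable hR.le
  have hk : ContinuousOn (fun z => (∑ i ∈ s, a i * poissonKernel c (w i) z) * u z) (sphere c R) := by
    refine ContinuousOn.mul (continuousOn_finsetSum s fun i hi => ?_) hu
    refine continuousOn_const.mul ?_
    have := continuousOn_poissonKernel (hw i hi)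
    rwa [abs_of_pos hR] at this
  -- A combination of values of `u` is the mean of `u` against the same combination of Poisson
  -- kernels, so estimates for finite differences reduce to algebra with kernels.
  have h1 : ∑ i ∈ s, a i * poissonIntegral c R u (w i) =
      Real.circleAverage (fun z => (∑ i ∈ s, a i * poissonKernel c (w i) z) * u z) c R := by
    have h2 : (fun z => (∑ i ∈ s, a i * poissonKernel c (w i) z) * u z) =
        fun z => ∑ i ∈ s, a i • (poissonKernel c (w i) z * u z) := by
      ext z
      rw [Finset.sum_mul]
      exact Finset.sum_congr rfl fun i _ => mul_assoc _ _ _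
    rw [h2, Real.circleAverage_fun_sum]
    · exact Finset.sum_congr rfl fun i _ => (Real.circleAverage_fun_smul (a := a i)).symm
    · exact fun i hi => (circleIntegrable_poissonKernel_mul (hw i hi) hui).const_fun_smul
  rw [h1]
  refine Real.abs_circleAverage_le_circleAverage_abs.trans ?_
  refine Real.circleAverage_mono_on_of_le_circle (hk.abs.circleIntegrable hR.le) fun z hz => ?_
  rw [abs_of_pos hR] at hz
  rw [Pi.abs_apply, abs_mul]
  exact mul_le_mul (hε z hz) (hM z hz) (abs_nonneg _) hε0

theorem poissonKernel_self {c z : ℂ} {R : ℝ} (hR : 0 < R) (hz : z ∈ sphere c R) :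
    poissonKernel c c z = 1 := by
  rw [mem_sphere, dist_eq_norm] at hz
  rw [poissonKernel, hz, sub_self, sub_zero, hz]
  simp [hR.ne']

theorem poissonKernel_add_eq {c h z : ℂ} :
    poissonKernel c (c + h) z = (((z - c) + h) / ((z - c) - h)).re := by
  rw [poissonKernel_eq_re_herglotzRieszKernel]
  simp [herglotzRieszKernel_def]

/-- A Lipschitz estimate for bounded harmonic functions. -/
theorem abs_sub_le_of_harmonic {c w : ℂ} {R M : ℝ} {u : ℂ → ℝ} (hR : 0 < R)
    (hu : HarmonicContOnCl u (ball c R)) (hM : ∀ z ∈ sphere c R, |u z| ≤ M)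
    (hw : dist w c ≤ R / 2) : |u w - u c| ≤ 4 * (dist w c / R) * M := by
  have hwb : w ∈ ball c R := by rw [mem_ball]; linarith
  have h := abs_sum_poissonIntegral_le (u := u) (M := M) (ε := 4 * (dist w c / R)) Finset.univ
    ![1, -1] ![w, c] hR
    (by intro i _; fin_cases i; exacts [hwb, mem_ball_self hR])
    (hu.continuousOn_ball.mono sphere_subset_closedBall) hM ?_ (by positivity)
  · simp only [Fin.sum_univ_two, Matrix.cons_val_zero, Matrix.cons_val_one,
      poissonIntegral_of_harmonic hu hwb, poissonIntegral_of_harmonic hu (mem_ball_self hR)] at h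
    convert h using 2
    ring
  · intro z hz
    simp only [Fin.sum_univ_two, Matrix.cons_val_zero, Matrix.cons_val_one,
      poissonKernel_self hR hz]
    have e : poissonKernel c w z = poissonKernel c (c + (w - c)) z := by rw [add_sub_cancel]
    have hz' : ‖z - c‖ = R := by rw [← dist_eq_norm]; exact hz
    set h := w - c with hh
    have hd : dist w c = ‖h‖ := dist_eq_norm _ _
    rw [hd] at hw ⊢
    have h1 : R / 2 ≤ ‖(z - c) - h‖ := by
      have := norm_sub_norm_le (z - c) h
      linarith
    have h2 : (z - c) - h ≠ 0 := by
      intro h0; rw [h0, norm_zero] at h1; linarith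
    have e2 : 1 * poissonKernel c w z + -1 * 1 = (2 * h / ((z - c) - h)).re := by
      rw [e, poissonKernel_add_eq]
      have : ((z - c) + h) / ((z - c) - h) = 1 + 2 * h / ((z - c) - h) := by
        field_simp; ring
      rw [this, Complex.add_re, Complex.one_re]; ring
    rw [e2]
    refine (Complex.abs_re_le_norm _).trans ?_
    rw [norm_div, norm_mul, Complex.norm_ofNat, div_le_iff₀ (by linarith)]
    have h3 : 0 ≤ ‖h‖ / R := by positivity
    calc 2 * ‖h‖ = 4 * (‖h‖ / R) * (R / 2) := by field_simp; ring
      _ ≤ _ := by gcongr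

/-- The discrete Laplacian of a bounded harmonic function is small. -/
theorem abs_discreteLaplacian_le_of_harmonic {c : ℂ} {R M h : ℝ} {u : ℂ → ℝ} (hR : 0 < R)
    (hu : HarmonicContOnCl u (ball c R)) (hM : ∀ z ∈ sphere c R, |u z| ≤ M) (hh : 0 ≤ h)
    (hhR : h ≤ R / 2) :
    |u (c + h) + u (c - h) + u (c + h * Complex.I) + u (c - h * Complex.I) - 4 * u c| ≤
      16 * (h / R) ^ 4 * M := by
  have hm : ∀ ω : ℂ, ‖ω‖ = 1 → c + h * ω ∈ ball c R := by
    intro ω hω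
    rw [mem_ball, dist_eq_norm, add_sub_cancel_left, norm_mul, hω, Complex.norm_real,
      Real.norm_eq_abs, abs_of_nonneg hh]
    linarith
  have m1 : c + h ∈ ball c R := by simpa using hm 1 (by simp)
  have m2 : c - h ∈ ball c R := by simpa [sub_eq_add_neg] using hm (-1) (by simp)
  have m3 : c + h * Complex.I ∈ ball c R := hm Complex.I (by simp)
  have m4 : c - h * Complex.I ∈ ball c R := by
    simpa [sub_eq_add_neg] using hm (-Complex.I) (by simp)
  have m5 : c ∈ ball c R := mem_ball_self hR
  have key := abs_sum_poissonIntegral_le (u := u) (M := M) (ε := 16 * (h / R) ^ 4) Finset.univ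
    ![1, 1, 1, 1, -4] ![c + h, c - h, c + h * Complex.I, c - h * Complex.I, c] hR
    (by intro i _; fin_cases i; exacts [m1, m2, m3, m4, m5])
    (hu.continuousOn_ball.mono sphere_subset_closedBall) hM ?_ (by positivity)
  · simp only [Fin.sum_univ_five, Matrix.cons_val, poissonIntegral_of_harmonic hu m1,
      poissonIntegral_of_harmonic hu m2, poissonIntegral_of_harmonic hu m3,
      poissonIntegral_of_harmonic hu m4, poissonIntegral_of_harmonic hu m5] at key
    convert key using 2
    ring
  · intro z hz
    simp only [Fin.sum_univ_five, Matrix.cons_val, poissonKernel_self hR hz]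
    have hz' : ‖z - c‖ = R := by rw [← dist_eq_norm]; exact hz
    set ζ := z - c with hζ
    have hne : ∀ ω : ℂ, ‖ω‖ = 1 → ζ - h * ω ≠ 0 := by
      intro ω hω h0
      have h1 : ‖ζ‖ = ‖(h : ℂ) * ω‖ := by rw [sub_eq_zero.1 h0]
      rw [hz', norm_mul, hω, Complex.norm_real, Real.norm_eq_abs, abs_of_nonneg hh] at h1
      linarith
    have n1 : ζ - h ≠ 0 := by simpa using hne 1 (by simp)
    have n2 : ζ + h ≠ 0 := by simpa using hne (-1) (by simp)
    have n3 : ζ - h * Complex.I ≠ 0 := hne Complex.I (by simp)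
    have n4 : ζ + h * Complex.I ≠ 0 := by simpa using hne (-Complex.I) (by simp)
    have hfac : ζ ^ 4 - (h : ℂ) ^ 4 = (ζ - h) * (ζ + h) * ((ζ - h * Complex.I) * (ζ + h * Complex.I)) := by
      linear_combination ((ζ ^ 2 - (h : ℂ) ^ 2) * (h : ℂ) ^ 2) * Complex.I_sq
    have n5 : ζ ^ 4 - (h : ℂ) ^ 4 ≠ 0 := by
      rw [hfac]; exact mul_ne_zero (mul_ne_zero n1 n2) (mul_ne_zero n3 n4)
    -- In the expansion `(ζ + hω) / (ζ - hω) = 1 + 2 ∑ (hω / ζ) ^ i`, summing over the fourth roots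
    -- of unity `ω` keeps only the powers divisible by four. This yields the fourth order in `h /
    -- R`.
    have e2 : 1 * poissonKernel c (c + h) z + 1 * poissonKernel c (c - h) z +
        1 * poissonKernel c (c + h * Complex.I) z + 1 * poissonKernel c (c - h * Complex.I) z +
        -4 * 1 = (8 * (h : ℂ) ^ 4 / (ζ ^ 4 - (h : ℂ) ^ 4)).re := by
      rw [sub_eq_add_neg c, sub_eq_add_neg c, poissonKernel_add_eq, poissonKernel_add_eq,
        poissonKernel_add_eq, poissonKernel_add_eq, ← hζ]
      have : (ζ + h) / (ζ - h) + (ζ + -h) / (ζ - -h) + (ζ + h * Complex.I) / (ζ - h * Complex.I) +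
          (ζ + -(h * Complex.I)) / (ζ - -(h * Complex.I)) =
          4 + 8 * (h : ℂ) ^ 4 / (ζ ^ 4 - (h : ℂ) ^ 4) := by
        have a1 : (ζ + h) / (ζ - h) + (ζ + -h) / (ζ - -h) =
            2 * (ζ ^ 2 + (h : ℂ) ^ 2) / ((ζ - h) * (ζ + h)) := by
          rw [sub_neg_eq_add]; field_simp; ring
        have a2 : (ζ + h * Complex.I) / (ζ - h * Complex.I) +
            (ζ + -(h * Complex.I)) / (ζ - -(h * Complex.I)) =
            2 * (ζ ^ 2 - (h : ℂ) ^ 2) / ((ζ - h * Complex.I) * (ζ + h * Complex.I)) := by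
          rw [sub_neg_eq_add, div_add_div _ _ n3 n4, div_eq_div_iff (mul_ne_zero n3 n4)
            (mul_ne_zero n3 n4)]
          linear_combination (2 * (h : ℂ) ^ 2 * ((ζ - h * Complex.I) * (ζ + h * Complex.I))) *
            Complex.I_sq
        rw [add_assoc ((ζ + h) / (ζ - h) + _), a1, a2, hfac,
          div_add_div _ _ (mul_ne_zero n1 n2) (mul_ne_zero n3 n4), eq_comm, ← hfac]
        rw [eq_div_iff n5, add_mul, div_mul_cancel₀ _ n5]
        linear_combination (2 * (ζ ^ 2 + (h : ℂ) ^ 2) * (h : ℂ) ^ 2) * Complex.I_sq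
      have h4 := congrArg Complex.re this
      simp only [Complex.add_re, Complex.re_ofNat] at h4
      linarith
    rw [e2]
    refine (Complex.abs_re_le_norm _).trans ?_
    have hR4 : R ^ 4 / 2 ≤ ‖ζ ^ 4 - (h : ℂ) ^ 4‖ := by
      have h1 := norm_sub_norm_le (ζ ^ 4) ((h : ℂ) ^ 4)
      rw [norm_pow, norm_pow, hz', Complex.norm_real, Real.norm_eq_abs, abs_of_nonneg hh] at h1
      have h2 : h ^ 4 ≤ (R / 2) ^ 4 := by gcongr
      have h3 : 0 < R ^ 4 := by positivity
      rw [div_pow] at h2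
      linarith
    rw [norm_div, norm_mul, norm_pow, Complex.norm_real, Real.norm_eq_abs, abs_of_nonneg hh,
      Complex.norm_ofNat, div_le_iff₀ (by rw [norm_pos_iff]; exact n5)]
    calc 8 * h ^ 4 = 16 * (h / R) ^ 4 * (R ^ 4 / 2) := by field_simp; ring
      _ ≤ _ := by gcongr

/-! ### Grid points, the discrete maximum principle and the boundary layer -/

/-- The point `z` is within `δ`, in each coordinate, of the grid square `c` of level `n`. -/
def GridNear (n : ℕ) (c : ℤ × ℤ) (δ : ℝ) (z : ℂ) : Prop :=
  ((c.1 : ℝ) / 2 ^ n ≤ z.re + δ ∧ z.re ≤ ((c.1 : ℝ) + 1) / 2 ^ n + δ) ∧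
    (c.2 : ℝ) / 2 ^ n ≤ z.im + δ ∧ z.im ≤ ((c.2 : ℝ) + 1) / 2 ^ n + δ

theorem gridNear_of_dist_le {n : ℕ} {c : ℤ × ℤ} {δ : ℝ} {y z : ℂ} (hy : y ∈ gridSquare n c)
    (h : dist z y ≤ δ) : GridNear n c δ z := by
  rw [dist_eq_norm] at h
  have h1 := abs_le.1 ((Complex.abs_re_le_norm (z - y)).trans h)
  have h2 := abs_le.1 ((Complex.abs_im_le_norm (z - y)).trans h)
  rw [Complex.sub_re] at h1
  rw [Complex.sub_im] at h2
  obtain ⟨a, b, c, d⟩ := hy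
  refine ⟨⟨?_, ?_⟩, ?_, ?_⟩ <;> linarith [h1.1, h1.2, h2.1, h2.2]

theorem exists_clamp {l r x δ : ℝ} (hlr : l ≤ r) (h1 : l ≤ x + δ) (h2 : x ≤ r + δ) (hδ : 0 ≤ δ) :
    ∃ y, l ≤ y ∧ y ≤ r ∧ |x - y| ≤ δ := by
  rcases le_total x l with h | h
  · exact ⟨l, le_rfl, hlr, by rw [abs_le]; constructor <;> linarith⟩
  rcases le_total x r with h' | h'
  · exact ⟨x, h, h', by simpa using hδ⟩
  · exact ⟨r, hlr, le_rfl, by rw [abs_le]; constructor <;> linarith⟩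

theorem GridNear.exists_dist_le {n : ℕ} {c : ℤ × ℤ} {δ : ℝ} {z : ℂ} (hδ : 0 ≤ δ)
    (h : GridNear n c δ z) : ∃ y ∈ gridSquare n c, dist z y ≤ 2 * δ := by
  have hle : ∀ i : ℤ, (i : ℝ) / 2 ^ n ≤ ((i : ℝ) + 1) / 2 ^ n := fun i => by gcongr; linarith
  obtain ⟨x, hx1, hx2, hx⟩ := exists_clamp (hle _) h.1.1 h.1.2 hδ
  obtain ⟨y, hy1, hy2, hy⟩ := exists_clamp (hle _) h.2.1 h.2.2 hδ
  refine ⟨⟨x, y⟩, ⟨hx1, hx2, hy1, hy2⟩, ?_⟩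
  rw [dist_eq_norm]
  refine (Complex.norm_le_abs_re_add_abs_im _).trans ?_
  simp only [Complex.sub_re, Complex.sub_im]
  linarith

/-- The value of the discrete Laplacian of `w` at `q`. -/
def discreteLaplacian {R : Type*} [Ring R] (w : ℤ × ℤ → R) (q : ℤ × ℤ) : R :=
  w (q.1 + 1, q.2) + w (q.1 - 1, q.2) + w (q.1, q.2 + 1) + w (q.1, q.2 - 1) - 4 * w q

/-- The discrete maximum principle, with an error term. -/
theorem le_of_discreteLaplacian {G : Set (ℤ × ℤ)} (hG : G.Finite) {e : ℤ × ℤ → ℝ} {B κ l R : ℝ}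
    (hl : 0 ≤ l) (hκ : κ < 4 * l)
    (h : ∀ q ∈ G, e q ≤ B ∨ (((q.1 + 1, q.2) ∈ G ∧ (q.1 - 1, q.2) ∈ G ∧ (q.1, q.2 + 1) ∈ G ∧
      (q.1, q.2 - 1) ∈ G) ∧ -κ ≤ discreteLaplacian e q))
    (hR : ∀ q ∈ G, (q.1 : ℝ) ^ 2 + (q.2 : ℝ) ^ 2 ≤ R) : ∀ q ∈ G, e q ≤ B + l * R := by
  intro q hq
  -- The function `|q| ^ 2` has discrete Laplacian `4`. So the Laplacian of `f` is at least `4 * l -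
  -- κ > 0` at points of the second kind, and no maximum occurs there.
  set f : ℤ × ℤ → ℝ := fun q => e q + l * ((q.1 : ℝ) ^ 2 + (q.2 : ℝ) ^ 2) with hf
  obtain ⟨p, hp, hmax⟩ := hG.exists_maximalFor f G ⟨q, hq⟩
  have hmax' : ∀ x ∈ G, f x ≤ f p := fun x hx => by
    rcases le_total (f x) (f p) with h | h
    · exact h
    · exact hmax hx h
  have hpq := hmax' q hq
  have hlq : 0 ≤ l * ((q.1 : ℝ) ^ 2 + (q.2 : ℝ) ^ 2) := by positivity
  have hlp : l * ((p.1 : ℝ) ^ 2 + (p.2 : ℝ) ^ 2) ≤ l * R := mul_le_mul_of_nonneg_left (hR p hp) hl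
  rcases h p hp with h1 | ⟨⟨n1, n2, n3, n4⟩, h2⟩
  · simp only [hf] at hpq
    linarith
  · have m1 := hmax' _ n1
    have m2 := hmax' _ n2
    have m3 := hmax' _ n3
    have m4 := hmax' _ n4
    simp only [hf, Int.cast_add, Int.cast_sub, Int.cast_one] at m1 m2 m3 m4
    unfold discreteLaplacian at h2
    nlinarith

/-- The decay estimate for `u - t - η` and `t - u - η`. Both are at most `2 * 2 ^ M`, since `t` is
within `η` of `φ a`. -/
theorem IsTwoSidedSolution.abs_sub_le {K : Set ℂ} {φ u : ℂ → ℝ} {b M A₀ A : ℕ}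
    (h : IsTwoSidedSolution K φ u b M A₀) (hA : A₀ ≤ A) {a : ℂ} (ha : a ∈ K) {t η : ℝ}
    (hη : ∀ y ∈ K, dist y a < 1 / 2 ^ (A + 1) → |φ y - t| ≤ η) (j : ℕ) {z : ℂ}
    (hz : dist z a < 1 / 2 ^ (A + 1) / 16 ^ j) :
    |u z - t| ≤ η + (3 / 4) ^ j * (2 * 2 ^ M) := by
  set V := ball (0 : ℂ) (2 ^ (b + 2)) \ K with hV
  set r : ℝ := 1 / 2 ^ (A + 1) with hr
  have hr0 : 0 < r := by positivity
  have hr1 : r ≤ 1 := by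
    rw [hr, div_le_one (by positivity)]; exact one_le_pow₀ one_le_two
  have hball : ball a r ⊆ ball 0 (2 ^ (b + 2)) := by
    intro y hy
    have h1 := h.subset ha
    rw [mem_closedBall] at h1
    rw [mem_ball] at hy ⊢
    have h2 : (0 : ℝ) < 2 ^ b := by positivity
    have h3 : (2 : ℝ) ^ (b + 2) = 4 * 2 ^ b := by ring
    linarith [dist_triangle y a 0]
  have hrA : r ≤ 1 / 2 ^ A₀ := by
    rw [hr]; gcongr
    · norm_num
    · omega
  have hVo : IsOpen V := isOpen_ball.sdiff h.isCompact.isClosed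
  have haV : a ∉ V := fun h' => h'.2 ha
  have huc : ContinuousOn u (ball a r) := h.continuousOn.mono (hball.trans ball_subset_closedBall)
  have hη0 := hη a ha (by rw [dist_self]; exact hr0)
  have hta := abs_le.1 hη0
  have hφa := abs_le.1 (h.bound a (ball_subset_closedBall (hball (mem_ball_self hr0))))
  rw [h.boundary a ha] at hφa
  have hout : ∀ y ∈ ball a r, y ∉ V → |u y - t| ≤ η := by
    intro y hy hyV
    have hyK : y ∈ K := by
      by_contra hn
      exact hyV ⟨hball hy, hn⟩
    rw [h.boundary y hyK]
    exact hη y hyK (mem_ball.1 hy)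
  have hM : ∀ y ∈ ball a r, |u y| ≤ 2 ^ M := fun y hy =>
    h.bound y (ball_subset_closedBall (hball hy))
  have k1 := subharm_le_pow (f := fun y => u y - (t + η)) (M := 2 * 2 ^ M) hVo haV
    ((h.nonThin a ha).mono hrA) (huc.sub continuousOn_const)
    (fun y hy => (h.harmonic y hy.1).subharmAt.sub_const _)
    (fun y hy hyV => by linarith [(abs_le.1 (hout y hy hyV)).2])
    (fun y hy => by linarith [(abs_le.1 (hM y hy)).2, hta.1, hφa.1]) (by positivity) j z hz
  have k2 := subharm_le_pow (f := fun y => (-u) y - (η - t)) (M := 2 * 2 ^ M) hVo haV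
    ((h.nonThin a ha).mono hrA) (huc.neg.sub continuousOn_const)
    (fun y hy => (HarmonicAt.neg (h.harmonic y hy.1)).subharmAt.sub_const _)
    (fun y hy hyV => by
      simp only [Pi.neg_apply]; linarith [(abs_le.1 (hout y hy hyV)).1])
    (fun y hy => by
      simp only [Pi.neg_apply]
      linarith [(abs_le.1 (hM y hy)).1, hta.2, hφa.2]) (by positivity) j z hz
  simp only [Pi.neg_apply] at k2
  rw [abs_le]
  constructor <;> linarith

theorem three_quarters_pow_le (i : ℕ) : (3 / 4 : ℝ) ^ (3 * i) ≤ 1 / 2 ^ i := by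
  rw [pow_mul, one_div, ← inv_pow]
  gcongr
  norm_num

theorem dyadicPoint_add (m : ℕ) (q : ℤ × ℤ) :
    dyadicPoint m (q.1 + 1, q.2) = dyadicPoint m q + ((1 / 2 ^ m : ℝ) : ℂ) ∧
    dyadicPoint m (q.1 - 1, q.2) = dyadicPoint m q - ((1 / 2 ^ m : ℝ) : ℂ) ∧
    dyadicPoint m (q.1, q.2 + 1) = dyadicPoint m q + ((1 / 2 ^ m : ℝ) : ℂ) * Complex.I ∧
    dyadicPoint m (q.1, q.2 - 1) = dyadicPoint m q - ((1 / 2 ^ m : ℝ) : ℂ) * Complex.I := by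
  refine ⟨?_, ?_, ?_, ?_⟩ <;>
  · apply Complex.ext <;>
    · simp only [dyadicPoint, Complex.add_re, Complex.add_im, Complex.sub_re, Complex.sub_im,
        Complex.mul_re, Complex.mul_im, Complex.ofReal_re, Complex.ofReal_im, Complex.I_re,
        Complex.I_im]
      push_cast
      ring

/-- The grid points of level `m` in the square of half side `2 ^ b`. -/
def InBox (b m : ℕ) (q : ℤ × ℤ) : Prop :=
  |q.1| ≤ 2 ^ (b + m) ∧ |q.2| ≤ 2 ^ (b + m)

theorem inBox_of_norm_le {b m : ℕ} {q : ℤ × ℤ} (h : ‖dyadicPoint m q‖ ≤ 2 ^ b) : InBox b m q := by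
  have h1 := (Complex.abs_re_le_norm _).trans h
  have h2 := (Complex.abs_im_le_norm _).trans h
  have key : ∀ i : ℤ, |(i : ℝ) / 2 ^ m| ≤ 2 ^ b → |i| ≤ 2 ^ (b + m) := by
    intro i hi
    rw [abs_div, abs_of_pos (show (0 : ℝ) < 2 ^ m by positivity), div_le_iff₀ (by positivity),
      ← pow_add] at hi
    exact_mod_cast hi
  exact ⟨key _ h1, key _ h2⟩

theorem InBox.norm_le {b m : ℕ} {q : ℤ × ℤ} (h : InBox b m q) :
    ‖dyadicPoint m q‖ ≤ 2 * 2 ^ b := by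
  refine (Complex.norm_le_abs_re_add_abs_im _).trans ?_
  have key : ∀ i : ℤ, |i| ≤ 2 ^ (b + m) → |(i : ℝ) / 2 ^ m| ≤ 2 ^ b := by
    intro i hi
    rw [abs_div, abs_of_pos (show (0 : ℝ) < 2 ^ m by positivity), div_le_iff₀ (by positivity),
      ← pow_add]
    exact_mod_cast hi
  have h1 := key _ h.1
  have h2 := key _ h.2
  simp only [dyadicPoint]
  linarith

theorem finite_inBox (b m : ℕ) : {q | InBox b m q}.Finite := by
  refine ((Set.finite_Icc (-(2 ^ (b + m) : ℤ)) (2 ^ (b + m))).prod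
    (Set.finite_Icc (-(2 ^ (b + m) : ℤ)) (2 ^ (b + m)))).subset fun q hq => ?_
  exact ⟨abs_le.1 hq.1, abs_le.1 hq.2⟩

/-- The grid point `q` of level `m` is close to the set of squares `L` of level `N`. -/
def CloseTo (N m : ℕ) (L : List (ℤ × ℤ)) (q : ℤ × ℤ) : Prop :=
  ∃ c ∈ L, GridNear N c (1 / 2 ^ N) (dyadicPoint m q)

section Clear
variable {K : Set ℂ} {φ u : ℂ → ℝ} {b M A₀ : ℕ} {C : ℕ → List (ℤ × ℤ)} {N m : ℕ} {q : ℤ × ℤ}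

theorem CloseTo.exists_dist_le (hC : IsComputableApproximation K C) (h : CloseTo N m (C N) q) :
    ∃ a ∈ K, dist (dyadicPoint m q) a ≤ 6 / 2 ^ N := by
  obtain ⟨c, hc, hn⟩ := h
  obtain ⟨y, hy, hd⟩ := hn.exists_dist_le (by positivity)
  obtain ⟨a, ha, hya⟩ := hC.close N y (mem_biUnion (show c ∈ {c | c ∈ C N} from hc) hy)
  refine ⟨a, ha, ?_⟩
  have := dist_triangle (dyadicPoint m q) y a
  have e : (6 : ℝ) / 2 ^ N = 2 * (1 / 2 ^ N) + 4 / 2 ^ N := by ring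
  linarith

/-- The other half of the dichotomy: a grid point is either within `6 / 2 ^ N` of `K` or the centre
of a disc of radius `1 / 2 ^ N` that misses `K`. -/
theorem disjoint_of_not_closeTo (hC : IsComputableApproximation K C) (h : ¬ CloseTo N m (C N) q) :
    ∀ y ∈ closedBall (dyadicPoint m q) (1 / 2 ^ N), y ∉ K := by
  intro y hy hyK
  obtain ⟨c, hc, hyc⟩ := mem_iUnion₂.1 (hC.covers N hyK)
  exact h ⟨c, hc, gridNear_of_dist_le hyc (by rw [dist_comm]; exact hy)⟩

theorem InBox.closedBall_subset (hq : InBox b m q) :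
    closedBall (dyadicPoint m q) (1 / 2 ^ N) ⊆ ball 0 (2 ^ (b + 2)) := by
  intro y hy
  rw [mem_closedBall] at hy
  rw [mem_ball]
  have h1 := hq.norm_le
  rw [← dist_zero_right] at h1
  have h2 : (1 : ℝ) ≤ 2 ^ b := one_le_pow₀ one_le_two
  have h3 : (2 : ℝ) ^ (b + 2) = 4 * 2 ^ b := by ring
  have h4 : 1 / (2 : ℝ) ^ N ≤ 1 := by
    rw [div_le_one (by positivity)]; exact one_le_pow₀ one_le_two
  linarith [dist_triangle y (dyadicPoint m q) 0]

theorem IsTwoSidedSolution.harmonicContOnCl (h : IsTwoSidedSolution K φ u b M A₀)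
    (hC : IsComputableApproximation K C) (hq : InBox b m q) (hf : ¬ CloseTo N m (C N) q) :
    HarmonicContOnCl u (ball (dyadicPoint m q) (1 / 2 ^ N)) ∧
      ∀ z ∈ sphere (dyadicPoint m q) (1 / 2 ^ N), |u z| ≤ 2 ^ M := by
  have hsub : closedBall (dyadicPoint m q) (1 / 2 ^ N) ⊆ ball 0 (2 ^ (b + 2)) := hq.closedBall_subset
  refine ⟨⟨fun y hy => h.harmonic y ⟨hsub (ball_subset_closedBall hy),
    disjoint_of_not_closeTo hC hf y (ball_subset_closedBall hy)⟩, ?_⟩, fun z hz =>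
      h.bound z (ball_subset_closedBall (hsub (sphere_subset_closedBall hz)))⟩
  exact h.continuousOn.mono
    (closure_ball_subset_closedBall.trans (hsub.trans ball_subset_closedBall))

theorem IsTwoSidedSolution.abs_discreteLaplacian_le (h : IsTwoSidedSolution K φ u b M A₀)
    (hC : IsComputableApproximation K C) (hq : InBox b m q) (hf : ¬ CloseTo N m (C N) q)
    (hNm : N < m) :
    |discreteLaplacian (fun q => u (dyadicPoint m q)) q| ≤ 16 * (2 ^ N / 2 ^ m) ^ 4 * 2 ^ M := by
  obtain ⟨h1, h2⟩ := h.harmonicContOnCl hC hq hf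
  obtain ⟨e1, e2, e3, e4⟩ := dyadicPoint_add m q
  have h3 : (1 : ℝ) / 2 ^ m ≤ 1 / 2 ^ N / 2 := by
    rw [div_div, ← pow_succ]
    gcongr
    · norm_num
    · omega
  have := abs_discreteLaplacian_le_of_harmonic (by positivity) h1 h2 (by positivity) h3
  simp only [discreteLaplacian, e1, e2, e3, e4]
  convert this using 4
  field_simp

end Clear

/-! ### From discrete conditions to closeness to the solution -/

section Soundness
variable {K U : Set ℂ} {φ u : ℂ → ℝ} {b M A₀ A n j : ℕ} {C : ℕ → List (ℤ × ℤ)} {N m : ℕ} {q : ℤ × ℤ}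

/-- The choice of `N` gives `16 / 2 ^ N = 1 / 2 ^ (A + 1) / 16 ^ j`. As `6 + 1 < 16`, the point `z`
lies in the small disc of the decay estimate around a point `a` of `K`. Squares meeting `K` within
`1 / 2 ^ (A + 1)` of `a` are within `1 / 2 ^ A` of the grid point, hence subject to `hη`. -/
theorem IsTwoSidedSolution.abs_sub_le_of_closeTo (h : IsTwoSidedSolution K φ u b M A₀)
    (hC : IsComputableApproximation K C) (hA : A₀ ≤ A) {ψ : ℤ × ℤ → ℝ} {ε : ℝ}
    (hψ : ∀ c ∈ C n, ∀ y ∈ K ∩ gridSquare n c, |ψ c - φ y| ≤ ε) {t η : ℝ}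
    (hN : N = A + 4 * j + 5) (hcl : CloseTo N m (C N) q)
    (hη : ∀ c ∈ C n, GridNear n c (1 / 2 ^ A) (dyadicPoint m q) → |t - ψ c| ≤ η) {z : ℂ}
    (hz : dist z (dyadicPoint m q) ≤ 1 / 2 ^ N) :
    |u z - t| ≤ η + ε + (3 / 4) ^ j * (2 * 2 ^ M) := by
  obtain ⟨a, ha, hd⟩ := hcl.exists_dist_le hC
  have e0 : (2 : ℝ) ^ N = 2 ^ A * 16 ^ j * 32 := by
    rw [hN, pow_add, pow_add, pow_mul]; norm_num
  have e1 : (1 : ℝ) / 2 ^ (A + 1) / 16 ^ j = 16 / 2 ^ N := by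
    rw [e0, pow_succ]; field_simp; norm_num
  have hN0 : (0 : ℝ) < 1 / 2 ^ N := by positivity
  have e6 : (6 : ℝ) / 2 ^ N = 6 * (1 / 2 ^ N) := by ring
  have e16 : (16 : ℝ) / 2 ^ N = 16 * (1 / 2 ^ N) := by ring
  have e2 : (16 : ℝ) / 2 ^ N ≤ 1 / 2 ^ (A + 1) := by
    rw [← e1]
    exact div_le_self (by positivity) (one_le_pow₀ (by norm_num))
  have e3 : (1 : ℝ) / 2 ^ A = 2 * (1 / 2 ^ (A + 1)) := by rw [pow_succ]; field_simp
  refine h.abs_sub_le hA ha (η := η + ε) (fun y hy hya => ?_) j ?_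
  · obtain ⟨c, hc, hyc⟩ := mem_iUnion₂.1 (hC.covers n hy)
    have h1 := hψ c hc y ⟨hy, hyc⟩
    have h2 := hη c hc (gridNear_of_dist_le hyc (by
      have := dist_triangle_right (dyadicPoint m q) y a
      linarith))
    rw [abs_le] at h1 h2 ⊢
    constructor <;> linarith [h1.1, h1.2, h2.1, h2.2]
  · rw [e1]
    linarith [dist_triangle z (dyadicPoint m q) a]

theorem closedBall_subset_of_not_closeTo (hUo : IsOpen U) (hC : IsComputableApproximation (frontier U) C)
    (h : ¬ CloseTo N m (C N) q) {z : ℂ} (hz : z ∈ closedBall (dyadicPoint m q) (1 / 2 ^ N))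
    (hzU : z ∈ U) : closedBall (dyadicPoint m q) (1 / 2 ^ N) ⊆ U := by
  refine (convex_closedBall _ _).isPreconnected.subset_left_of_subset_union hUo
    isClosed_closure.isOpen_compl (disjoint_compl_right.mono_left subset_closure) (fun y hy => ?_)
    ⟨z, hz, hzU⟩
  by_contra hn
  rw [mem_union, not_or, mem_compl_iff, not_not] at hn
  exact disjoint_of_not_closeTo hC h y hy (hUo.frontier_eq ▸ ⟨hn.2, hn.1⟩)

/-- The discrete maximum principle for `±(u - w)` on the grid points of `U`. Those not close to the
frontier have all four neighbours in `U`; the others are controlled by `hnear`. -/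
theorem IsTwoSidedSolution.abs_sub_le_of_discreteLaplacian
    (h : IsTwoSidedSolution (frontier U) φ u b M A₀)
    (hUo : IsOpen U)
    (hC : IsComputableApproximation (frontier U) C) (hU : closure U ⊆ closedBall 0 (2 ^ b - 1))
    (hNm : N < m) {w : ℤ × ℤ → ℝ} {B κ l : ℝ}
    (hnear : ∀ q, InBox b m q → CloseTo N m (C N) q →
      ∀ z, dist z (dyadicPoint m q) ≤ 1 / 2 ^ N → |u z - w q| ≤ B)
    (hfar : ∀ q, InBox b m q → ¬ CloseTo N m (C N) q → |discreteLaplacian w q| ≤ κ)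
    (hl : 0 ≤ l) (hκ : κ + 16 * (2 ^ N / 2 ^ m) ^ 4 * 2 ^ M < 4 * l)
    (hq : dyadicPoint m q ∈ U) : |u (dyadicPoint m q) - w q| ≤ B + l * 4 ^ (m + b) := by
  set G : Set (ℤ × ℤ) := {q | dyadicPoint m q ∈ U} with hG
  have hnorm : ∀ q ∈ G, ‖dyadicPoint m q‖ ≤ 2 ^ b := fun q hq => by
    have := hU (subset_closure hq)
    rw [mem_closedBall, dist_zero_right] at this
    linarith
  have hbox : ∀ q ∈ G, InBox b m q := fun q hq => inBox_of_norm_le (hnorm q hq)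
  have hGf : G.Finite := (finite_inBox b m).subset hbox
  have hR : ∀ q ∈ G, (q.1 : ℝ) ^ 2 + (q.2 : ℝ) ^ 2 ≤ 4 ^ (m + b) := by
    intro q hq
    have h1 := pow_le_pow_left₀ (norm_nonneg _) (hnorm q hq) 2
    rw [Complex.sq_norm, Complex.normSq_apply] at h1
    simp only [dyadicPoint] at h1
    rw [← sub_nonneg] at h1 ⊢
    have h2 := mul_nonneg h1 (show (0 : ℝ) ≤ (2 ^ m) ^ 2 by positivity)
    have e : (4 : ℝ) ^ (m + b) = (2 ^ m) ^ 2 * (2 ^ b) ^ 2 := by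
      rw [pow_add, ← pow_mul, ← pow_mul, mul_comm m, mul_comm b, pow_mul, pow_mul]; norm_num
    rw [e]
    have hm : (2 : ℝ) ^ m ≠ 0 := by positivity
    have e2 : ∀ x : ℝ, x / 2 ^ m * (x / 2 ^ m) * (2 ^ m) ^ 2 = x ^ 2 := fun x => by field_simp
    nlinarith [e2 q.1, e2 q.2]
  have hdist : (1 : ℝ) / 2 ^ m ≤ 1 / 2 ^ N := by gcongr; norm_num
  have hnb : ∀ q ∈ G, ¬ CloseTo N m (C N) q → (q.1 + 1, q.2) ∈ G ∧ (q.1 - 1, q.2) ∈ G ∧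
      (q.1, q.2 + 1) ∈ G ∧ (q.1, q.2 - 1) ∈ G := by
    intro q hq hcl
    have hs := closedBall_subset_of_not_closeTo hUo hC hcl (mem_closedBall_self (by positivity)) hq
    obtain ⟨e1, e2, e3, e4⟩ := dyadicPoint_add m q
    have hn : ‖((1 / 2 ^ m : ℝ) : ℂ)‖ ≤ 1 / 2 ^ N := by
      rw [Complex.norm_real, Real.norm_of_nonneg (by positivity)]; exact hdist
    refine ⟨hs ?_, hs ?_, hs ?_, hs ?_⟩ <;> rw [mem_closedBall, dist_eq_norm]
    · rw [e1, add_sub_cancel_left]; exact hn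
    · rw [e2, sub_sub_cancel_left, norm_neg]; exact hn
    · rw [e3, add_sub_cancel_left, norm_mul, Complex.norm_I, mul_one]; exact hn
    · rw [e4, sub_sub_cancel_left, norm_neg, norm_mul, Complex.norm_I, mul_one]; exact hn
  have hptN : ∀ q : ℤ × ℤ, dist (dyadicPoint m q) (dyadicPoint m q) ≤ 1 / 2 ^ N := fun q => by
    rw [dist_self]; positivity
  have k1 := le_of_discreteLaplacian hGf (e := fun q => u (dyadicPoint m q) - w q) (B := B) hl hκ
    (fun q hq => by
      by_cases hcl : CloseTo N m (C N) q
      · exact Or.inl (abs_le.1 (hnear q (hbox q hq) hcl _ (hptN q))).2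
      · refine Or.inr ⟨hnb q hq hcl, ?_⟩
        have a1 := abs_le.1 (h.abs_discreteLaplacian_le hC (hbox q hq) hcl hNm)
        have a2 := abs_le.1 (hfar q (hbox q hq) hcl)
        simp only [discreteLaplacian] at a1 a2 ⊢
        linarith [a1.1, a2.2]) hR q hq
  have k2 := le_of_discreteLaplacian hGf (e := fun q => w q - u (dyadicPoint m q)) (B := B) hl hκ
    (fun q hq => by
      by_cases hcl : CloseTo N m (C N) q
      · exact Or.inl (by linarith [(abs_le.1 (hnear q (hbox q hq) hcl _ (hptN q))).1])
      · refine Or.inr ⟨hnb q hq hcl, ?_⟩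
        have a1 := abs_le.1 (h.abs_discreteLaplacian_le hC (hbox q hq) hcl hNm)
        have a2 := abs_le.1 (hfar q (hbox q hq) hcl)
        simp only [discreteLaplacian] at a1 a2 ⊢
        linarith [a1.2, a2.1]) hR q hq
  rw [abs_le]
  constructor <;> linarith

/-- If `q` is close to the frontier, `hnear` already covers `z`. Otherwise the disc around `q` lies
in `U`, and the Lipschitz estimate passes from the grid point to `z`. -/
theorem IsTwoSidedSolution.abs_sub_le_of_dist_le
    (h : IsTwoSidedSolution (frontier U) φ u b M A₀) (hUo : IsOpen U)
    (hC : IsComputableApproximation (frontier U) C) (hU : closure U ⊆ closedBall 0 (2 ^ b - 1))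
    (hNm : N < m) {w : ℤ × ℤ → ℝ} {B κ l : ℝ}
    (hnear : ∀ q, InBox b m q → CloseTo N m (C N) q →
      ∀ z, dist z (dyadicPoint m q) ≤ 1 / 2 ^ N → |u z - w q| ≤ B)
    (hfar : ∀ q, InBox b m q → ¬ CloseTo N m (C N) q → |discreteLaplacian w q| ≤ κ)
    (hl : 0 ≤ l) (hκ : κ + 16 * (2 ^ N / 2 ^ m) ^ 4 * 2 ^ M < 4 * l) {z : ℂ} (hz : z ∈ closure U)
    (hq : dist z (dyadicPoint m q) ≤ 1 / 2 ^ m) :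
    |u z - w q| ≤ B + l * 4 ^ (m + b) + 4 * (2 ^ N / 2 ^ m) * 2 ^ M := by
  have hdist : (1 : ℝ) / 2 ^ m ≤ 1 / 2 ^ N / 2 := by
    rw [div_div, ← pow_succ]
    gcongr
    · norm_num
    · omega
  have hN0 : (0 : ℝ) < 1 / 2 ^ N := by positivity
  have hqb : InBox b m q := by
    refine inBox_of_norm_le ?_
    have h1 := hU hz
    rw [mem_closedBall] at h1
    have h2 : (1 : ℝ) / 2 ^ m ≤ 1 := by
      rw [div_le_one (by positivity)]; exact one_le_pow₀ one_le_two
    rw [← dist_zero_right]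
    linarith [dist_triangle_left (dyadicPoint m q) 0 z]
  by_cases hcl : CloseTo N m (C N) q
  · have h1 := hnear q hqb hcl z (by linarith)
    have h2 : 0 ≤ l * 4 ^ (m + b) := by positivity
    have h3 : (0 : ℝ) ≤ 4 * (2 ^ N / 2 ^ m) * 2 ^ M := by positivity
    linarith
  · have hzb : z ∈ closedBall (dyadicPoint m q) (1 / 2 ^ N) := by
      rw [mem_closedBall]; linarith
    have hzU : z ∈ U := by
      by_contra hn
      exact disjoint_of_not_closeTo hC hcl z hzb (hUo.frontier_eq ▸ ⟨hz, hn⟩)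
    have hs := closedBall_subset_of_not_closeTo hUo hC hcl hzb hzU
    have h1 := h.abs_sub_le_of_discreteLaplacian hUo hC hU hNm hnear hfar hl hκ
      (hs (mem_closedBall_self hN0.le))
    obtain ⟨h2, h3⟩ := h.harmonicContOnCl hC hqb hcl
    have h4 := abs_sub_le_of_harmonic hN0 h2 h3 (hq.trans hdist)
    have h5 : dist z (dyadicPoint m q) / (1 / 2 ^ N) ≤ 2 ^ N / 2 ^ m := by
      rw [div_le_iff₀ hN0]
      refine hq.trans (le_of_eq ?_)
      field_simp
    have h6 : 4 * (dist z (dyadicPoint m q) / (1 / 2 ^ N)) * 2 ^ M ≤ 4 * (2 ^ N / 2 ^ m) * 2 ^ M := by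
      gcongr
    rw [abs_le] at h1 h4 ⊢
    constructor <;> linarith [h1.1, h1.2, h4.1, h4.2]

end Soundness

/-! ### Certificates: soundness and existence -/

theorem two_pow_div_le {a b c : ℕ} (h : a + c ≤ b) : (2 : ℝ) ^ a / 2 ^ b ≤ 1 / 2 ^ c := by
  rw [div_le_div_iff₀ (by positivity) (by positivity), ← pow_add, one_mul]
  exact pow_le_pow_right₀ one_le_two h

theorem abs_div_two_pow (x : ℝ) (s : ℕ) : |x| / 2 ^ s = |x / 2 ^ s| := by
  rw [abs_div, abs_of_pos (show (0 : ℝ) < 2 ^ s by positivity)]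

theorem abs_mul_two_pow (x : ℝ) (s : ℕ) : |x| * 2 ^ s = |x * 2 ^ s| := by
  rw [abs_mul, abs_of_pos (show (0 : ℝ) < 2 ^ s by positivity)]

theorem laplacian_error_le {b k m M N s : ℕ} (hm : m = 2 * N + M + b + k + 9)
    (hs : s = 2 * m + 2 * b + k + 8) :
    16 * ((2 : ℝ) ^ N / 2 ^ m) ^ 4 * 2 ^ M ≤ 8 * (1 / 2 ^ s) := by
  have h := two_pow_div_le (a := 4 + 4 * N + M) (b := 4 * m + 3) (c := s) (by omega)
  have e : 16 * ((2 : ℝ) ^ N / 2 ^ m) ^ 4 * 2 ^ M = 8 * (2 ^ (4 + 4 * N + M) / 2 ^ (4 * m + 3)) := by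
    rw [div_pow, ← pow_mul, ← pow_mul, pow_add, pow_add, pow_add, mul_comm N, mul_comm m]
    norm_num; ring
  rw [e]
  linarith

/-- The conditions at the grid point `q` of level `m` on the integers `t` and `r`, which make
`t q / 2 ^ s` and `r q / 2 ^ k` approximate the solution of the Dirichlet problem, where
`γ c / 2 ^ s` approximates the boundary values in the squares `c` of the list `L` of level `n`, and
`L'` is the list of squares of level `N`. -/
structure IsCertificateAt (k n A N m s : ℕ) (L L' : List (ℤ × ℤ)) (γ t r : ℤ × ℤ → ℤ)
    (q : ℤ × ℤ) : Prop where
  rounding : |2 * (r q * 2 ^ (s - k) - t q)| ≤ 2 ^ (s - k)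
  near : CloseTo N m L' q → ∀ c ∈ L, GridNear n c (1 / 2 ^ A) (dyadicPoint m q) →
    |t q - γ c| ≤ 2 ^ (s - k - 3)
  far : ¬ CloseTo N m L' q → |discreteLaplacian t q| ≤ 16

section Certificates
variable {U : Set ℂ} {φ u : ℂ → ℝ} {b M A₀ A n j k s : ℕ} {C : ℕ → List (ℤ × ℤ)} {N m : ℕ}
  {γ t r : ℤ × ℤ → ℤ} {ψ : ℤ × ℤ → ℝ} {ε : ℝ}

/-- In units of `1 / 2 ^ k` the error is at most `1/4` from the boundary layer, `1/32` from the
discrete maximum principle, `1/32` from moving to `z` and `1/2` from rounding `t` to `r`. -/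
theorem IsTwoSidedSolution.abs_sub_le_of_isCertificateAt
    (h : IsTwoSidedSolution (frontier U) φ u b M A₀) (hUo : IsOpen U)
    (hC : IsComputableApproximation (frontier U) C) (hU : closure U ⊆ closedBall 0 (2 ^ b - 1))
    (hψ : ∀ c ∈ C n, ∀ y ∈ frontier U ∩ gridSquare n c, |ψ c - φ y| ≤ ε) (hε : ε ≤ 1 / 2 ^ (k + 4))
    (hA : A₀ ≤ A) (hj : j = 3 * (k + M + 7)) (hN : N = A + 4 * j + 5)
    (hm : m = 2 * N + M + b + k + 9) (hs : s = 2 * m + 2 * b + k + 8)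
    (hγ : ∀ c ∈ C n, |ψ c - (γ c : ℝ) / 2 ^ s| ≤ 1 / 2 ^ s)
    (hcert : ∀ q, InBox b m q → IsCertificateAt k n A N m s (C n) (C N) γ t r q)
    {q : ℤ × ℤ} {z : ℂ} (hz : z ∈ closure U) (hq : dist z (dyadicPoint m q) ≤ 1 / 2 ^ m) :
    |u z - (r q : ℝ) / 2 ^ k| ≤ 1 / 2 ^ k := by
  have hX : (0 : ℝ) < 1 / 2 ^ k := by positivity
  have hY : (0 : ℝ) < 1 / 2 ^ s := by positivity
  have hsp : (0 : ℝ) < 2 ^ s := by positivity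
  have hsk : (2 : ℝ) ^ (s - k) / 2 ^ s = 1 / 2 ^ k := by
    rw [div_eq_div_iff (by positivity) (by positivity), ← pow_add, one_mul]
    congr 1; omega
  have hsk3 : (2 : ℝ) ^ (s - k - 3) / 2 ^ s = 1 / 2 ^ k / 8 := by
    rw [← hsk, show s - k = s - k - 3 + 3 by omega, pow_add]; norm_num; ring
  have hk4 : (1 : ℝ) / 2 ^ (k + 4) = 1 / 2 ^ k / 16 := by rw [pow_add]; norm_num; ring
  have hk5 : (1 : ℝ) / 2 ^ (k + 5) = 1 / 2 ^ k / 32 := by rw [pow_add]; norm_num; ring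
  have hk8 : (1 : ℝ) / 2 ^ s ≤ 1 / 2 ^ k / 256 := by
    have : (1 : ℝ) / 2 ^ s ≤ 1 / 2 ^ (k + 8) := by gcongr; norm_num; omega
    rw [pow_add] at this
    refine this.trans (le_of_eq ?_)
    norm_num; ring
  have hpow : (3 / 4 : ℝ) ^ j * (2 * 2 ^ M) ≤ 1 / 2 ^ k / 64 := by
    have h1 := three_quarters_pow_le (k + M + 7)
    rw [hj]
    calc (3 / 4 : ℝ) ^ (3 * (k + M + 7)) * (2 * 2 ^ M) ≤ 1 / 2 ^ (k + M + 7) * (2 * 2 ^ M) := by gcongr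
      _ = 1 / 2 ^ k / 64 := by rw [pow_add, pow_add]; field_simp; norm_num
  have hbox : InBox b m q := by
    refine inBox_of_norm_le ?_
    have h1 := hU hz
    rw [mem_closedBall] at h1
    have h2 : (1 : ℝ) / 2 ^ m ≤ 1 := by
      rw [div_le_one (by positivity)]; exact one_le_pow₀ one_le_two
    rw [← dist_zero_right]
    linarith [dist_triangle_left (dyadicPoint m q) 0 z]
  have key := h.abs_sub_le_of_dist_le hUo hC hU (show N < m by omega)
    (w := fun q => (t q : ℝ) / 2 ^ s) (B := 1 / 2 ^ k / 4) (κ := 16 / 2 ^ s) (l := 8 / 2 ^ s)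
    (fun q hq hcl z hz => ?_) (fun q hq hcl => ?_) (by positivity) ?_ hz hq
  · have h1 : 8 / 2 ^ s * (4 : ℝ) ^ (m + b) ≤ 1 / 2 ^ k / 32 := by
      rw [← hk5]
      refine le_trans (le_of_eq ?_)
        (two_pow_div_le (a := 3 + 2 * (m + b)) (b := s) (c := k + 5) (by omega))
      rw [pow_add 2 3, pow_mul]; norm_num; ring
    have h2 : 4 * ((2 : ℝ) ^ N / 2 ^ m) * 2 ^ M ≤ 1 / 2 ^ k / 32 := by
      rw [← hk5]
      refine le_trans (le_of_eq ?_)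
        (two_pow_div_le (a := 2 + N + M) (b := m) (c := k + 5) (by omega))
      rw [pow_add, pow_add]; norm_num; ring
    have h3 : |(t q : ℝ) / 2 ^ s - r q / 2 ^ k| ≤ 1 / 2 ^ k / 2 := by
      have h4 : |2 * ((r q : ℝ) * 2 ^ (s - k) - t q)| ≤ 2 ^ (s - k) := by
        exact_mod_cast (hcert q hbox).rounding
      have h5 := div_le_div_of_nonneg_right h4 hsp.le
      rw [hsk, abs_div_two_pow] at h5
      have e : 2 * ((r q : ℝ) * 2 ^ (s - k) - t q) / 2 ^ s = 2 * (r q / 2 ^ k - t q / 2 ^ s) := by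
        have : (r q : ℝ) / 2 ^ k = r q * (2 ^ (s - k) / 2 ^ s) := by rw [hsk]; ring
        rw [this]; ring
      rw [e, abs_mul, abs_two, abs_sub_comm] at h5
      linarith
    rw [abs_le] at key h3 ⊢
    constructor <;> linarith [key.1, key.2, h3.1, h3.2]
  · have h1 := h.abs_sub_le_of_closeTo hC hA hψ (t := (t q : ℝ) / 2 ^ s)
      (η := 1 / 2 ^ k / 8 + 1 / 2 ^ s) hN hcl (fun c hc hn => ?_) hz
    · refine h1.trans ?_
      linarith
    · have h2 : |(t q : ℝ) - γ c| ≤ 2 ^ (s - k - 3) := by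
        exact_mod_cast (hcert q hq).near hcl c hc hn
      have h3 := div_le_div_of_nonneg_right h2 hsp.le
      rw [hsk3, abs_div_two_pow, sub_div] at h3
      have h4 := hγ c hc
      rw [abs_le] at h3 h4 ⊢
      constructor <;> linarith [h3.1, h3.2, h4.1, h4.2]
  · have h1 : |((discreteLaplacian t q : ℤ) : ℝ)| ≤ 16 := by exact_mod_cast (hcert q hq).far hcl
    have e : discreteLaplacian (fun q => (t q : ℝ) / 2 ^ s) q =
        (discreteLaplacian t q : ℤ) / 2 ^ s := by
      simp only [discreteLaplacian]; push_cast; ring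
    rw [e, abs_div, abs_of_pos hsp]
    gcongr
  · have h1 := laplacian_error_le hm hs
    have e1 : (16 : ℝ) / 2 ^ s = 16 * (1 / 2 ^ s) := by ring
    have e2 : (8 : ℝ) / 2 ^ s = 8 * (1 / 2 ^ s) := by ring
    rw [e1, e2]
    linarith

/-- Near the compact set, the solution is close to the approximate boundary values. -/
theorem IsTwoSidedSolution.exists_forall_gridNear {K : Set ℂ}
    (h : IsTwoSidedSolution K φ u b M A₀) {L : List (ℤ × ℤ)}
    (hψ : ∀ c ∈ L, ∀ y ∈ K ∩ gridSquare n c, |ψ c - φ y| ≤ ε) {η : ℝ} (hη : 0 < η) :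
    ∃ A₁ : ℕ, ∀ A, A₁ ≤ A → ∀ c ∈ L, ∀ z ∈ closedBall (0 : ℂ) (2 ^ (b + 2)),
      (∃ a ∈ K, dist z a ≤ 1 / 2 ^ A) → GridNear n c (1 / 2 ^ A) z → |u z - ψ c| ≤ ε + η := by
  have key : ∀ c ∈ L, ∃ A₁ : ℕ, ∀ A, A₁ ≤ A → ∀ z ∈ closedBall (0 : ℂ) (2 ^ (b + 2)),
      (∃ a ∈ K, dist z a ≤ 1 / 2 ^ A) → GridNear n c (1 / 2 ^ A) z → |u z - ψ c| ≤ ε + η := by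
    intro c hc
    set B := closedBall (0 : ℂ) (2 ^ (b + 2))
    set S : Set ℂ := B ∩ (fun z => |u z - ψ c|) ⁻¹' Ici (ε + η) with hS
    have hSc : IsCompact S := by
      refine (isCompact_closedBall _ _).of_isClosed_subset ?_ inter_subset_left
      exact (h.continuousOn.sub continuousOn_const).abs.preimage_isClosed_of_isClosed
        isClosed_closedBall isClosed_Ici
    rcases S.eq_empty_or_nonempty with hSe | hSn
    · refine ⟨0, fun A _ z hz _ _ => ?_⟩
      by_contra hn
      have : z ∈ S := ⟨hz, (not_le.1 hn).le⟩
      rw [hSe] at this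
      exact this
    rcases K.eq_empty_or_nonempty with hKe | hKn
    · refine ⟨0, fun A _ z hz ⟨a, ha, _⟩ _ => ?_⟩
      rw [hKe] at ha
      exact ha.elim
    have hQn : (gridSquare n c).Nonempty := by
      refine ⟨⟨c.1 / 2 ^ n, c.2 / 2 ^ n⟩, le_rfl, ?_, le_rfl, ?_⟩ <;>
      · simp only
        gcongr
        linarith
    -- A bad point cannot lie in both `K` and the square, where `|u - ψ c| ≤ ε`. By compactness the
    -- sum of its distances to the two is bounded below, while the two proximity conditions make
    -- this sum at most `3 / 2 ^ A`.
    obtain ⟨p, hp, hmin⟩ := hSc.exists_isMinOn hSn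
      ((continuous_infDist_pt K).add (continuous_infDist_pt (gridSquare n c))).continuousOn
    have hpos : 0 < infDist p K + infDist p (gridSquare n c) := by
      refine lt_of_le_of_ne (add_nonneg infDist_nonneg infDist_nonneg) fun h0 => ?_
      have h1 : infDist p K = 0 := by
        linarith [infDist_nonneg (x := p) (s := K), infDist_nonneg (x := p) (s := gridSquare n c)]
      have h2 : infDist p (gridSquare n c) = 0 := by linarith
      have h3 : p ∈ K := (h.isCompact.isClosed.mem_iff_infDist_zero hKn).2 h1
      have h4 : p ∈ gridSquare n c := ((isClosed_gridSquare n c).mem_iff_infDist_zero hQn).2 h2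
      have h5 := hψ c hc p ⟨h3, h4⟩
      have h6 : ε + η ≤ |u p - ψ c| := hp.2
      rw [h.boundary p h3, abs_sub_comm] at h6
      linarith
    obtain ⟨A₁, hA₁⟩ := exists_div_two_pow_lt 3 hpos
    refine ⟨A₁, fun A hA z hz ⟨a, ha, hza⟩ hn => ?_⟩
    by_contra hlt
    have hzS : z ∈ S := ⟨hz, (not_le.1 hlt).le⟩
    obtain ⟨y, hy, hzy⟩ := hn.exists_dist_le (by positivity)
    have h1 := infDist_le_dist_of_mem ha (x := z)
    have h2 := infDist_le_dist_of_mem hy (x := z)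
    have h3 : infDist p K + infDist p (gridSquare n c) ≤ infDist z K + infDist z (gridSquare n c) :=
      hmin hzS
    have h4 : (3 : ℝ) / 2 ^ A ≤ 3 / 2 ^ A₁ := by gcongr; norm_num
    have h5 : (3 : ℝ) / 2 ^ A = 3 * (1 / 2 ^ A) := by ring
    linarith
  choose! f hf using key
  refine ⟨(L.map f).sum, fun A hA c hc => hf c hc A (le_trans ?_ hA)⟩
  exact List.single_le_sum (fun _ _ => Nat.zero_le _) _ (List.mem_map_of_mem hc)

/-- The table is the rounded solution. Since `u` is harmonic on both sides of `K`, the conditions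
hold at every point of the box, inside `U` or not. -/
theorem IsTwoSidedSolution.exists_isCertificateAt {K : Set ℂ}
    (h : IsTwoSidedSolution K φ u b M A₀) (hC : IsComputableApproximation K C)
    (hε : ε ≤ 1 / 2 ^ (k + 4))
    (hnear : ∀ c ∈ C n, ∀ z ∈ closedBall (0 : ℂ) (2 ^ (b + 2)),
      (∃ a ∈ K, dist z a ≤ 1 / 2 ^ A) → GridNear n c (1 / 2 ^ A) z → |u z - ψ c| ≤ ε + 1 / 2 ^ (k + 5))
    (hj : j = 3 * (k + M + 7)) (hN : N = A + 4 * j + 5)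
    (hm : m = 2 * N + M + b + k + 9) (hs : s = 2 * m + 2 * b + k + 8)
    (hγ : ∀ c ∈ C n, |ψ c - (γ c : ℝ) / 2 ^ s| ≤ 1 / 2 ^ s) :
    ∃ t r : ℤ × ℤ → ℤ, ∀ q, InBox b m q → IsCertificateAt k n A N m s (C n) (C N) γ t r q := by
  have hsp : (0 : ℝ) < 2 ^ s := by positivity
  set t : ℤ × ℤ → ℤ := fun q => round (u (dyadicPoint m q) * 2 ^ s) with ht
  have htu : ∀ q, |u (dyadicPoint m q) * 2 ^ s - t q| ≤ 1 / 2 := fun q => abs_sub_round _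
  refine ⟨t, fun q => round ((t q : ℝ) / 2 ^ (s - k)), fun q hq => ⟨?_, fun hcl c hc hn => ?_,
    fun hcl => ?_⟩⟩
  · have h1 := abs_le.1 (abs_sub_round ((t q : ℝ) / 2 ^ (s - k)))
    have hp : (0 : ℝ) < 2 ^ (s - k) := by positivity
    have e : (t q : ℝ) = t q / 2 ^ (s - k) * 2 ^ (s - k) := by field_simp
    have h2 : |2 * ((round ((t q : ℝ) / 2 ^ (s - k)) : ℝ) * 2 ^ (s - k) - t q)| ≤ 2 ^ (s - k) := by
      rw [abs_le]
      constructor <;> nlinarith [h1.1, h1.2]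
    exact_mod_cast h2
  · have hd := hcl.exists_dist_le hC
    obtain ⟨a, ha, hd⟩ := hd
    have hd' : dist (dyadicPoint m q) a ≤ 1 / 2 ^ A := by
      refine hd.trans ?_
      calc (6 : ℝ) / 2 ^ N ≤ 2 ^ 3 / 2 ^ N := by gcongr; norm_num
        _ ≤ 1 / 2 ^ A := two_pow_div_le (by omega)
    have hzb : dyadicPoint m q ∈ closedBall (0 : ℂ) (2 ^ (b + 2)) := by
      rw [mem_closedBall, dist_zero_right, pow_add]
      have := hq.norm_le
      have h2 : (0 : ℝ) < 2 ^ b := by positivity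
      linarith
    have h1 := hnear c hc _ hzb ⟨a, ha, hd'⟩ hn
    have h2 := hγ c hc
    have h3 := abs_le.1 (htu q)
    have hP : (8 : ℝ) ≤ 2 ^ (s - k - 3) := by
      have : (2 : ℝ) ^ 3 ≤ 2 ^ (s - k - 3) := pow_le_pow_right₀ one_le_two (by omega)
      linarith
    have eP : (2 : ℝ) ^ s = 2 ^ (s - k - 3) * 8 * 2 ^ k := by
      rw [show (8 : ℝ) = 2 ^ 3 by norm_num, ← pow_add, ← pow_add]
      congr 1; omega
    have e4 : (1 : ℝ) / 2 ^ (k + 4) * 2 ^ s = 2 ^ (s - k - 3) / 2 := by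
      rw [eP, pow_add]; field_simp; norm_num
    have e5 : (1 : ℝ) / 2 ^ (k + 5) * 2 ^ s = 2 ^ (s - k - 3) / 4 := by
      rw [eP, pow_add]; field_simp; norm_num
    have k1 : |u (dyadicPoint m q) - ψ c| * 2 ^ s ≤ 2 ^ (s - k - 3) * (3 / 4) := by
      refine (mul_le_mul_of_nonneg_right (h1.trans (add_le_add_left hε _)) hsp.le).trans ?_
      linarith
    have k2 := mul_le_mul_of_nonneg_right h2 hsp.le
    rw [abs_mul_two_pow] at k1 k2
    have e6 : (γ c : ℝ) / 2 ^ s * 2 ^ s = γ c := by field_simp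
    have e7 : (1 : ℝ) / 2 ^ s * 2 ^ s = 1 := by field_simp
    rw [sub_mul, e6, e7] at k2
    rw [sub_mul] at k1
    have h9 : |(t q : ℝ) - γ c| ≤ 2 ^ (s - k - 3) := by
      rw [abs_le] at k1 k2 ⊢
      constructor <;> linarith [k1.1, k1.2, k2.1, k2.2, h3.1, h3.2]
    exact_mod_cast h9
  · have h1 := h.abs_discreteLaplacian_le hC hq hcl (show N < m by omega)
    have h2 := laplacian_error_le hm hs
    have h3 := htu q
    have h4 := htu (q.1 + 1, q.2)
    have h5 := htu (q.1 - 1, q.2)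
    have h6 := htu (q.1, q.2 + 1)
    have h7 := htu (q.1, q.2 - 1)
    have h8 := mul_le_mul_of_nonneg_right (h1.trans h2) hsp.le
    have e : 8 * (1 / (2 : ℝ) ^ s) * 2 ^ s = 8 := by field_simp
    rw [e, abs_mul_two_pow] at h8
    -- At most `8` from the Laplacian of `u` and `8 * (1 / 2)` from rounding at the five points, the
    -- centre counting four times.
    have h9 : |((discreteLaplacian t q : ℤ) : ℝ)| ≤ 16 := by
      simp only [discreteLaplacian] at h8 ⊢
      push_cast
      rw [abs_le] at *
      constructor <;> linarith [h3.1, h3.2, h4.1, h4.2, h5.1, h5.2, h6.1, h6.2, h7.1, h7.2, h8.1, h8.2]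
    exact_mod_cast h9

end Certificates

/-! ### Decidability of certificates -/

/-- The test that the grid point `q` is within `H` of the square of side `D` with index `c`. -/
def touchesBox (D H : ℤ) (c q : ℤ × ℤ) : Bool :=
  (decide (c.1 * D ≤ q.1 + H) && decide (q.1 ≤ c.1 * D + D + H)) &&
    (decide (c.2 * D ≤ q.2 + H) && decide (q.2 ≤ c.2 * D + D + H))

theorem touchesBox_iff {n A m : ℕ} (hn : n ≤ m) (hA : A ≤ m) (c q : ℤ × ℤ) :
    touchesBox (2 ^ (m - n)) (2 ^ (m - A)) c q = true ↔
      GridNear n c (1 / 2 ^ A) (dyadicPoint m q) := by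
  have key : ∀ i x : ℤ, ((i * 2 ^ (m - n) ≤ x + 2 ^ (m - A)) ↔
      (i : ℝ) / 2 ^ n ≤ (x : ℝ) / 2 ^ m + 1 / 2 ^ A) ∧
      ((x ≤ i * 2 ^ (m - n) + 2 ^ (m - n) + 2 ^ (m - A)) ↔
        (x : ℝ) / 2 ^ m ≤ ((i : ℝ) + 1) / 2 ^ n + 1 / 2 ^ A) := by
    intro i x
    have hm : (0 : ℝ) < 2 ^ m := by positivity
    have e1 : (2 : ℝ) ^ m = 2 ^ (m - n) * 2 ^ n := by rw [← pow_add]; congr 1; omega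
    have e2 : (2 : ℝ) ^ m = 2 ^ (m - A) * 2 ^ A := by rw [← pow_add]; congr 1; omega
    have f1 : ∀ y : ℝ, y / 2 ^ n = y * 2 ^ (m - n) / 2 ^ m := fun y => by rw [e1]; field_simp
    have f2 : (1 : ℝ) / 2 ^ A = 2 ^ (m - A) / 2 ^ m := by rw [e2]; field_simp
    rw [f1, f1, f2, ← add_div, ← add_div, div_le_div_iff_of_pos_right hm,
      div_le_div_iff_of_pos_right hm, add_mul, one_mul]
    constructor <;> exact_mod_cast Iff.rfl
  simp only [touchesBox, Bool.and_eq_true, decide_eq_true_eq, GridNear, dyadicPoint, key]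

/-- The test that `|x| ≤ y`. -/
def absLe (x y : ℤ) : Bool := decide (x ≤ y) && decide (-x ≤ y)

theorem absLe_iff {x y : ℤ} : absLe x y = true ↔ |x| ≤ y := by
  rw [absLe, Bool.and_eq_true, decide_eq_true_eq, decide_eq_true_eq, abs_le']

/-- The entry of index `q` of a table. -/
def tableEntry (T : List (ℤ × ℤ)) (q : ℤ × ℤ) : ℤ × ℤ := T.getD (Encodable.encode q) (0, 0)

theorem exists_tableEntry_eq {S : Set (ℤ × ℤ)} (hS : S.Finite) (f : ℤ × ℤ → ℤ × ℤ) :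
    ∃ T, ∀ q ∈ S, tableEntry T q = f q := by
  obtain ⟨B, hB⟩ := (hS.image Encodable.encode).bddAbove
  refine ⟨(List.range (B + 1)).map fun i => ((Encodable.decode i).map f).getD (0, 0), fun q hq => ?_⟩
  have h1 : Encodable.encode q < B + 1 := Nat.lt_succ_of_le (hB (mem_image_of_mem _ hq))
  simp only [tableEntry, List.getD_eq_getElem?_getD, List.getElem?_map, List.getElem?_range h1,
    Option.map_some, Encodable.encodek, Option.getD_some]

/-- The pairs of integers of absolute value at most `R`. -/
def gridBox (R : ℕ) : List (ℤ × ℤ) :=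
  (List.range (2 * R + 1)).flatMap fun i : ℕ => (List.range (2 * R + 1)).map fun l : ℕ =>
    ((i : ℤ) - R, (l : ℤ) - R)

theorem mem_gridBox {R : ℕ} {q : ℤ × ℤ} : q ∈ gridBox R ↔ |q.1| ≤ R ∧ |q.2| ≤ R := by
  simp only [gridBox, List.mem_flatMap, List.mem_range, List.mem_map, abs_le, Prod.ext_iff]
  constructor
  · rintro ⟨i, hi, l, hl, h1, h2⟩
    omega
  · rintro ⟨h1, h2⟩
    exact ⟨(q.1 + R).toNat, by omega, (q.2 + R).toNat, by omega, by omega, by omega⟩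

theorem mem_gridBox_iff_inBox {b m : ℕ} {q : ℤ × ℤ} : q ∈ gridBox (2 ^ (b + m)) ↔ InBox b m q := by
  rw [mem_gridBox, InBox]
  push_cast
  exact Iff.rfl

/-- The test of the conditions `IsCertificateAt`. -/
def certificateTest (k n A N m s : ℕ) (L L' : List (ℤ × ℤ)) (γ : ℤ × ℤ → ℤ) (T : List (ℤ × ℤ))
    (q : ℤ × ℤ) : Bool :=
  absLe (2 * ((tableEntry T q).2 * 2 ^ (s - k) - (tableEntry T q).1)) (2 ^ (s - k)) &&
    bif L'.any (fun c => touchesBox (2 ^ (m - N)) (2 ^ (m - N)) c q) then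
      L.all fun c => !touchesBox (2 ^ (m - n)) (2 ^ (m - A)) c q ||
        absLe ((tableEntry T q).1 - γ c) (2 ^ (s - k - 3))
    else absLe (discreteLaplacian (fun q => (tableEntry T q).1) q) 16

theorem certificateTest_iff {k n A N m s : ℕ} {L L' : List (ℤ × ℤ)} {γ : ℤ × ℤ → ℤ}
    {T : List (ℤ × ℤ)} {q : ℤ × ℤ} (hn : n ≤ m) (hA : A ≤ m) (hN : N ≤ m) :
    certificateTest k n A N m s L L' γ T q = true ↔ IsCertificateAt k n A N m s L L' γ
      (fun q => (tableEntry T q).1) (fun q => (tableEntry T q).2) q := by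
  have h1 : L'.any (fun c => touchesBox (2 ^ (m - N)) (2 ^ (m - N)) c q) = true ↔
      CloseTo N m L' q := by
    simp only [List.any_eq_true, touchesBox_iff hN hN, CloseTo]
  have h2 : (L.all fun c => !touchesBox (2 ^ (m - n)) (2 ^ (m - A)) c q ||
      absLe ((tableEntry T q).1 - γ c) (2 ^ (s - k - 3))) = true ↔
      ∀ c ∈ L, GridNear n c (1 / 2 ^ A) (dyadicPoint m q) →
        |(tableEntry T q).1 - γ c| ≤ 2 ^ (s - k - 3) := by
    simp only [List.all_eq_true, Bool.or_eq_true, Bool.not_eq_true', ← absLe_iff,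
      ← touchesBox_iff hn hA, ← Bool.not_eq_true, imp_iff_not_or]
  rw [certificateTest, Bool.and_eq_true, absLe_iff]
  by_cases h : CloseTo N m L' q
  · rw [h1.2 h, cond_true, h2]
    exact ⟨fun ⟨a, b⟩ => ⟨a, fun _ => b, fun h' => absurd h h'⟩, fun ⟨a, b, _⟩ => ⟨a, b h⟩⟩
  · rw [Bool.eq_false_iff.2 (fun h' => h (h1.1 h')), cond_false, absLe_iff]
    exact ⟨fun ⟨a, b⟩ => ⟨a, fun h' => absurd h' h, fun _ => b⟩, fun ⟨a, _, b⟩ => ⟨a, b h⟩⟩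

/-- The Laplacian at the edge of the box looks at neighbours outside it, so the table must be right
on the next larger box. -/
theorem IsCertificateAt.congr {k n A N m s : ℕ} {L L' : List (ℤ × ℤ)} {γ t r t' r' : ℤ × ℤ → ℤ}
    {b : ℕ} {q : ℤ × ℤ} (hq : InBox b m q) (h : IsCertificateAt k n A N m s L L' γ t r q)
    (ht : ∀ q, InBox (b + 1) m q → t' q = t q) (hr : r' q = r q) :
    IsCertificateAt k n A N m s L L' γ t' r' q := by
  have hb : ∀ x y : ℤ, |x - q.1| ≤ 1 → |y - q.2| ≤ 1 → InBox (b + 1) m (x, y) := by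
    intro x y hx hy
    have e : (2 : ℤ) ^ (b + 1 + m) = 2 * 2 ^ (b + m) := by ring
    have h1 : (1 : ℤ) ≤ 2 ^ (b + m) := one_le_pow₀ (by norm_num)
    obtain ⟨h2, h3⟩ := hq
    rw [abs_le] at *
    constructor <;> rw [abs_le] <;> constructor <;> simp only <;> omega
  have h0 := ht q (hb q.1 q.2 (by simp) (by simp))
  refine ⟨?_, ?_, ?_⟩
  · rw [hr, h0]; exact h.rounding
  · rw [h0]; exact h.near
  · have e : discreteLaplacian t' q = discreteLaplacian t q := by
      simp only [discreteLaplacian]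
      rw [h0, ht _ (hb (q.1 + 1) q.2 (by simp) (by simp)), ht _ (hb (q.1 - 1) q.2 (by simp) (by simp)),
        ht _ (hb q.1 (q.2 + 1) (by simp) (by simp)), ht _ (hb q.1 (q.2 - 1) (by simp) (by simp))]
    rw [e]; exact h.far

section Computability
variable {α : Type*} [Primcodable α]

theorem Computable.int_le {f g : α → ℤ} (hf : Computable f) (hg : Computable g) :
    Computable fun a => decide (f a ≤ g a) := Primrec.int_le.to_comp.comp hf hg

theorem Computable.int_add {f g : α → ℤ} (hf : Computable f) (hg : Computable g) :
    Computable fun a => f a + g a := Primrec.int_add.to_comp.comp hf hg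

theorem Computable.int_sub {f g : α → ℤ} (hf : Computable f) (hg : Computable g) :
    Computable fun a => f a - g a := Primrec.int_sub.to_comp.comp hf hg

theorem Computable.int_mul {f g : α → ℤ} (hf : Computable f) (hg : Computable g) :
    Computable fun a => f a * g a := Primrec.int_mul.to_comp.comp hf hg

theorem Computable.nat_add {f g : α → ℕ} (hf : Computable f) (hg : Computable g) :
    Computable fun a => f a + g a := Primrec.nat_add.to_comp.comp hf hg

theorem Computable.nat_mul {f g : α → ℕ} (hf : Computable f) (hg : Computable g) :
    Computable fun a => f a * g a := Primrec.nat_mul.to_comp.comp hf hg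

theorem Computable.nat_sub {f g : α → ℕ} (hf : Computable f) (hg : Computable g) :
    Computable fun a => f a - g a := Primrec.nat_sub.to_comp.comp hf hg

theorem Computable.int_two_pow {f : α → ℕ} (hf : Computable f) :
    Computable fun a => (2 : ℤ) ^ f a := Primrec.int_two_pow.to_comp.comp hf

theorem Computable.touchesBox {D H : α → ℤ} {c q : α → ℤ × ℤ} (hD : Computable D)
    (hH : Computable H) (hc : Computable c) (hq : Computable q) :
    Computable fun a => touchesBox (D a) (H a) (c a) (q a) := by
  have key : ∀ i x : α → ℤ, Computable i → Computable x → Computable fun a =>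
      decide (i a * D a ≤ x a + H a) && decide (x a ≤ i a * D a + D a + H a) := fun i x hi hx =>
    .bool_and (.int_le (hi.int_mul hD) (hx.int_add hH))
      (.int_le hx (((hi.int_mul hD).int_add hD).int_add hH))
  exact .bool_and (key _ _ (Computable.fst.comp hc) (Computable.fst.comp hq))
    (key _ _ (Computable.snd.comp hc) (Computable.snd.comp hq))

theorem Computable.absLe {x y : α → ℤ} (hx : Computable x) (hy : Computable y) :
    Computable fun a => absLe (x a) (y a) :=
  .bool_and (.int_le hx hy) (.int_le (Primrec.int_neg.to_comp.comp hx) hy)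

theorem Computable.tableEntry {T : α → List (ℤ × ℤ)} {q : α → ℤ × ℤ} (hT : Computable T)
    (hq : Computable q) : Computable fun a => tableEntry (T a) (q a) :=
  (Primrec.list_getD (0, 0)).to_comp.comp hT (Computable.encode.comp hq)

theorem Primrec.gridBox : Primrec gridBox := by
  have hR : Primrec fun R : ℕ => List.range (2 * R + 1) :=
    Primrec.list_range.comp (Primrec.succ.comp (Primrec.nat_mul.comp (.const 2) .id))
  refine Primrec.list_flatMap hR ?_
  refine Primrec.list_map (hR.comp .fst) ?_
  exact Primrec.pair (Primrec.int_sub_nat.comp (Primrec.snd.comp .fst) (Primrec.fst.comp .fst))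
    (Primrec.int_sub_nat.comp .snd (Primrec.fst.comp .fst))

theorem Computable.discreteLaplacian_tableEntry {T : α → List (ℤ × ℤ)} {q : α → ℤ × ℤ}
    (hT : Computable T) (hq : Computable q) :
    Computable fun a => discreteLaplacian (fun q => (_root_.tableEntry (T a) q).1) (q a) := by
  have key : ∀ x y : α → ℤ, Computable x → Computable y →
      Computable fun a => (_root_.tableEntry (T a) (x a, y a)).1 := fun x y hx hy =>
    Computable.fst.comp (hT.tableEntry (hx.pair hy))
  have h1 : Computable fun a => (q a).1 := Computable.fst.comp hq
  have h2 : Computable fun a => (q a).2 := Computable.snd.comp hq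
  have hc : ∀ x : ℤ, Computable fun _ : α => x := Computable.const
  exact ((((key _ _ (h1.int_add (hc 1)) h2).int_add (key _ _ (h1.int_sub (hc 1)) h2)).int_add
    (key _ _ h1 (h2.int_add (hc 1)))).int_add (key _ _ h1 (h2.int_sub (hc 1)))).int_sub
      ((hc 4).int_mul (key _ _ h1 h2))

theorem Computable.certificateTest {k n A N m s : α → ℕ} {L L' T : α → List (ℤ × ℤ)}
    {γ : α → ℤ × ℤ → ℤ} {q : α → ℤ × ℤ} (hk : Computable k) (hn : Computable n) (hA : Computable A)
    (hN : Computable N) (hm : Computable m) (hs : Computable s) (hL : Computable L)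
    (hL' : Computable L') (hT : Computable T) (hγ : Computable₂ γ) (hq : Computable q) :
    Computable fun a => certificateTest (k a) (n a) (A a) (N a) (m a) (s a) (L a) (L' a) (γ a) (T a)
      (q a) := by
  have hsk := (hs.nat_sub hk).int_two_pow
  have hTq := hT.tableEntry hq
  have h1 : Computable fun a => (_root_.tableEntry (T a) (q a)).1 := Computable.fst.comp hTq
  have h2 : Computable fun a => (_root_.tableEntry (T a) (q a)).2 := Computable.snd.comp hTq
  refine .bool_and (.absLe ((Computable.const (2 : ℤ)).int_mul ((h2.int_mul hsk).int_sub h1)) hsk) ?_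
  refine Computable.cond (.list_any hL' ?_) (.list_all hL ?_)
    (.absLe (hT.discreteLaplacian_tableEntry hq) (.const 16))
  · have hE := (hm.nat_sub hN).int_two_pow
    exact Computable.touchesBox (hE.comp .fst) (hE.comp .fst) .snd (hq.comp .fst)
  · refine .bool_or (.bool_not (.touchesBox ((hm.nat_sub hn).int_two_pow.comp .fst)
      ((hm.nat_sub hA).int_two_pow.comp .fst) .snd (hq.comp .fst))) ?_
    exact .absLe ((h1.comp .fst).int_sub hγ)
      (((hs.nat_sub hk).nat_sub (.const 3)).int_two_pow.comp .fst)

end Computability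

/-! ### The algorithm and the main theorem -/

theorem IsTwoSidedSolution.isComputableOn {U : Set ℂ} {φ u : ℂ → ℝ} {b M A₀ : ℕ}
    {C : ℕ → List (ℤ × ℤ)} (h : IsTwoSidedSolution (frontier U) φ u b M A₀) (hUo : IsOpen U)
    (hC : IsComputableApproximation (frontier U) C) (hU : closure U ⊆ closedBall 0 (2 ^ b - 1))
    (hφ : IsComputableCondition (frontier U) C φ) : IsComputableOn u (closure U) := by
  obtain ⟨ψ, ε, ⟨g, hg, hgψ⟩, -, ⟨mo, hmo, hmoε⟩, hψ, -⟩ := hφ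
  set n : ℕ → ℕ := fun k => mo (k + 4) with hn
  set j : ℕ → ℕ := fun k => 3 * (k + M + 7) with hj
  -- `A₀` ensures non-thinness at this scale, `n k` makes the grid of level `m` refine that of level
  -- `n`, and `e` is the free parameter of the search. The numbers `b`, `M` and `A₀` are constants
  -- built into the algorithm.
  set A : ℕ → ℕ → ℕ := fun k e => A₀ + n k + e with hA
  set N : ℕ → ℕ → ℕ := fun k e => A k e + 4 * j k + 5 with hN
  set m : ℕ → ℕ → ℕ := fun k e => 2 * N k e + M + b + k + 9 with hm
  set s : ℕ → ℕ → ℕ := fun k e => 2 * m k e + 2 * b + k + 8 with hs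
  have hε : ∀ k, ε (n k) ≤ 1 / 2 ^ (k + 4) := fun k => (abs_le.1 (hmoε (k + 4) (n k) le_rfl)).2
  have hγ : ∀ k e, ∀ c ∈ C (n k), |ψ (n k) c - (g (n k, c) (s k e) : ℝ) / 2 ^ s k e| ≤
      1 / 2 ^ s k e := fun k e c hc => hgψ (n k, c) hc (s k e)
  have hnm : ∀ k e, n k ≤ m k e := fun k e => by simp only [hm, hN, hA]; omega
  have hAm : ∀ k e, A k e ≤ m k e := fun k e => by simp only [hm, hN]; omega
  have hNm : ∀ k e, N k e ≤ m k e := fun k e => by simp only [hm]; omega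
  set test : ℕ → ℕ × List (ℤ × ℤ) → Bool := fun k p => (gridBox (2 ^ (b + m k p.1))).all fun q =>
    certificateTest k (n k) (A k p.1) (N k p.1) (m k p.1) (s k p.1) (C (n k)) (C (N k p.1))
      (fun c => g (n k, c) (s k p.1)) p.2 q with htest
  have hcn : Computable n := hmo.comp (Computable.nat_add .id (.const 4))
  have hcj : Computable j := .nat_mul (.const 3) (.nat_add (.nat_add .id (.const M)) (.const 7))
  have hcA : Computable₂ A := .nat_add (.nat_add (.const A₀) (hcn.comp .fst)) .snd
  have hcN : Computable₂ N := .nat_add (.nat_add hcA (.nat_mul (.const 4) (hcj.comp .fst))) (.const 5)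
  have hcm : Computable₂ m := .nat_add (.nat_add (.nat_add (.nat_add (.nat_mul (.const 2) hcN)
    (.const M)) (.const b)) .fst) (.const 9)
  have hcs : Computable₂ s := .nat_add (.nat_add (.nat_add (.nat_mul (.const 2) hcm)
    (.const (2 * b))) .fst) (.const 8)
  have hct : Computable₂ test := by
    have hp : Computable fun x : (ℕ × (ℕ × List (ℤ × ℤ))) × (ℤ × ℤ) => x.1.2.1 :=
      Computable.fst.comp (Computable.snd.comp .fst)
    have hk : Computable fun x : (ℕ × (ℕ × List (ℤ × ℤ))) × (ℤ × ℤ) => x.1.1 :=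
      Computable.fst.comp .fst
    refine Computable.list_all (Primrec.gridBox.to_comp.comp (Primrec.two_pow.to_comp.comp
      (.nat_add (.const b) (hcm.comp .fst (Computable.fst.comp .snd))))) ?_
    refine Computable.certificateTest hk (hcn.comp hk) (hcA.comp hk hp) (hcN.comp hk hp)
      (hcm.comp hk hp) (hcs.comp hk hp) (hC.computable.comp (hcn.comp hk))
      (hC.computable.comp (hcN.comp hk hp)) (Computable.snd.comp (Computable.snd.comp .fst)) ?_ .snd
    exact hg.comp (.pair ((hcn.comp hk).comp .fst) .snd) ((hcs.comp hk hp).comp .fst)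
  have htest_iff : ∀ k p, test k p = true ↔ ∀ q, InBox b (m k p.1) q →
      IsCertificateAt k (n k) (A k p.1) (N k p.1) (m k p.1) (s k p.1) (C (n k)) (C (N k p.1))
        (fun c => g (n k, c) (s k p.1)) (fun q => (tableEntry p.2 q).1)
        (fun q => (tableEntry p.2 q).2) q := fun k p => by
    simp only [htest, List.all_eq_true, mem_gridBox_iff_inBox,
      certificateTest_iff (hnm k p.1) (hAm k p.1) (hNm k p.1)]
  have hex : ∀ k, ∃ p, test k p = true := by
    intro k
    -- No computable bound on `A₁` is available or needed: the search runs over pairs of a parameter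
    -- and a table, and any pair passing the test is sound.
    obtain ⟨A₁, hA₁⟩ := h.exists_forall_gridNear (hψ (n k)) (η := 1 / 2 ^ (k + 5)) (by positivity)
    obtain ⟨t, r, htr⟩ := h.exists_isCertificateAt hC (hε k)
      (hA₁ (A k A₁) (by simp only [hA]; omega)) rfl rfl rfl rfl (hγ k A₁)
    obtain ⟨T, hT⟩ := exists_tableEntry_eq (finite_inBox (b + 1) (m k A₁)) fun q => (t q, r q)
    refine ⟨(A₁, T), (htest_iff k _).2 fun q hq => (htr q hq).congr hq (fun q hq => ?_) ?_⟩
    · simp only [hT q hq]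
    · have hq' : InBox (b + 1) (m k A₁) q :=
        ⟨hq.1.trans (pow_le_pow_right₀ (by norm_num) (by simp only; omega)),
          hq.2.trans (pow_le_pow_right₀ (by norm_num) (by simp only; omega))⟩
      simp only [hT q hq']
  obtain ⟨f, hf, hft⟩ := Computable.exists_search hct hex
  -- Only the term of index `m` of the name is read, where `m` is the level of the certificate
  -- found; a shorter initial segment gives `none`.
  refine ⟨fun L k => L[m k (f k).1]?.map fun q => (tableEntry (f k).2 q).2, ?_, ?_⟩
  · refine Computable.option_map (Computable.list_getElem?.comp .fst (hcm.comp .snd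
      (Computable.fst.comp (hf.comp .snd)))) ?_
    exact Computable.snd.comp (Computable.tableEntry
      (Computable.snd.comp (hf.comp (Computable.snd.comp .fst))) .snd)
  · intro z hz a ha k
    have hget : ∀ l, ((List.range l).map a)[m k (f k).1]? =
        if m k (f k).1 < l then some (a (m k (f k).1)) else none := fun l => by
      split_ifs with hl
      · rw [List.getElem?_map, List.getElem?_range hl, Option.map_some]
      · exact List.getElem?_eq_none (by simpa using hl)
    refine ⟨⟨m k (f k).1 + 1, (tableEntry (f k).2 (a (m k (f k).1))).2, ?_⟩, fun l r hr => ?_⟩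
    · simp only [hget, Nat.lt_succ_self, if_true, Option.map_some]
    · simp only [hget] at hr
      split_ifs at hr
      · rw [Option.map_some, Option.some.injEq] at hr
        rw [← hr]
        exact h.abs_sub_le_of_isCertificateAt hUo hC hU (hψ (n k)) (hε k)
          (show A₀ ≤ A k (f k).1 by simp only [hA]; omega) rfl rfl rfl rfl (hγ k (f k).1)
          ((htest_iff k (f k)).1 (hft k)) hz (ha _)
      · cases hr

theorem mainTheorem3 (U : Set ℂ) (hU_open : IsOpen U) (hU_conn : IsConnected U)
    (hU_bdd : Bornology.IsBounded U) (hU_cone : ∀ x ∈ frontier U, PoincareConeAt U x)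
    (φ : ℂ → ℝ) (C : ℕ → List (ℤ × ℤ))
    (hC : IsComputableApproximation (frontier U) C)
    (hφ : IsComputableCondition (frontier U) C φ) :
    ∃ u : ℂ → ℝ, IsDirichletSolution U φ u ∧
      (∀ v : ℂ → ℝ, IsDirichletSolution U φ v → Set.EqOn v u (closure U)) ∧
      IsComputableOn u (closure U) := by
  obtain ⟨u, b, M, A, h, hcl⟩ := exists_isTwoSidedSolution hU_open hU_conn.nonempty hU_bdd hC
    (hφ.continuousOn hC)
  have hsub : closure U ⊆ ball (0 : ℂ) (2 ^ (b + 2)) := by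
    refine hcl.trans (closedBall_subset_ball ?_)
    have h1 : (0 : ℝ) < 2 ^ b := by positivity
    rw [pow_add]
    linarith
  have hu : IsDirichletSolution U φ u := ⟨h.continuousOn.mono (hsub.trans ball_subset_closedBall),
    fun z hz => h.harmonic z ⟨hsub (subset_closure hz), fun hz' => by
      rw [hU_open.frontier_eq] at hz'; exact hz'.2 hz⟩, h.boundary⟩
  have hle : ∀ v w : ℂ → ℝ, IsDirichletSolution U φ v → IsDirichletSolution U φ w →
      ∀ z ∈ closure U, v z ≤ w z := fun v w hv hw =>
    subharm_le_harmonic hU_open hU_bdd hv.continuousOn hw.continuousOn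
      (fun z hz => (hv.harmonic z hz).subharmAt) hw.harmonic
      (fun z hz => (hv.boundary z hz).trans_le (hw.boundary z hz).ge)
  exact ⟨u, hu, fun v hv z hz => (hle v u hv hu z hz).antisymm (hle u v hu hv z hz),
    h.isComputableOn hU_open hC hcl hφ⟩
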